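/- **Conventions.** Let $k\subset K$ be a field extension. A *rigid tensor category* over a field $F$ is an $F$-linear abelian symmetric monoidal category with $F$-bilinear tensor product and unit object $I$, such that $F\to\mathrm{End}(I)$ is an isomorphism, every object has a dual and every object has finite length. A *tensor functor* is an additive symmetric (strong) monoidal functor. An object is *trivial* if it is a finite direct sum of copies of $I$. Let $\mathcal T$ be an (essentially) small rigid tensor category over $k$. A *normal $K$-quotient* of $\mathcal T$ is a rigid tensor category $\mathcal Q$ over $K$ with a $k$-linear exact tensor functor $q:\mathcal T\to\mathcal Q$ such that (i) for every $X\in\mathcal T$ the object $q(X)$ has a largest trivial subobject, and it is isomorphic to $q(X')$ for a subobject $X'\subset X$; (ii) every object of $\mathcal Q$ is isomorphic to a subobject of some $q(X)$ and to a quotient of some $q(Y)$, with $X,Y\in\mathcal T$. It is called the *base change* of $\mathcal T$, written $\mathcal T_{(K)}$ with $q(X)=X_{(K)}$, if moreover $q(X)$ is trivial exactly when $X$ is trivial. The tensor product of $\mathcal T$ extends to the ind-category $\mathrm{Ind}\text{-}\mathcal T$ by filtered colimits. A *$K$-module* in $\mathrm{Ind}\text{-}\mathcal T$ is an ind-object $M$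 with a homomorphism of $k$-algebras $K\to\mathrm{End}(M)$; with the $K$-linear morphisms these form a category $\mathrm{Ind}\text{-}\mathcal T_K$. For $K$-modules $M,N$ let $M\otimes_KN$ be the largest quotient of $M\otimes N$ on which the two actions of $K$ agree. *$\mathcal T$ is flat over $K$* if the functor $-\otimes_KN$ on $\mathrm{Ind}\text{-}\mathcal T_K$ is exact for every $N$. For $Y\in\mathcal T$ let $Y\otimes_kK$ be the $K$-module with $\mathrm{Hom}(X,Y\otimes_kK)=\mathrm{Hom}_{\mathcal T}(X,Y)\otimes_kK$ for $X\in\mathcal T$; a morphism $f:X\to Y\otimes_kK$ of ind-objects extends uniquely to a $K$-linear morphism $\hat f:X\otimes_kK\to Y\otimes_kK$. Let $\mathcal P$ be the category of triples $(X,Y,f)$ with $X,Y\in\mathcal T$ and $f:X\to Y\otimes_kK$ a morphism of $\mathrm{Ind}\text{-}\mathcal T$; morphisms from $(X_0,Y_0,f_0)$ to $(X_1,Y_1,f_1)$ are the $K$-linear morphisms $\operatorname{im}\hat f_0\to\operatorname{im}\hat f_1$. Let $(X,Y,f)\otimes(X',Y',f')=(X\otimes X',Y\otimes Y',f'')$ where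 $f''$ is $f\otimes f'$ followed by the multiplication $K\otimes_kK\to K$, and let $q':\mathcal T\to\mathcal P$ be $X\mapsto(X,X,X\to X\otimes_kK)$ (the unit of $K$), $g\mapsto g\otimes\mathrm{id}_K$. **Theorem.** Assume that the base change $q:\mathcal T\to\mathcal T_{(K)}$ exists and that $\mathcal T$ is flat over $K$. 1. For $U\in\mathcal T_{(K)}$ let $U^K$ be the ind-object of $\mathcal T$ with $\mathrm{Hom}(X,U^K)=\mathrm{Hom}_{\mathcal T_{(K)}}(X_{(K)},U)$ for $X\in\mathcal T$ (the right adjoint of $q$), with its $K$-module structure from the $K$-linear structure of $\mathcal T_{(K)}$. Then $U\mapsto U^K$ is a $K$-linear exact functor $\mathcal T_{(K)}\to\mathrm{Ind}\text{-}\mathcal T_K$, and it is a tensor functor: the canonical morphisms $U^K\otimes_KV^K\to(U\otimes V)^K$ and $I\otimes_kK\to I^K$ are isomorphisms. 2. There is a $K$-linear additive equivalence $e:\mathcal P\to\mathcal T_{(K)}$ with $e\circ q'\cong q$ and $e(X,Y,f)^K\cong\operatorname{im}\hat f$ naturally in $(X,Y,f)$; moreover $e(A\otimes B)\cong e(A)\otimes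 e(B)$ for $A,B\in\mathcal P$, and $e(q'(I))\cong I$. 3. Let $\mathcal C$ be a $K$-linear abelian symmetric monoidal category whose tensor product is $K$-bilinear and right exact in each variable (for instance, any rigid tensor category over $K$). For every $k$-linear exact tensor functor $\omega:\mathcal T\to\mathcal C$ there is a $K$-linear tensor functor $\omega_K:\mathcal T_{(K)}\to\mathcal C$ such that $\omega_K\circ q\cong\omega$ as monoidal functors. -/

import Mathlib

open CategoryTheory CategoryTheory.Limits MonoidalCategory Opposite
open scoped TensorProduct

universe v u w

set_option linter.unusedSectionVars false

noncomputable section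

namespace TensorBC

section Ind
variable {T : Type v} [SmallCategory T]

/-- Morphisms from an object `X` of `T` to the ind-object `M` are the values of `M` at `X`. -/
def elemEquiv (X : T) (M : Ind T) :
    (Ind.yoneda.obj X ⟶ M) ≃ ((Ind.inclusion T).obj M).obj (op X) :=
  (Ind.inclusion.fullyFaithful.homEquiv).trans
    (((Ind.yonedaCompInclusion.app X).homFromEquiv).trans yonedaEquiv)

lemma elemEquiv_naturality_right {X : T} {M N : Ind T} (x : Ind.yoneda.obj X ⟶ M) (f : M ⟶ N) :
    elemEquiv X N (x ≫ f) = ((Ind.inclusion T).map f).app (op X) (elemEquiv X M x) := by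
  simp [elemEquiv, Functor.FullyFaithful.homEquiv, yonedaEquiv]

lemma elemEquiv_naturality_left {X Y : T} (g : Y ⟶ X) {M : Ind T} (x : Ind.yoneda.obj X ⟶ M) :
    elemEquiv Y M (Ind.yoneda.map g ≫ x) =
      ((Ind.inclusion T).obj M).map g.op (elemEquiv X M x) := by
  have h := Ind.yonedaCompInclusion.inv.naturality g
  dsimp at h
  change yonedaEquiv (Ind.yonedaCompInclusion.inv.app Y ≫
      (Ind.inclusion T).map (Ind.yoneda.map g ≫ x)) =
    ((Ind.inclusion T).obj M).map g.op
      (yonedaEquiv (Ind.yonedaCompInclusion.inv.app X ≫ (Ind.inclusion T).map x))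
  rw [yonedaEquiv_naturality, Functor.map_comp, reassoc_of% h]

lemma ind_hom_ext {M N : Ind T} {f g : M ⟶ N}
    (h : ∀ (X : T) (x : Ind.yoneda.obj X ⟶ M), x ≫ f = x ≫ g) : f = g := by
  apply (Ind.inclusion T).map_injective
  ext Z m
  obtain ⟨Z⟩ := Z
  obtain ⟨x, rfl⟩ := (elemEquiv Z M).surjective m
  have := congrArg (elemEquiv Z N) (h Z x)
  simpa [elemEquiv_naturality_right] using this

/-- The ind-object given by a presheaf which is a filtered colimit of representable ones. -/
def indOf (A : Tᵒᵖ ⥤ Type v) (hA : IsIndObject A) : Ind T :=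
  (Ind.equivalence T).inverse.obj ⟨A, hA⟩

def indOfIso (A : Tᵒᵖ ⥤ Type v) (hA : IsIndObject A) :
    (Ind.inclusion T).obj (indOf A hA) ≅ A :=
  (ObjectProperty.ι _).mapIso ((Ind.equivalence T).counitIso.app ⟨A, hA⟩)

/-- A morphism of presheaves between ind-objects, as a morphism of ind-objects. -/
def indOfMap {A B : Tᵒᵖ ⥤ Type v} (hA : IsIndObject A) (hB : IsIndObject B) (f : A ⟶ B) :
    indOf A hA ⟶ indOf B hB :=
  Ind.inclusion.fullyFaithful.preimage ((indOfIso A hA).hom ≫ f ≫ (indOfIso B hB).inv)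

/-- Morphisms from an object `X` of `T` to the ind-object `A` are the values of `A` at `X`. -/
def indOfEquiv (A : Tᵒᵖ ⥤ Type v) (hA : IsIndObject A) (X : T) :
    (Ind.yoneda.obj X ⟶ indOf A hA) ≃ A.obj (op X) :=
  (elemEquiv X _).trans ((indOfIso A hA).app (op X)).toEquiv

lemma indOfEquiv_map {A B : Tᵒᵖ ⥤ Type v} (hA : IsIndObject A) (hB : IsIndObject B) (f : A ⟶ B)
    {X : T} (x : Ind.yoneda.obj X ⟶ indOf A hA) :
    indOfEquiv B hB X (x ≫ indOfMap hA hB f) = f.app (op X) (indOfEquiv A hA X x) := by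
  simp [indOfEquiv, elemEquiv_naturality_right, indOfMap]

lemma indOfEquiv_naturality (A : Tᵒᵖ ⥤ Type v) (hA : IsIndObject A) {X Y : T} (g : Y ⟶ X)
    (x : Ind.yoneda.obj X ⟶ indOf A hA) :
    indOfEquiv A hA Y (Ind.yoneda.map g ≫ x) = A.map g.op (indOfEquiv A hA X x) := by
  simp [indOfEquiv, elemEquiv_naturality_left]

end Ind

section Linear
variable {T : Type v} [SmallCategory T] [Abelian T]

instance : (Ind.yoneda (C := T)).Additive :=
  Functor.additive_of_preserves_binary_products _

variable {k : Type v} [Field k] [Linear k T]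

/-- Multiplication by the scalar `a` of `k` on an ind-object of a `k`-linear category. -/
def indScalar (a : k) (M : Ind T) : M ⟶ M :=
  Ind.inclusion.fullyFaithful.preimage
    { app := fun Z => ((Ind.inclusion T).obj M).map (a • 𝟙 Z.unop).op
      naturality := fun Z Z' f => by
        rw [← Functor.map_comp, ← Functor.map_comp]
        congr 1
        apply Quiver.Hom.unop_inj
        simp }

lemma comp_indScalar (a : k) {X : T} {M : Ind T} (x : Ind.yoneda.obj X ⟶ M) :
    x ≫ indScalar a M = Ind.yoneda.map (a • 𝟙 X) ≫ x := by
  apply (elemEquiv X M).injective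
  rw [elemEquiv_naturality_left, elemEquiv_naturality_right]
  simp [indScalar]

lemma indScalar_naturality (a : k) {M N : Ind T} (f : M ⟶ N) :
    indScalar a M ≫ f = f ≫ indScalar a N := by
  apply ind_hom_ext
  intro X x
  rw [← Category.assoc, comp_indScalar, ← Category.assoc, comp_indScalar, Category.assoc]

/-- The `k`-linear structure of the ind-category. -/
instance : Linear k (Ind T) where
  homModule M N :=
    { smul := fun a f => f ≫ indScalar a N
      one_smul := fun f => ind_hom_ext fun X x => by
        change x ≫ f ≫ indScalar 1 N = _
        rw [← Category.assoc, comp_indScalar]; simp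
      mul_smul := fun a b f => ind_hom_ext fun X x => by
        change x ≫ f ≫ indScalar (a * b) N = x ≫ (f ≫ indScalar b N) ≫ indScalar a N
        simp only [← Category.assoc, comp_indScalar]
        rw [← Functor.map_comp]
        simp [smul_smul, mul_comm]
      smul_zero := fun a => zero_comp
      smul_add := fun a f g => Preadditive.add_comp _ _ _ _ _ _
      add_smul := fun a b f => ind_hom_ext fun X x => by
        change x ≫ f ≫ indScalar (a + b) N = x ≫ (f ≫ indScalar a N + f ≫ indScalar b N)
        rw [Preadditive.comp_add]
        simp only [← Category.assoc, comp_indScalar]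
        simp [add_smul, Functor.map_add]
      zero_smul := fun f => ind_hom_ext fun X x => by
        change x ≫ f ≫ indScalar (0 : k) N = x ≫ 0
        rw [← Category.assoc, comp_indScalar]; simp }
  smul_comp M N P a f g := by
    change (f ≫ indScalar a N) ≫ g = (f ≫ g) ≫ indScalar a P
    rw [Category.assoc, Category.assoc, indScalar_naturality]
  comp_smul M N P f a g := by
    change f ≫ g ≫ indScalar a P = (f ≫ g) ≫ indScalar a P
    rw [Category.assoc]

lemma ind_smul_def (a : k) {M N : Ind T} (f : M ⟶ N) : a • f = f ≫ indScalar a N := rfl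

lemma yoneda_comp_smul (a : k) {X : T} {N : Ind T} (x : Ind.yoneda.obj X ⟶ N) :
    a • x = Ind.yoneda.map (a • 𝟙 X) ≫ x := comp_indScalar a x


variable {K : Type v} [Field K]

/-- The identification of `Hom(X, A)` with `A X` is additive. -/
lemma indOfEquiv_symm_add (A : Tᵒᵖ ⥤ ModuleCat.{v} K) [A.Additive]
    (hA : IsIndObject (A ⋙ forget _)) {X : T} (s t : A.obj (op X)) :
    (indOfEquiv (A ⋙ forget _) hA X).symm (s + t : A.obj (op X)) =
      (indOfEquiv (A ⋙ forget _) hA X).symm s + (indOfEquiv (A ⋙ forget _) hA X).symm t := by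
  let e := indOfEquiv (A ⋙ forget _) hA
  have nat : ∀ {X Y : T} (g : Y ⟶ X) (s : A.obj (op X)),
      Ind.yoneda.map g ≫ (e X).symm s = (e Y).symm (A.map g.op s) := by
    intro X Y g s
    apply (e Y).injective
    rw [indOfEquiv_naturality]
    change A.map g.op (e X ((e X).symm s)) = e Y ((e Y).symm (A.map g.op s))
    rw [Equiv.apply_symm_apply, Equiv.apply_symm_apply]
  let z : A.obj (op (X ⊞ X)) :=
    A.map (biprod.fst : X ⊞ X ⟶ X).op s + A.map (biprod.snd : X ⊞ X ⟶ X).op t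
  have hcomp : ∀ {X Y Z : T} (g : Y ⟶ X) (h : Z ⟶ Y) (s : A.obj (op X)),
      A.map h.op (A.map g.op s) = A.map (h ≫ g).op s := by
    intro X Y Z g h s
    simp
  have hid : ∀ {X : T} (s : A.obj (op X)), A.map (𝟙 X).op s = s := by intro X s; simp
  have hzero : ∀ {X Y : T} (s : A.obj (op X)), A.map (0 : Y ⟶ X).op s = 0 := by
    intro X Y s
    simp
  have h1 : A.map (biprod.inl : X ⟶ X ⊞ X).op z = s := by
    simp only [z, map_add, hcomp, biprod.inl_fst, biprod.inl_snd, hid, hzero, add_zero]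
  have h2 : A.map (biprod.inr : X ⟶ X ⊞ X).op z = t := by
    simp only [z, map_add, hcomp, biprod.inr_fst, biprod.inr_snd, hid, hzero, zero_add]
  have h3 : A.map (biprod.inl + biprod.inr : X ⟶ X ⊞ X).op z = s + t := by
    simp only [z, map_add, hcomp, Preadditive.add_comp, biprod.inl_fst, biprod.inl_snd,
      biprod.inr_fst, biprod.inr_snd, add_zero, zero_add, hid]
  change (e X).symm (s + t : A.obj (op X)) = (e X).symm s + (e X).symm t
  rw [← h3, ← nat, Functor.map_add, Preadditive.add_comp, nat, nat, h1, h2]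

end Linear

variable (k K : Type v) [Field k] [Field K] [Algebra k K]
variable (T : Type v) [SmallCategory T] [Abelian T] [Linear k T]

/-- A `K`-module in the ind-category of the `k`-linear category `T`: an ind-object together with
an action of the `k`-algebra `K` by endomorphisms. -/
structure IndMod where
  obj : Ind T
  act : K →ₐ[k] End obj

namespace IndMod
variable {k K T}

@[ext]
structure Hom (M N : IndMod k K T) where
  hom : M.obj ⟶ N.obj
  comm : ∀ a : K, M.act a ≫ hom = hom ≫ N.act a := by cat_disch

@[simps]
instance : Category (IndMod k K T) where
  Hom := Hom
  id M := ⟨𝟙 M.obj, fun a => (Category.comp_id _).trans (Category.id_comp _).symm⟩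
  comp f g := ⟨f.hom ≫ g.hom, fun a => by
    rw [← Category.assoc, f.comm, Category.assoc, g.comm, Category.assoc]⟩

@[ext]
lemma hom_ext {M N : IndMod k K T} {f g : M ⟶ N} (h : f.hom = g.hom) : f = g := Hom.ext h

lemma act_add (M : IndMod k K T) (a b : K) : M.act (a + b) = M.act a + M.act b := map_add _ _ _
lemma act_mul (M : IndMod k K T) (a b : K) : M.act (a * b) = M.act b ≫ M.act a := map_mul _ _ _
lemma act_one (M : IndMod k K T) : M.act 1 = 𝟙 M.obj := map_one _
lemma act_zero (M : IndMod k K T) : M.act 0 = 0 := map_zero _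
lemma act_comm (M : IndMod k K T) (a b : K) : M.act a ≫ M.act b = M.act b ≫ M.act a := by
  rw [← act_mul, ← act_mul, mul_comm]

instance (M N : IndMod k K T) : Zero (M ⟶ N) := ⟨⟨0, by simp⟩⟩
instance (M N : IndMod k K T) : Add (M ⟶ N) :=
  ⟨fun f g => ⟨f.hom + g.hom, fun a => by simp [f.comm, g.comm]⟩⟩
instance (M N : IndMod k K T) : Neg (M ⟶ N) := ⟨fun f => ⟨-f.hom, fun a => by simp [f.comm]⟩⟩
instance (M N : IndMod k K T) : Sub (M ⟶ N) :=
  ⟨fun f g => ⟨f.hom - g.hom, fun a => by simp [f.comm, g.comm]⟩⟩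
instance (M N : IndMod k K T) : SMul ℕ (M ⟶ N) :=
  ⟨fun n f => ⟨n • f.hom, fun a => by simp [f.comm]⟩⟩
instance (M N : IndMod k K T) : SMul ℤ (M ⟶ N) :=
  ⟨fun n f => ⟨n • f.hom, fun a => by simp [f.comm]⟩⟩
instance (M N : IndMod k K T) : SMul K (M ⟶ N) :=
  ⟨fun c f => ⟨f.hom ≫ N.act c, fun a => by
    rw [← Category.assoc, f.comm, Category.assoc, Category.assoc, act_comm]⟩⟩

instance (M N : IndMod k K T) : AddCommGroup (M ⟶ N) :=
  Function.Injective.addCommGroup (fun f : M ⟶ N => f.hom) (fun _ _ h => hom_ext h)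
    rfl (fun _ _ => rfl) (fun _ => rfl) (fun _ _ => rfl) (fun _ _ => rfl) (fun _ _ => rfl)

@[simp] lemma add_hom {M N : IndMod k K T} (f g : M ⟶ N) : (f + g).hom = f.hom + g.hom := rfl
@[simp] lemma zero_hom {M N : IndMod k K T} : (0 : M ⟶ N).hom = 0 := rfl
@[simp] lemma smul_hom {M N : IndMod k K T} (c : K) (f : M ⟶ N) :
    (c • f).hom = f.hom ≫ N.act c := rfl

instance : Preadditive (IndMod k K T) where
  add_comp _ _ _ _ _ _ := hom_ext (Preadditive.add_comp _ _ _ _ _ _)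
  comp_add _ _ _ _ _ _ := hom_ext (Preadditive.comp_add _ _ _ _ _ _)

instance : Linear K (IndMod k K T) where
  homModule M N :=
    { one_smul := fun f => hom_ext (by simp [act_one])
      mul_smul := fun a b f => hom_ext (by simp [act_mul])
      smul_zero := fun a => hom_ext (by simp)
      smul_add := fun a f g => hom_ext (by simp)
      add_smul := fun a b f => hom_ext (by simp only [smul_hom, act_add, add_hom]; exact Preadditive.comp_add _ _ _ _ _ _)
      zero_smul := fun f => hom_ext (by simp [act_zero]) }
  smul_comp M N P a f g := hom_ext (by
    change (f.hom ≫ N.act a) ≫ g.hom = (f.hom ≫ g.hom) ≫ P.act a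
    rw [Category.assoc, Category.assoc, g.comm])
  comp_smul M N P f a g := hom_ext (by
    change f.hom ≫ g.hom ≫ P.act a = (f.hom ≫ g.hom) ≫ P.act a
    rw [Category.assoc])


end IndMod


/-- A left exact `k`-linear functor from `Tᵒᵖ` to `K`-vector spaces. -/
structure Lex where
  F : Tᵒᵖ ⥤ ModuleCat.{v} K
  additive : F.Additive
  lex : PreservesFiniteLimits F
  map_smul : ∀ (X : T) (a : k) (s : F.obj (op X)), F.map (a • 𝟙 X).op s = algebraMap k K a • s

namespace Lex
variable {k K T}

lemma isIndObject (A : Lex k K T) : IsIndObject (A.F ⋙ forget _) := by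
  have := A.lex
  rw [isIndObject_iff_preservesFiniteLimits]
  infer_instance

/-- The ind-object underlying a left exact functor to `K`-vector spaces. -/
abbrev toInd (A : Lex k K T) : Ind T := indOf (A.F ⋙ forget _) A.isIndObject

/-- The value of a left exact functor `A` at `X` is `Hom(X, A)`. -/
def elem (A : Lex k K T) (X : T) : A.F.obj (op X) ≃ (Ind.yoneda.obj X ⟶ A.toInd) :=
  (indOfEquiv (A.F ⋙ forget _) A.isIndObject X).symm

lemma elem_add (A : Lex k K T) {X : T} (s t : A.F.obj (op X)) :
    A.elem X (s + t) = A.elem X s + A.elem X t := by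
  have := A.additive
  exact indOfEquiv_symm_add A.F A.isIndObject s t

lemma elem_zero (A : Lex k K T) {X : T} : A.elem X 0 = 0 := by
  simpa using A.elem_add (X := X) 0 0

lemma elem_naturality (A : Lex k K T) {X Y : T} (g : Y ⟶ X) (s : A.F.obj (op X)) :
    Ind.yoneda.map g ≫ A.elem X s = A.elem Y (A.F.map g.op s) := by
  apply (A.elem Y).symm.injective
  rw [Equiv.symm_apply_apply]
  refine (indOfEquiv_naturality (A.F ⋙ forget _) A.isIndObject g (A.elem X s)).trans ?_
  exact congrArg (fun t => A.F.map g.op t) ((A.elem X).symm_apply_apply s)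

/-- The morphism of ind-objects given by a morphism of functors. -/
def map {A B : Lex k K T} (f : A.F ⟶ B.F) : A.toInd ⟶ B.toInd :=
  indOfMap A.isIndObject B.isIndObject (Functor.whiskerRight f (forget _))

lemma elem_map {A B : Lex k K T} (f : A.F ⟶ B.F) {X : T} (s : A.F.obj (op X)) :
    A.elem X s ≫ map f = B.elem X (f.app (op X) s) := by
  apply (B.elem X).symm.injective
  rw [Equiv.symm_apply_apply]
  refine (indOfEquiv_map A.isIndObject B.isIndObject (Functor.whiskerRight f (forget _))
    (A.elem X s)).trans ?_
  exact congrArg (fun t => f.app (op X) t) ((A.elem X).symm_apply_apply s)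

lemma hom_ext {A : Lex k K T} {N : Ind T} {f g : A.toInd ⟶ N}
    (h : ∀ (X : T) (s : A.F.obj (op X)), A.elem X s ≫ f = A.elem X s ≫ g) : f = g :=
  ind_hom_ext fun X x => by
    obtain ⟨s, rfl⟩ := (A.elem X).surjective x
    exact h X s

/-- Multiplication by an element of `K`. -/
@[simps]
def smulNat (A : Lex k K T) (c : K) : A.F ⟶ A.F where
  app Z := ModuleCat.ofHom (c • LinearMap.id)
  naturality Z Z' f := by ext; simp

lemma elem_smulNat (A : Lex k K T) (c : K) {X : T} (s : A.F.obj (op X)) :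
    A.elem X s ≫ map (A.smulNat c) = A.elem X (c • s) := elem_map _ _

/-- The `K`-module in `Ind T` given by a left exact `k`-linear functor to `K`-vector spaces. -/
def toIndMod (A : Lex k K T) : IndMod k K T where
  obj := A.toInd
  act :=
    { toFun := fun c => map (A.smulNat c)
      map_one' := hom_ext fun X s => by
        refine Eq.trans ?_ (Category.comp_id _).symm
        rw [elem_smulNat, one_smul]
      map_mul' := fun a b => hom_ext fun X s => by
        rw [End.mul_def, ← Category.assoc, elem_smulNat, elem_smulNat, elem_smulNat, mul_smul]
      map_zero' := hom_ext fun X s => by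
        rw [elem_smulNat, zero_smul, elem_zero]
        exact comp_zero.symm
      map_add' := fun a b => hom_ext fun X s => by
        refine Eq.trans ?_ (Preadditive.comp_add _ _ _ _ _ _).symm
        rw [elem_smulNat, elem_smulNat, elem_smulNat, add_smul, elem_add]
      commutes' := fun a => hom_ext fun X s => by
        rw [elem_smulNat, ← A.map_smul, ← elem_naturality, ← yoneda_comp_smul,
          Algebra.algebraMap_eq_smul_one]
        refine Eq.trans ?_ (Linear.comp_smul _ _ _ _ _ _).symm
        exact congrArg (a • ·) (Category.comp_id (A.elem X s)).symm }

/-- A morphism of functors gives a `K`-linear morphism of ind-objects. -/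
def mapIndMod {A B : Lex k K T} (f : A.F ⟶ B.F) : A.toIndMod ⟶ B.toIndMod :=
  ⟨map f, fun a => hom_ext fun X s => by
    change A.elem X s ≫ map (A.smulNat a) ≫ map f = A.elem X s ≫ map f ≫ map (B.smulNat a)
    rw [← Category.assoc, ← Category.assoc, elem_map, elem_map, elem_map, elem_map]
    simp⟩

lemma elem_mapIndMod {A B : Lex k K T} (f : A.F ⟶ B.F) {X : T} (s : A.F.obj (op X)) :
    A.elem X s ≫ (mapIndMod f).hom = B.elem X (f.app (op X) s) := elem_map f s

lemma mapIndMod_ext {A : Lex k K T} {N : IndMod k K T} {f g : A.toIndMod ⟶ N}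
    (h : ∀ (X : T) (s : A.F.obj (op X)), A.elem X s ≫ f.hom = A.elem X s ≫ g.hom) : f = g :=
  IndMod.hom_ext (hom_ext h)

lemma mapIndMod_id (A : Lex k K T) : mapIndMod (𝟙 A.F) = 𝟙 A.toIndMod :=
  mapIndMod_ext fun X s => (elem_map _ _).trans (Category.comp_id (A.elem X s)).symm

lemma mapIndMod_comp {A B C : Lex k K T} (f : A.F ⟶ B.F) (g : B.F ⟶ C.F) :
    mapIndMod (A := A) (B := C) (f ≫ g) = mapIndMod (B := B) f ≫ mapIndMod g :=
  mapIndMod_ext fun X s => by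
    change A.elem X s ≫ map (f ≫ g) = A.elem X s ≫ map f ≫ map g
    rw [← Category.assoc, elem_map, elem_map, elem_map]
    simp

end Lex

section ExtendScalars
variable {T}

/-- The functor `Z ↦ K ⊗ Hom(Z, Y)`. -/
@[simps]
def extFunctor (Y : T) : Tᵒᵖ ⥤ ModuleCat.{v} K where
  obj Z := ModuleCat.of K (K ⊗[k] (Z.unop ⟶ Y))
  map g := ModuleCat.ofHom (LinearMap.baseChange K (Linear.leftComp k Y g.unop))
  map_id Z := by
    refine ModuleCat.hom_ext (LinearMap.ext fun x => ?_)
    change LinearMap.baseChange K (Linear.leftComp k Y (𝟙 Z.unop)) x = x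
    have : Linear.leftComp k Y (𝟙 Z.unop) = LinearMap.id := by ext; simp
    rw [this, LinearMap.baseChange_id]; rfl
  map_comp {Z Z' Z''} f g := by
    refine ModuleCat.hom_ext (LinearMap.ext fun x => ?_)
    change LinearMap.baseChange K (Linear.leftComp k Y (g.unop ≫ f.unop)) x =
      LinearMap.baseChange K (Linear.leftComp k Y g.unop)
        (LinearMap.baseChange K (Linear.leftComp k Y f.unop) x)
    have : Linear.leftComp k Y (g.unop ≫ f.unop) =
      Linear.leftComp k Y g.unop ∘ₗ Linear.leftComp k Y f.unop := by ext; simp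
    rw [this, LinearMap.baseChange_comp]; rfl

instance (Y : T) : PreservesFiniteLimits ((linearYoneda k T).obj Y) := by
  have : PreservesFiniteLimits ((linearYoneda k T).obj Y ⋙ forget _) :=
    inferInstanceAs (PreservesFiniteLimits (yoneda.obj Y))
  exact preservesFiniteLimits_of_reflects_of_preserves _ (forget _)

/-- `Z ↦ K ⊗ Hom(Z, Y)` is left exact. -/
def extLex (Y : T) : Lex k K T where
  F := extFunctor k K Y
  additive := ⟨fun {Z Z' f g} => by
    refine ModuleCat.hom_ext (LinearMap.ext fun x => ?_)
    change LinearMap.baseChange K (Linear.leftComp k Y (f.unop + g.unop)) x =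
      LinearMap.baseChange K (Linear.leftComp k Y f.unop) x +
      LinearMap.baseChange K (Linear.leftComp k Y g.unop) x
    have : Linear.leftComp k Y (f.unop + g.unop) =
      Linear.leftComp k Y f.unop + Linear.leftComp k Y g.unop := by ext; simp
    rw [this, LinearMap.baseChange_add]; rfl⟩
  lex := by
    let e : (linearYoneda k T).obj Y ⋙ tensorLeft (ModuleCat.of k K) ⋙ forget _ ≅
        extFunctor k K Y ⋙ forget _ := NatIso.ofComponents (fun Z => Iso.refl _)
    have : PreservesFiniteLimits (extFunctor k K Y ⋙ forget _) :=
      preservesFiniteLimits_of_natIso e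
    exact preservesFiniteLimits_of_reflects_of_preserves _ (forget _)
  map_smul X a s := by
    change LinearMap.baseChange K (Linear.leftComp k Y (a • 𝟙 X)) s = _
    have : Linear.leftComp k Y (a • 𝟙 X) = a • LinearMap.id := by ext; simp
    rw [this]
    change (LinearMap.baseChange K (a • LinearMap.id : (X ⟶ Y) →ₗ[k] (X ⟶ Y)))
      (show K ⊗[k] (X ⟶ Y) from s) = algebraMap k K a • (show K ⊗[k] (X ⟶ Y) from s)
    rw [LinearMap.baseChange_smul, LinearMap.baseChange_id]
    exact (algebraMap_smul K a (show K ⊗[k] (X ⟶ Y) from s)).symm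

/-- The `K`-module `Y ⊗ K` in `Ind T`. -/
def extend (Y : T) : IndMod k K T := (extLex k K Y).toIndMod

/-- Morphisms `X ⟶ Y ⊗ K` in `Ind T` are the elements of `K ⊗ Hom(X, Y)`. -/
def extendEquiv (X Y : T) :
    K ⊗[k] (X ⟶ Y) ≃ (Ind.yoneda.obj X ⟶ (extend k K Y).obj) :=
  (extLex k K Y).elem X

/-- The morphism `id ⊗ u : X ⟶ X ⊗ K`, where `u` is the unit of `K`. -/
def extendUnit (X : T) : Ind.yoneda.obj X ⟶ (extend k K X).obj :=
  extendEquiv k K X X (1 ⊗ₜ 𝟙 X)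

variable {k K} in
/-- For `t` in `K ⊗ Hom(X, Y)`, the map `h ↦ t ∘ h` from `Hom(Z, X)` to `K ⊗ Hom(Z, Y)`. -/
def extendPrecomp {X Y : T} (t : K ⊗[k] (X ⟶ Y)) (Z : T) : (Z ⟶ X) →ₗ[k] K ⊗[k] (Z ⟶ Y) where
  toFun h := LinearMap.baseChange K (Linear.leftComp k Y h) t
  map_add' h h' := by
    have : Linear.leftComp k Y (h + h') = Linear.leftComp k Y h + Linear.leftComp k Y h' := by
      ext; simp
    rw [this, LinearMap.baseChange_add]; rfl
  map_smul' a h := by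
    have : Linear.leftComp k Y (a • h) = a • Linear.leftComp k Y h := by ext; simp
    rw [this, LinearMap.baseChange_smul]; rfl

variable {k K} in
lemma extendPrecomp_comp {X Y : T} (t : K ⊗[k] (X ⟶ Y)) {Z Z' : T} (g : Z' ⟶ Z) (h : Z ⟶ X) :
    extendPrecomp t Z' (g ≫ h) =
      LinearMap.baseChange K (Linear.leftComp k Y g) (extendPrecomp t Z h) := by
  change LinearMap.baseChange K (Linear.leftComp k Y (g ≫ h)) t =
    LinearMap.baseChange K (Linear.leftComp k Y g) (LinearMap.baseChange K (Linear.leftComp k Y h) t)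
  have : Linear.leftComp k Y (g ≫ h) = Linear.leftComp k Y g ∘ₗ Linear.leftComp k Y h := by
    ext; simp
  rw [this, LinearMap.baseChange_comp]; rfl

variable {k K} in
lemma extendPrecomp_id {X Y : T} (t : K ⊗[k] (X ⟶ Y)) : extendPrecomp t X (𝟙 X) = t := by
  change LinearMap.baseChange K (Linear.leftComp k Y (𝟙 X)) _ = _
  have : Linear.leftComp k Y (𝟙 X) = LinearMap.id := by ext; simp
  rw [this, LinearMap.baseChange_id]; rfl

variable {k K} in
/-- The `K`-linear extension `f^ : X ⊗ K ⟶ Y ⊗ K` of a morphism `f : X ⟶ Y ⊗ K`, that is to say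
`(id ⊗ m) ∘ (f ⊗ id)`. If `f` corresponds to `t` in `K ⊗ Hom(X, Y)`, it is given on the values at
`Z` by `c ⊗ h ↦ c • (t ∘ h)`. -/
def extendLift {X Y : T} (f : Ind.yoneda.obj X ⟶ (extend k K Y).obj) :
    extend k K X ⟶ extend k K Y :=
  Lex.mapIndMod (A := extLex k K X) (B := extLex k K Y)
    { app := fun Z => ModuleCat.ofHom
        (LinearMap.liftBaseChange K (extendPrecomp ((extendEquiv k K X Y).symm f) Z.unop))
      naturality := fun Z Z' g => by
        refine ModuleCat.hom_ext (LinearMap.ext fun (x : K ⊗[k] (Z.unop ⟶ X)) => ?_)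
        change LinearMap.liftBaseChange K _
            (LinearMap.baseChange K (Linear.leftComp k X g.unop) x) =
          LinearMap.baseChange K (Linear.leftComp k Y g.unop) (LinearMap.liftBaseChange K _ x)
        induction x using TensorProduct.induction_on with
        | zero => simp only [map_zero]
        | add x y hx hy => simp only [map_add, hx, hy]
        | tmul c h =>
          rw [LinearMap.baseChange_tmul, LinearMap.liftBaseChange_tmul,
            LinearMap.liftBaseChange_tmul, map_smul, ← extendPrecomp_comp]
          rfl }

variable {k K} in
lemma extendUnit_extendLift {X Y : T} (f : Ind.yoneda.obj X ⟶ (extend k K Y).obj) :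
    extendUnit k K X ≫ (extendLift f).hom = f := by
  refine (Lex.elem_mapIndMod (A := extLex k K X) (B := extLex k K Y) _ _).trans ?_
  refine Eq.trans ?_ ((extendEquiv k K X Y).apply_symm_apply f)
  change extendEquiv k K X Y (LinearMap.liftBaseChange K _ ((1 : K) ⊗ₜ[k] (𝟙 X))) = _
  rw [LinearMap.liftBaseChange_tmul, one_smul, extendPrecomp_id]

end ExtendScalars

section Tensor
variable [MonoidalCategory T]

/-- The tensor product of ind-objects:
`M ⊗ N` is the colimit of the `X ⊗ Y` over all `X ⟶ M` and `Y ⟶ N` with `X`, `Y` in `T`. -/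
def indTensor : Ind T × Ind T ⥤ Ind T :=
  (Functor.prod (Ind.yoneda : T ⥤ Ind T) (Ind.yoneda : T ⥤ Ind T)).pointwiseLeftKanExtension
    (MonoidalCategory.tensor T ⋙ (Ind.yoneda : T ⥤ Ind T))


variable {T}

/-- The morphism `X ⊗ Y ⟶ M ⊗ N` given by `x : X ⟶ M` and `y : Y ⟶ N`. -/
def indTensorElem {M N : Ind T} {X Y : T} (x : Ind.yoneda.obj X ⟶ M) (y : Ind.yoneda.obj Y ⟶ N) :
    Ind.yoneda.obj (X ⊗ Y) ⟶ (indTensor T).obj (M, N) :=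
  colimit.ι (CostructuredArrow.proj
    (Functor.prod (Ind.yoneda : T ⥤ Ind T) (Ind.yoneda : T ⥤ Ind T)) (M, N) ⋙
      MonoidalCategory.tensor T ⋙ (Ind.yoneda : T ⥤ Ind T))
    (CostructuredArrow.mk (Y := (X, Y)) (Prod.mkHom x y))

lemma indTensor_hom_ext {M N P : Ind T} {f g : (indTensor T).obj (M, N) ⟶ P}
    (h : ∀ (X Y : T) (x : Ind.yoneda.obj X ⟶ M) (y : Ind.yoneda.obj Y ⟶ N),
      indTensorElem x y ≫ f = indTensorElem x y ≫ g) : f = g := by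
  refine colimit.hom_ext fun j => ?_
  obtain ⟨⟨X, Y⟩, ⟨⟨⟩⟩, x, y⟩ := j
  exact h X Y x y

lemma indTensorElem_map {M N M' N' : Ind T} (f : M ⟶ M') (g : N ⟶ N') {X Y : T}
    (x : Ind.yoneda.obj X ⟶ M) (y : Ind.yoneda.obj Y ⟶ N) :
    indTensorElem x y ≫ (indTensor T).map (Prod.mkHom f g) = indTensorElem (x ≫ f) (y ≫ g) :=
  colimit.ι_desc _ _

lemma indTensorElem_naturality {M N : Ind T} {X Y X' Y' : T} (f : X' ⟶ X) (g : Y' ⟶ Y)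
    (x : Ind.yoneda.obj X ⟶ M) (y : Ind.yoneda.obj Y ⟶ N) :
    indTensorElem (Ind.yoneda.map f ≫ x) (Ind.yoneda.map g ≫ y) =
      Ind.yoneda.map (f ⊗ₘ g) ≫ indTensorElem x y := by
  let φ : CostructuredArrow.mk (S := Functor.prod (Ind.yoneda : T ⥤ Ind T) Ind.yoneda)
      (Y := (X', Y')) (Prod.mkHom (Ind.yoneda.map f ≫ x) (Ind.yoneda.map g ≫ y)) ⟶
      CostructuredArrow.mk (Y := (X, Y)) (Prod.mkHom x y) := CostructuredArrow.homMk (Prod.mkHom f g) rfl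
  exact (colimit.w (CostructuredArrow.proj
    (Functor.prod (Ind.yoneda : T ⥤ Ind T) (Ind.yoneda : T ⥤ Ind T)) (M, N) ⋙
      MonoidalCategory.tensor T ⋙ (Ind.yoneda : T ⥤ Ind T)) φ).symm

variable [MonoidalPreadditive T]

lemma indTensorElem_add {M N : Ind T} {X Y : T} (x x' : Ind.yoneda.obj X ⟶ M)
    (y : Ind.yoneda.obj Y ⟶ N) :
    indTensorElem (x + x') y = indTensorElem x y + indTensorElem x' y := by
  let fst := Ind.yoneda.map (biprod.fst : X ⊞ X ⟶ X)
  let snd := Ind.yoneda.map (biprod.snd : X ⊞ X ⟶ X)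
  let z : Ind.yoneda.obj (X ⊞ X) ⟶ M := fst ≫ x + snd ≫ x'
  have hz (f : X ⟶ X ⊞ X) : Ind.yoneda.map f ≫ z =
      Ind.yoneda.map (f ≫ biprod.fst) ≫ x + Ind.yoneda.map (f ≫ biprod.snd) ≫ x' := by
    simp [z, fst, snd]
  have h1 : Ind.yoneda.map (biprod.inl : X ⟶ X ⊞ X) ≫ z = x := by rw [hz]; simp
  have h2 : Ind.yoneda.map (biprod.inr : X ⟶ X ⊞ X) ≫ z = x' := by rw [hz]; simp
  have h3 : Ind.yoneda.map (biprod.inl + biprod.inr : X ⟶ X ⊞ X) ≫ z = x + x' := by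
    rw [Functor.map_add, Preadditive.add_comp, h1, h2]
  have hn (f : X ⟶ X ⊞ X) : indTensorElem (Ind.yoneda.map f ≫ z) y =
      Ind.yoneda.map (f ⊗ₘ 𝟙 Y) ≫ indTensorElem z y := by
    rw [← indTensorElem_naturality]; simp
  rw [← h3, hn, MonoidalPreadditive.add_tensor, Functor.map_add, Preadditive.add_comp, ← hn, ← hn,
    h1, h2]

variable [MonoidalLinear k T]

lemma indTensorElem_smul (a : k) {M N : Ind T} {X Y : T} (x : Ind.yoneda.obj X ⟶ M)
    (y : Ind.yoneda.obj Y ⟶ N) :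
    indTensorElem (a • x) y = a • indTensorElem x y := by
  have h := indTensorElem_naturality (a • 𝟙 X) (𝟙 Y) x y
  rw [tensorHom_id, MonoidalLinear.smul_whiskerRight, id_whiskerRight, ← yoneda_comp_smul,
    ← yoneda_comp_smul] at h
  simpa using h

end Tensor

namespace IndMod
variable {k K T} [MonoidalCategory T]

/-- The action of `a` on the first factor of the tensor product over `k` of two `K`-modules. -/
def actLeft (M N : IndMod k K T) (a : K) :
    (indTensor T).obj (M.obj, N.obj) ⟶ (indTensor T).obj (M.obj, N.obj) :=
  (indTensor T).map (Prod.mkHom (X₁ := M.obj) (X₂ := M.obj) (M.act a) (𝟙 N.obj))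

/-- The action of `a` on the second factor of the tensor product over `k` of two `K`-modules. -/
def actRight (M N : IndMod k K T) (a : K) :
    (indTensor T).obj (M.obj, N.obj) ⟶ (indTensor T).obj (M.obj, N.obj) :=
  (indTensor T).map (Prod.mkHom (Y₁ := N.obj) (Y₂ := N.obj) (𝟙 M.obj) (N.act a))

/-- The ind-object underlying the tensor product over `K` of two `K`-modules in `Ind T`: the
largest quotient of their tensor product on which the two actions of `K` agree. -/
def tensorObj (M N : IndMod k K T) : Ind T :=
  cokernel (Sigma.desc fun a : K => actLeft M N a - actRight M N a)

def tensorπ (M N : IndMod k K T) : (indTensor T).obj (M.obj, N.obj) ⟶ tensorObj M N :=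
  cokernel.π _

instance (M N : IndMod k K T) : Epi (tensorπ M N) :=
  inferInstanceAs (Epi (cokernel.π _))

lemma tensorπ_balanced (M N : IndMod k K T) (a : K) :
    actLeft M N a ≫ tensorπ M N = actRight M N a ≫ tensorπ M N := by
  have h := Sigma.ι (fun _ : K => (indTensor T).obj (M.obj, N.obj)) a ≫=
    cokernel.condition (Sigma.desc fun a : K => actLeft M N a - actRight M N a)
  rw [← Category.assoc, Sigma.ι_desc, comp_zero, Preadditive.sub_comp, sub_eq_zero] at h
  exact h

/-- A morphism of ind-objects out of the tensor product which is `K`-balanced. -/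
def tensorDesc {M N : IndMod k K T} {P : Ind T} (f : (indTensor T).obj (M.obj, N.obj) ⟶ P)
    (hf : ∀ a, actLeft M N a ≫ f = actRight M N a ≫ f) : tensorObj M N ⟶ P :=
  cokernel.desc _ f (Sigma.hom_ext _ _ fun a => by simp [hf])

lemma tensorπ_desc {M N : IndMod k K T} {P : Ind T} (f : (indTensor T).obj (M.obj, N.obj) ⟶ P)
    (hf : ∀ a, actLeft M N a ≫ f = actRight M N a ≫ f) : tensorπ M N ≫ tensorDesc f hf = f :=
  cokernel.π_desc _ _ _


variable [MonoidalPreadditive T] [MonoidalLinear k T]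

lemma actLeft_add (M N : IndMod k K T) (a b : K) :
    actLeft M N (a + b) = actLeft M N a + actLeft M N b :=
  indTensor_hom_ext fun X Y x y => by
    refine (indTensorElem_map _ _ _ _).trans ?_
    rw [Preadditive.comp_add]
    refine Eq.trans ?_ (congrArg₂ (· + ·) (indTensorElem_map _ _ _ _)
      (indTensorElem_map _ _ _ _)).symm
    rw [act_add, ← indTensorElem_add]
    congr 1
    exact Preadditive.comp_add _ _ _ _ _ _

lemma actLeft_mul (M N : IndMod k K T) (a b : K) :
    actLeft M N (a * b) = actLeft M N b ≫ actLeft M N a := by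
  rw [actLeft, actLeft, actLeft, ← Functor.map_comp, act_mul]
  simp

lemma actLeft_algebraMap (M N : IndMod k K T) (a : k) :
    actLeft M N (algebraMap k K a) = a • 𝟙 _ :=
  indTensor_hom_ext fun X Y x y => by
    refine (indTensorElem_map _ _ _ _).trans ?_
    rw [AlgHom.commutes, Algebra.algebraMap_eq_smul_one, Category.comp_id]
    refine Eq.trans ?_ (Linear.comp_smul _ _ _ _ _ _).symm
    rw [Category.comp_id, ← indTensorElem_smul]
    congr 1
    exact (Linear.comp_smul _ _ _ _ _ _).trans (congrArg (a • ·) (Category.comp_id x))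

lemma actLeft_comm (M N : IndMod k K T) (a b : K) :
    actLeft M N a ≫ actLeft M N b = actLeft M N b ≫ actLeft M N a := by
  rw [← actLeft_mul, ← actLeft_mul, mul_comm]

lemma actLeft_actRight (M N : IndMod k K T) (a b : K) :
    actLeft M N a ≫ actRight M N b = actRight M N b ≫ actLeft M N a := by
  rw [actLeft, actRight, ← Functor.map_comp, ← Functor.map_comp]
  simp

/-- The action of `K` on the tensor product over `K`, through either of the factors. -/
def tensorAct (M N : IndMod k K T) (a : K) : tensorObj M N ⟶ tensorObj M N :=
  tensorDesc (actLeft M N a ≫ tensorπ M N) fun b => by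
    rw [← Category.assoc, actLeft_comm, Category.assoc, tensorπ_balanced, ← Category.assoc,
      ← Category.assoc, actLeft_actRight]

lemma tensorπ_act (M N : IndMod k K T) (a : K) :
    tensorπ M N ≫ tensorAct M N a = actLeft M N a ≫ tensorπ M N := tensorπ_desc _ _

/-- The tensor product over `K` of two `K`-modules in `Ind T`. -/
def tensor (M N : IndMod k K T) : IndMod k K T where
  obj := tensorObj M N
  act :=
    { toFun := tensorAct M N
      map_one' := by
        have h : actLeft M N 1 = 𝟙 _ := by
          rw [← (algebraMap k K).map_one, actLeft_algebraMap, one_smul]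
        rw [← cancel_epi (tensorπ M N), tensorπ_act, h, Category.id_comp]
        exact (Category.comp_id _).symm
      map_mul' := fun a b => by
        rw [End.mul_def, ← cancel_epi (tensorπ M N), tensorπ_act, actLeft_mul, ← Category.assoc,
          tensorπ_act, Category.assoc, Category.assoc, tensorπ_act]
      map_zero' := by
        have h : actLeft M N 0 = 0 := by simpa using actLeft_add M N 0 0
        rw [← cancel_epi (tensorπ M N), tensorπ_act, h, zero_comp]
        exact comp_zero.symm
      map_add' := fun a b => by
        rw [← cancel_epi (tensorπ M N), tensorπ_act, actLeft_add]
        refine Eq.trans ?_ (Preadditive.comp_add _ _ _ _ _ _).symm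
        rw [tensorπ_act, tensorπ_act, Preadditive.add_comp]
      commutes' := fun a => by
        rw [← cancel_epi (tensorπ M N), tensorπ_act, actLeft_algebraMap,
          Algebra.algebraMap_eq_smul_one, Linear.smul_comp, Category.id_comp]
        refine Eq.trans ?_ (Linear.comp_smul _ _ _ _ _ _).symm
        exact congrArg (a • ·) (Category.comp_id _).symm }

lemma actLeft_map {M M' : IndMod k K T} (f : M ⟶ M') (N : IndMod k K T) (a : K) :
    actLeft M N a ≫ (indTensor T).map (Prod.mkHom f.hom (𝟙 N.obj)) =
      (indTensor T).map (Prod.mkHom f.hom (𝟙 N.obj)) ≫ actLeft M' N a := by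
  rw [actLeft, actLeft, ← Functor.map_comp, ← Functor.map_comp]
  simp [f.comm]

lemma actRight_map {M M' : IndMod k K T} (f : M ⟶ M') (N : IndMod k K T) (a : K) :
    actRight M N a ≫ (indTensor T).map (Prod.mkHom f.hom (𝟙 N.obj)) =
      (indTensor T).map (Prod.mkHom f.hom (𝟙 N.obj)) ≫ actRight M' N a := by
  rw [actRight, actRight, ← Functor.map_comp, ← Functor.map_comp]
  simp

/-- The morphism of ind-objects `f ⊗ id` on tensor products over `K`. -/
def tensorMapHom {M M' : IndMod k K T} (f : M ⟶ M') (N : IndMod k K T) :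
    tensorObj M N ⟶ tensorObj M' N :=
  tensorDesc ((indTensor T).map (Prod.mkHom f.hom (𝟙 N.obj)) ≫ tensorπ M' N) fun a => by
    rw [← Category.assoc, actLeft_map, Category.assoc, tensorπ_balanced, ← Category.assoc,
      ← actRight_map, Category.assoc]

lemma tensorπ_mapHom {M M' : IndMod k K T} (f : M ⟶ M') (N : IndMod k K T) :
    tensorπ M N ≫ tensorMapHom f N =
      (indTensor T).map (Prod.mkHom f.hom (𝟙 N.obj)) ≫ tensorπ M' N := tensorπ_desc _ _

lemma tensorMapHom_comm {M M' : IndMod k K T} (f : M ⟶ M') (N : IndMod k K T) (a : K) :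
    tensorAct M N a ≫ tensorMapHom f N = tensorMapHom f N ≫ tensorAct M' N a := by
  rw [← cancel_epi (tensorπ M N), ← Category.assoc, tensorπ_act, Category.assoc, tensorπ_mapHom,
    ← Category.assoc, actLeft_map, Category.assoc, ← tensorπ_act, ← Category.assoc,
    ← tensorπ_mapHom, Category.assoc]

lemma tensorMapHom_id (M N : IndMod k K T) : tensorMapHom (𝟙 M) N = 𝟙 _ := by
  rw [← cancel_epi (tensorπ M N), tensorπ_mapHom]
  have : (indTensor T).map (Prod.mkHom (𝟙 M : M ⟶ M).hom (𝟙 N.obj)) = 𝟙 _ :=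
    (indTensor T).map_id _
  rw [this, Category.id_comp, Category.comp_id]

lemma tensorMapHom_comp {M M' M'' : IndMod k K T} (f : M ⟶ M') (g : M' ⟶ M'')
    (N : IndMod k K T) : tensorMapHom (f ≫ g) N = tensorMapHom f N ≫ tensorMapHom g N := by
  rw [← cancel_epi (tensorπ M N), tensorπ_mapHom, ← Category.assoc, tensorπ_mapHom,
    Category.assoc, tensorπ_mapHom, ← Category.assoc, ← Functor.map_comp]
  congr 2
  simp

/-- The functor `- ⊗_K N` on `K`-modules in `Ind T`. -/
def tensorRight (N : IndMod k K T) : IndMod k K T ⥤ IndMod k K T where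
  obj M := tensor M N
  map f := ⟨tensorMapHom f N, tensorMapHom_comm f N⟩
  map_id M := hom_ext (tensorMapHom_id M N)
  map_comp f g := hom_ext (tensorMapHom_comp f g N)

end IndMod

/-- `T` is flat over `K`: the tensor product over `K` of `K`-modules in `Ind T` is exact. -/
def IsFlatOver [MonoidalCategory T] [MonoidalPreadditive T] [MonoidalLinear k T] : Prop :=
  ∀ N : IndMod k K T, PreservesFiniteLimits (IndMod.tensorRight N) ∧
    PreservesFiniteColimits (IndMod.tensorRight N)

namespace IndMod
variable {k K T}


/-- The action of `K` on the image of a morphism of `K`-modules. -/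
def imageAct {M N : IndMod k K T} (f : M ⟶ N) (a : K) :
    Abelian.image f.hom ⟶ Abelian.image f.hom :=
  kernel.lift _ (Abelian.image.ι f.hom ≫ N.act a) (by
    rw [← cancel_epi (Abelian.factorThruImage f.hom), ← Category.assoc, ← Category.assoc,
      Abelian.image.fac, ← f.comm, Category.assoc, cokernel.condition, comp_zero, comp_zero])

lemma imageAct_ι {M N : IndMod k K T} (f : M ⟶ N) (a : K) :
    imageAct f a ≫ Abelian.image.ι f.hom = Abelian.image.ι f.hom ≫ N.act a :=
  kernel.lift_ι _ _ _

lemma imageAct_comm {M N : IndMod k K T} (f : M ⟶ N) (a : K) :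
    M.act a ≫ Abelian.factorThruImage f.hom = Abelian.factorThruImage f.hom ≫ imageAct f a := by
  rw [← cancel_mono (Abelian.image.ι f.hom), Category.assoc, Category.assoc, imageAct_ι,
    Abelian.image.fac, ← Category.assoc, Abelian.image.fac, f.comm]

/-- The image of a morphism of `K`-modules in `Ind T`. -/
def image {M N : IndMod k K T} (f : M ⟶ N) : IndMod k K T where
  obj := Abelian.image f.hom
  act :=
    { toFun := imageAct f
      map_one' := by
        rw [← cancel_mono (Abelian.image.ι f.hom), imageAct_ι, act_one, Category.comp_id]
        exact (Category.id_comp _).symm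
      map_mul' := fun a b => by
        rw [End.mul_def, ← cancel_mono (Abelian.image.ι f.hom), imageAct_ι, act_mul,
          Category.assoc, imageAct_ι, ← Category.assoc, ← Category.assoc, imageAct_ι]
      map_zero' := by
        rw [← cancel_mono (Abelian.image.ι f.hom), imageAct_ι, act_zero]
        exact comp_zero.trans zero_comp.symm
      map_add' := fun a b => by
        rw [← cancel_mono (Abelian.image.ι f.hom), imageAct_ι, act_add]
        refine (Preadditive.comp_add _ _ _ _ _ _).trans
          (Eq.trans ?_ (Preadditive.add_comp _ _ _ _ _ _).symm)
        rw [imageAct_ι, imageAct_ι]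
      commutes' := fun a => by
        rw [← cancel_mono (Abelian.image.ι f.hom), imageAct_ι, AlgHom.commutes,
          Algebra.algebraMap_eq_smul_one, Algebra.algebraMap_eq_smul_one]
        refine (Linear.comp_smul _ _ _ _ _ _).trans
          (Eq.trans ?_ (Linear.smul_comp _ _ _ _ _ _).symm)
        exact congrArg (a • ·) ((Category.comp_id _).trans (Category.id_comp _).symm) }

/-- The inclusion of the image. -/
def imageι {M N : IndMod k K T} (f : M ⟶ N) : image f ⟶ N :=
  ⟨Abelian.image.ι f.hom, imageAct_ι f⟩

/-- The projection to the image. -/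
def toImage {M N : IndMod k K T} (f : M ⟶ N) : M ⟶ image f :=
  ⟨Abelian.factorThruImage f.hom, imageAct_comm f⟩

lemma toImage_ι {M N : IndMod k K T} (f : M ⟶ N) : toImage f ≫ imageι f = f :=
  hom_ext (Abelian.image.fac _)

lemma imageι_cancel {M N P : IndMod k K T} {f : M ⟶ N} {g h : P ⟶ image f}
    (e : g ≫ imageι f = h ≫ imageι f) : g = h :=
  hom_ext ((cancel_mono (Abelian.image.ι f.hom)).1 (congrArg Hom.hom e))

end IndMod


section Extend
variable {k K T}

lemma extendEquiv_add {X Y : T} (s t : K ⊗[k] (X ⟶ Y)) :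
    extendEquiv k K X Y (s + t) = extendEquiv k K X Y s + extendEquiv k K X Y t :=
  (extLex k K Y).elem_add s t

lemma extendEquiv_zero {X Y : T} : extendEquiv k K X Y 0 = 0 := (extLex k K Y).elem_zero

lemma extendEquiv_smul {X Y : T} (c : K) (s : K ⊗[k] (X ⟶ Y)) :
    extendEquiv k K X Y (c • s) = extendEquiv k K X Y s ≫ (extend k K Y).act c :=
  ((extLex k K Y).elem_smulNat c s).symm

lemma extendEquiv_tmul {X Y : T} (c : K) (a : X ⟶ Y) :
    extendEquiv k K X Y (c ⊗ₜ a) =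
      Ind.yoneda.map a ≫ extendUnit k K Y ≫ (extend k K Y).act c := by
  have h : Ind.yoneda.map a ≫ extendUnit k K Y = extendEquiv k K X Y (1 ⊗ₜ a) := by
    refine ((extLex k K Y).elem_naturality _ _).trans ?_
    change extendEquiv k K X Y (LinearMap.baseChange K (Linear.leftComp k Y a) (1 ⊗ₜ 𝟙 Y)) = _
    simp
  refine Eq.trans ?_ (Category.assoc _ _ _)
  rw [h, ← extendEquiv_smul, TensorProduct.smul_tmul', smul_eq_mul, mul_one]

lemma extendLift_ext {X : T} {M : IndMod k K T} {f g : extend k K X ⟶ M}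
    (h : extendUnit k K X ≫ f.hom = extendUnit k K X ≫ g.hom) : f = g := by
  have key (f : extend k K X ⟶ M) (Z : T) (c : K) (a : Z ⟶ X) :
      extendEquiv k K Z X (c ⊗ₜ a) ≫ f.hom =
        Ind.yoneda.map a ≫ (extendUnit k K X ≫ f.hom) ≫ M.act c := by
    rw [extendEquiv_tmul, Category.assoc, Category.assoc, Category.assoc, ← f.comm]
  refine Lex.mapIndMod_ext fun Z (s : K ⊗[k] (Z ⟶ X)) => ?_
  change extendEquiv k K Z X s ≫ f.hom = extendEquiv k K Z X s ≫ g.hom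
  induction s using TensorProduct.induction_on with
  | zero => rw [extendEquiv_zero, zero_comp, zero_comp]
  | add s t hs ht =>
    rw [extendEquiv_add, Preadditive.add_comp, Preadditive.add_comp, hs, ht]
  | tmul c a => rw [key, key, h]

lemma extendLift_unit (X : T) : extendLift (extendUnit k K X) = 𝟙 (extend k K X) := by
  apply extendLift_ext
  rw [extendUnit_extendLift]
  exact (Category.comp_id _).symm

/-- The morphism `g ⊗ id : X ⊗ K ⟶ Y ⊗ K`. -/
def extendMap {X Y : T} (g : X ⟶ Y) : extend k K X ⟶ extend k K Y :=
  extendLift (Ind.yoneda.map g ≫ extendUnit k K Y)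

lemma extendMap_id (X : T) : extendMap (𝟙 X) = 𝟙 (extend k K X) := by
  rw [extendMap, CategoryTheory.Functor.map_id, Category.id_comp, extendLift_unit]

lemma extendMap_comp {X Y Z : T} (g : X ⟶ Y) (h : Y ⟶ Z) :
    (extendMap (g ≫ h) : extend k K X ⟶ _) = extendMap g ≫ extendMap h := by
  apply extendLift_ext
  change _ = extendUnit k K X ≫ (extendMap g).hom ≫ (extendMap h).hom
  rw [extendMap, extendUnit_extendLift, ← Category.assoc, extendMap, extendUnit_extendLift,
    Category.assoc, extendMap, extendUnit_extendLift, Functor.map_comp, Category.assoc]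

end Extend

/-- Triples `(X, Y, f : X ⟶ Y ⊗ K)` with `X`, `Y` in `T` and `f` a morphism of `Ind T`. -/
structure Triple where
  X : T
  Y : T
  f : Ind.yoneda.obj X ⟶ (extend k K Y).obj

namespace Triple
variable {k K T}

/-- The image of the `K`-linear morphism `X ⊗ K ⟶ Y ⊗ K` defined by a triple. -/
def im (A : Triple k K T) : IndMod k K T := IndMod.image (extendLift A.f)

/-- Morphisms of triples are the `K`-linear morphisms between their images. -/
instance : Category (Triple k K T) where
  Hom A B := A.im ⟶ B.im
  id A := 𝟙 A.im
  comp {A B C} f g := CategoryStruct.comp (X := A.im) (Y := B.im) (Z := C.im) f g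
  id_comp {A B} f := Category.id_comp (X := A.im) (Y := B.im) f
  comp_id {A B} f := Category.comp_id (X := A.im) (Y := B.im) f
  assoc {A B C D} f g h := Category.assoc (W := A.im) (X := B.im) (Y := C.im) (Z := D.im) f g h

/-- A triple, sent to its image. -/
def imFunctor : Triple k K T ⥤ IndMod k K T where
  obj A := A.im
  map f := f

instance : Preadditive (Triple k K T) where
  homGroup A B := inferInstanceAs (AddCommGroup (A.im ⟶ B.im))
  add_comp A B C := Preadditive.add_comp A.im B.im C.im
  comp_add A B C := Preadditive.comp_add A.im B.im C.im

instance : Linear K (Triple k K T) where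
  homModule A B := inferInstanceAs (Module K (A.im ⟶ B.im))
  smul_comp A B C := Linear.smul_comp A.im B.im C.im
  comp_smul A B C := Linear.comp_smul A.im B.im C.im

/-- The morphism `g ⊗ id` between the images of the identities of `X ⊗ K` and `Y ⊗ K`. -/
def ofObjMap {X Y : T} (g : X ⟶ Y) :
    IndMod.image (extendLift (extendUnit k K X)) ⟶ IndMod.image (extendLift (extendUnit k K Y)) :=
  IndMod.imageι _ ≫ extendMap g ≫ IndMod.toImage _

lemma ofObjMap_ι {X Y : T} (g : X ⟶ Y) :
    ofObjMap (k := k) (K := K) g ≫ IndMod.imageι _ = IndMod.imageι _ ≫ extendMap g := by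
  rw [ofObjMap, Category.assoc, Category.assoc, IndMod.toImage_ι]
  congr 1
  rw [extendLift_unit, Category.comp_id]

/-- The functor `X ↦ (X, X, id ⊗ u)`, `g ↦ g ⊗ id`. -/
def ofObj : T ⥤ Triple k K T where
  obj X := ⟨X, X, extendUnit k K X⟩
  map g := ofObjMap g
  map_id X := IndMod.imageι_cancel (by
    rw [ofObjMap_ι, extendMap_id]
    exact (Category.comp_id _).trans (Category.id_comp _).symm)
  map_comp {X Y Z} g h := IndMod.imageι_cancel (by
    change _ = (ofObjMap g ≫ ofObjMap h) ≫ IndMod.imageι _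
    rw [Category.assoc, ofObjMap_ι, ofObjMap_ι, extendMap_comp, ← Category.assoc, ← Category.assoc,
      ofObjMap_ι])

variable [MonoidalCategory T] [MonoidalPreadditive T] [MonoidalLinear k T]

/-- The tensor product of `f : X ⟶ Y ⊗ K` and `f' : X' ⟶ Y' ⊗ K`, that is to say
`(id ⊗ m) ∘ τ₂₃ ∘ (f ⊗ f') : X ⊗ X' ⟶ Y ⊗ Y' ⊗ K`, on the level of elements of
`K ⊗ Hom(X, Y)` and `K ⊗ Hom(X', Y')`. -/
def tensorElem (X Y X' Y' : T) :
    (K ⊗[k] (X ⟶ Y)) ⊗[k] (K ⊗[k] (X' ⟶ Y')) →ₗ[k] K ⊗[k] (X ⊗ X' ⟶ Y ⊗ Y') :=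
  TensorProduct.map (LinearMap.mul' k K)
      (TensorProduct.lift (LinearMap.mk₂ k (fun g g' => g ⊗ₘ g')
        (fun g₁ g₂ g' => MonoidalPreadditive.add_tensor g₁ g₂ g')
        (fun a g g' => by simp [MonoidalCategory.tensorHom_def])
        (fun g g₁ g₂ => MonoidalPreadditive.tensor_add g g₁ g₂)
        (fun a g g' => by simp [MonoidalCategory.tensorHom_def]))) ∘ₗ
    (TensorProduct.tensorTensorTensorComm k K (X ⟶ Y) K (X' ⟶ Y')).toLinearMap

/-- The tensor product of triples. -/
def tensor (A B : Triple k K T) : Triple k K T where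
  X := A.X ⊗ B.X
  Y := A.Y ⊗ B.Y
  f := extendEquiv k K _ _ (tensorElem A.X A.Y B.X B.Y
    ((extendEquiv k K A.X A.Y).symm A.f ⊗ₜ (extendEquiv k K B.X B.Y).symm B.f))

/-- The unit triple `(I, I, u)`. -/
def unit : Triple k K T := ofObj.obj (𝟙_ T)

end Triple

variable {T}

/-- A functor from a `k`-linear to a `K`-linear category is `k`-linear. -/
class IsLinearOver {D : Type u} [Category.{v} D] [Preadditive D] [Linear K D]
    (F : T ⥤ D) : Prop where
  map_smul : ∀ {X Y : T} (a : k) (f : X ⟶ Y), F.map (a • f) = algebraMap k K a • F.map f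

section Restrict
variable {D : Type u} [Category.{v} D] [Abelian D] [Linear K D]
variable (q : T ⥤ D) [q.Additive] [PreservesFiniteColimits q] [IsLinearOver k K q]

/-- The left exact functor `X ↦ Hom(q X, U)`. -/
def restrictLex (U : D) : Lex k K T where
  F := q.op ⋙ (linearYoneda K D).obj U
  additive := inferInstance
  lex := by
    have : PreservesFiniteLimits ((linearYoneda K D).obj U) := by
      have : PreservesFiniteLimits ((linearYoneda K D).obj U ⋙ forget _) :=
        inferInstanceAs (PreservesFiniteLimits (yoneda.obj U))
      exact preservesFiniteLimits_of_reflects_of_preserves _ (forget _)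
    have : PreservesFiniteLimits q.op := preservesFiniteLimits_op _
    infer_instance
  map_smul X a s := by
    have h : q.map (a • 𝟙 X) = algebraMap k K a • 𝟙 (q.obj X) := by
      rw [IsLinearOver.map_smul (K := K), CategoryTheory.Functor.map_id]
    change q.map (a • 𝟙 X) ≫ (id s : q.obj X ⟶ U) = algebraMap k K a • (id s : q.obj X ⟶ U)
    rw [h, Linear.smul_comp, Category.id_comp]

/-- The right adjoint `U ↦ U^K` of the (ind-extension of the) functor `q`, restricted to the
objects `U` of `D`, with values in the `K`-modules of `Ind T`: the ind-object `U^K` is defined by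
`Hom(X, U^K) = Hom(q X, U)` for `X` in `T`, and `K` acts through the `K`-linear structure
of `D`. -/
def restrict : D ⥤ IndMod k K T where
  obj U := (restrictLex k K q U).toIndMod
  map {U V} f := Lex.mapIndMod (A := restrictLex k K q U) (B := restrictLex k K q V)
    (Functor.whiskerLeft q.op ((linearYoneda K D).map f))
  map_id U := by
    rw [← Lex.mapIndMod_id]
    congr 1
    simp; rfl
  map_comp {U V W} f g := by
    refine Eq.trans ?_ (Lex.mapIndMod_comp (A := restrictLex k K q U) (B := restrictLex k K q V)
      (C := restrictLex k K q W) _ _)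
    congr 1
    simp; rfl

/-- The adjunction `Hom(q X, U) = Hom(X, U^K)`. -/
def restrictElem (X : T) (U : D) :
    (q.obj X ⟶ U) ≃ (Ind.yoneda.obj X ⟶ ((restrict k K q).obj U).obj) :=
  (restrictLex k K q U).elem X

end Restrict



section Rigid

/-- Rigid tensor categories over a field `k`: a `k`-linear abelian symmetric monoidal category (with
bilinear tensor product) such that the scalars are the endomorphisms of the unit object, every
object has a dual, and every object is of finite length, i.e. noetherian and artinian. -/
class IsRigidTensorCategory (k : Type v) [Field k] (C : Type u) [Category.{v} C] [Abelian C]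
    [Linear k C] [MonoidalCategory C] [SymmetricCategory C] [MonoidalPreadditive C]
    [MonoidalLinear k C] : Prop where
  end_unit : Function.Bijective fun a : k => a • 𝟙 (𝟙_ C)
  exists_dual : ∀ X : C, ∃ Y : C, Nonempty (ExactPairing X Y)
  noetherian : ∀ X : C, IsNoetherianObject X
  artinian : ∀ X : C, IsArtinianObject X

/-- An object is trivial if it is a finite direct sum of copies of the unit object. -/
def IsTrivialObj {C : Type u} [Category.{v} C] [Abelian C] [MonoidalCategory C] (X : C) : Prop :=
  ∃ n : ℕ, Nonempty (X ≅ ∐ fun _ : Fin n => 𝟙_ C)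

/-- The conditions on a functor `q : T ⥤ D` of rigid tensor categories which say that
`D` is a normal quotient of `T`. -/
structure IsNormalQuotient [MonoidalCategory T] {D : Type u} [Category.{v} D] [Abelian D]
    [MonoidalCategory D] (q : T ⥤ D) : Prop where
  /-- The largest trivial subobject of `q X` is isomorphic to the image of a subobject of `X`. -/
  trivial_sub : ∀ X : T, ∃ S : Subobject (q.obj X),
    IsGreatest {S' : Subobject (q.obj X) | IsTrivialObj (S' : D)} S ∧
      ∃ X' : Subobject X, Nonempty ((S : D) ≅ q.obj (X' : T))
  exists_mono : ∀ U : D, ∃ (X : T) (i : U ⟶ q.obj X), Mono i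
  exists_epi : ∀ U : D, ∃ (X : T) (p : q.obj X ⟶ U), Epi p

/-- The conditions which say that `D` is the base change of `T`: it is a normal quotient, and the
objects of `T` which become trivial in `D` are the trivial ones. -/
structure IsBaseChange [MonoidalCategory T] {D : Type u} [Category.{v} D] [Abelian D]
    [MonoidalCategory D] (q : T ⥤ D) : Prop extends IsNormalQuotient q where
  trivial_iff : ∀ X : T, IsTrivialObj (q.obj X) ↔ IsTrivialObj X

/-- The functor `U ↦ U^K` from `D` to the `K`-modules in `Ind T` is a tensor functor, i.e. the
canonical morphisms `U^K ⊗_K V^K ⟶ (U ⊗ V)^K` and `I ⊗ K ⟶ I^K` are isomorphisms. The first one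
sends `u ⊗ v`, where `u : q X ⟶ U` and `v : q Y ⟶ V` are seen as morphisms `X ⟶ U^K` and
`Y ⟶ V^K`, to the morphism `X ⊗ Y ⟶ (U ⊗ V)^K` given by `q (X ⊗ Y) ≅ q X ⊗ q Y ⟶ U ⊗ V`. The second
one corresponds to `q I ≅ I`. -/
structure RestrictIsTensor [MonoidalCategory T] [MonoidalPreadditive T] [MonoidalLinear k T]
    {D : Type u} [Category.{v} D] [Abelian D] [Linear K D] [MonoidalCategory D]
    (q : T ⥤ D) [q.Monoidal] [q.Additive] [PreservesFiniteColimits q] [IsLinearOver k K q] :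
    Prop where
  tensor : ∀ U V : D, ∃ e : IndMod.tensor ((restrict k K q).obj U) ((restrict k K q).obj V) ≅
      (restrict k K q).obj (U ⊗ V),
    ∀ (X Y : T) (u : q.obj X ⟶ U) (v : q.obj Y ⟶ V),
      indTensorElem (restrictElem k K q X U u) (restrictElem k K q Y V v) ≫
          IndMod.tensorπ _ _ ≫ e.hom.hom =
        restrictElem k K q (X ⊗ Y) (U ⊗ V) (Functor.OplaxMonoidal.δ q X Y ≫ (u ⊗ₘ v))
  unit : ∃ e : extend k K (𝟙_ T) ≅ (restrict k K q).obj (𝟙_ D),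
    extendUnit k K (𝟙_ T) ≫ e.hom.hom =
      restrictElem k K q (𝟙_ T) (𝟙_ D) (Functor.OplaxMonoidal.η q)

end Rigid

end TensorBC

end

/-!
Let `D` be the target of `q`. The proof works with elements throughout: an ind-object is determined
by the morphisms to it from objects of `T`, the elements of `U^K` on `X` are the morphisms `q X ⟶
U`, and those of `X ⊗ K` on `Z` form `K ⊗ Hom(Z, X)`.

*Morphisms.* The comparison map `K ⊗ Hom(X, Y) ⟶ Hom(q X, q Y)` is bijective
(`IsBaseChange.homComparison_bijective`). Duality reduces this to `X = 𝟙_`. Since `𝟙_` is simple, a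
nonzero morphism from `q 𝟙_` to `q Y` has its image in the largest trivial subobject of `q Y`, and
the conditions on a base change identify this subobject with `q Y'` for a trivial subobject `Y'` of
`Y`. In other words `(q X)^K` is `X ⊗ K` (`isIso_extendToRestrict`).

*Exactness.* As a right adjoint, `U ↦ U^K` is left exact. For an epimorphism `q Z ⟶ q X`, let `N` be
the cokernel of the induced morphism `Z ⊗ K ⟶ X ⊗ K`. The dual monomorphism gives a monomorphism of
`K`-modules `X' ⊗ K ⟶ Z' ⊗ K`, which by flatness remains one after tensoring with `N`. Elements of
`N` on `X` thereby embed into elements of `N` on `Z` (`eq_zero_of_extendDescElem_eq_zero`), and the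
tautological one vanishes there, so that `N = 0`. As the objects of `T` are noetherian, it follows
that morphisms `q X ⟶ V` lift along an epimorphism `U ⟶ V` after passing to some epimorphism `Y ⟶ X`
in `T` (`exists_lift`). This gives the exactness of `U ↦ U^K`.

*Tensor products.* If `U = q X`, then `U^K ⊗_K V^K ⟶ (U ⊗ V)^K` has an explicit inverse, because a
morphism `q Z ⟶ q X ⊗ V` amounts to a morphism `q (X' ⊗ Z) ⟶ V` with `X'` dual to `X`
(`isIso_restrictTensorHom_obj`). In general `U` is a cokernel of a morphism between objects of the
form `q X`, and both sides are right exact.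

*Triples.* By local lifting `U ↦ U^K` is fully faithful (`faithful_restrict`, `full_restrict`). The
image of the `K`-linear morphism defined by a triple `(X, Y, f)` is `U^K`, where `U` is the image of
the corresponding morphism `q X ⟶ q Y`, and every object of `D` arises in this way
(`Triple.exists_equivalence`).

*Extension of functors.* The extension `ω_K` of `ω` is characterized by `Hom(ω_K U, Z) = Hom_K(U^K,
Z^K)`, where `Z^K` is formed with respect to `ω`. If `U = q X`, then `U^K = X ⊗ K` and `ω X`
represents the right hand side; the general case follows by taking cokernels (`exists_extension`). A
morphism `u : q X ⟶ U` gives an element `ω X ⟶ ω_K U`, and the tensor structure of `ω_K` is the only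
one which sends `u ⊗ v` to the element of `ω_K (U ⊗ V)` given by `q (X ⊗ Y) ≅ q X ⊗ q Y ⟶ U ⊗ V`
(`exists_extensionμ`). It is an isomorphism by right exactness, and its coherence conditions need
only be checked on elements.
-/

noncomputable section

namespace TensorBC

/-! ### Duals and the unit object in rigid tensor categories -/

section Duals

/-- A monoidal functor sends dual pairs to dual pairs. -/
@[reducible]
def exactPairingMap {C : Type*} [Category* C] [MonoidalCategory C] {D : Type*} [Category* D]
    [MonoidalCategory D] (F : C ⥤ D) [F.Monoidal] (X Y : C) [ExactPairing X Y] :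
    ExactPairing (F.obj X) (F.obj Y) where
  coevaluation' := Functor.LaxMonoidal.ε F ≫ F.map (η_ X Y) ≫ Functor.OplaxMonoidal.δ F X Y
  evaluation' := Functor.LaxMonoidal.μ F Y X ≫ F.map (ε_ X Y) ≫ Functor.OplaxMonoidal.η F
  coevaluation_evaluation' := by
    have h := congrArg F.map (ExactPairing.coevaluation_evaluation X Y)
    simp only [Functor.map_comp, Functor.Monoidal.map_whiskerLeft,
      Functor.Monoidal.map_whiskerRight, Functor.Monoidal.map_associator_inv,
      Functor.Monoidal.map_leftUnitor_inv, Functor.Monoidal.map_rightUnitor] at h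
    simp only [Category.assoc, Functor.Monoidal.μ_δ_assoc] at h
    rw [← cancel_mono (Functor.LaxMonoidal.ε F ▷ F.obj Y ≫ Functor.LaxMonoidal.μ F _ _),
      ← cancel_epi (Functor.OplaxMonoidal.δ F Y (𝟙_ C) ≫ F.obj Y ◁ Functor.OplaxMonoidal.η F)]
    simpa using h
  evaluation_coevaluation' := by
    have h := congrArg F.map (ExactPairing.evaluation_coevaluation X Y)
    simp only [Functor.map_comp, Functor.Monoidal.map_whiskerLeft,
      Functor.Monoidal.map_whiskerRight, Functor.Monoidal.map_associator,
      Functor.Monoidal.map_leftUnitor, Functor.Monoidal.map_rightUnitor_inv] at h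
    simp only [Category.assoc, Functor.Monoidal.μ_δ_assoc] at h
    rw [← cancel_mono (F.obj X ◁ Functor.LaxMonoidal.ε F ≫ Functor.LaxMonoidal.μ F _ _),
      ← cancel_epi (Functor.OplaxMonoidal.δ F (𝟙_ C) X ≫ Functor.OplaxMonoidal.η F ▷ F.obj X)]
    simpa using h

end Duals

section Unit
variable {k : Type v} [Field k] {C : Type u} [Category.{v} C] [Abelian C]
    [Linear k C] [MonoidalCategory C] [SymmetricCategory C] [MonoidalPreadditive C]
    [MonoidalLinear k C]

variable (k) in
lemma tensorLeft_exact [IsRigidTensorCategory k C] (X : C) :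
    PreservesFiniteLimits (tensorLeft X) ∧ PreservesFiniteColimits (tensorLeft X) := by
  obtain ⟨Y, ⟨p⟩⟩ := IsRigidTensorCategory.exists_dual (k := k) X
  have p' := BraidedCategory.exactPairing_swap X Y
  have := (tensorLeftAdjunction X Y).isRightAdjoint
  have := (tensorLeftAdjunction Y X).isLeftAdjoint
  exact ⟨inferInstance, inferInstance⟩

variable (k) in
lemma tensorRight_exact [IsRigidTensorCategory k C] (X : C) :
    PreservesFiniteLimits (tensorRight X) ∧ PreservesFiniteColimits (tensorRight X) := by
  obtain ⟨Y, ⟨p⟩⟩ := IsRigidTensorCategory.exists_dual (k := k) X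
  have p' := BraidedCategory.exactPairing_swap X Y
  have := (tensorRightAdjunction X Y).isLeftAdjoint
  have := (tensorRightAdjunction Y X).isRightAdjoint
  exact ⟨inferInstance, inferInstance⟩

variable (k) in
lemma mono_whiskerLeft [IsRigidTensorCategory k C] (X : C) {Y Z : C} (f : Y ⟶ Z) [Mono f] :
    Mono (X ◁ f) :=
  have := (tensorLeft_exact k X).1
  inferInstanceAs (Mono ((tensorLeft X).map f))

variable (k) in
lemma epi_whiskerLeft [IsRigidTensorCategory k C] (X : C) {Y Z : C} (f : Y ⟶ Z) [Epi f] :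
    Epi (X ◁ f) :=
  have := (tensorLeft_exact k X).2
  inferInstanceAs (Epi ((tensorLeft X).map f))

variable (k) in
lemma mono_whiskerRight [IsRigidTensorCategory k C] (X : C) {Y Z : C} (f : Y ⟶ Z) [Mono f] :
    Mono (f ▷ X) :=
  have := (tensorRight_exact k X).1
  inferInstanceAs (Mono ((tensorRight X).map f))

variable (k) in
lemma epi_whiskerRight [IsRigidTensorCategory k C] (X : C) {Y Z : C} (f : Y ⟶ Z) [Epi f] :
    Epi (f ▷ X) :=
  have := (tensorRight_exact k X).2
  inferInstanceAs (Epi ((tensorRight X).map f))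

variable (k) in
/-- A nonzero subobject `i : U ⟶ 𝟙_` of the unit is everything. If `i' : 𝟙_ ⟶ U'` is the dual
of `i`, then `i'` is an epimorphism and its kernel is killed by `U`, since `U ⊗ ker i'` embeds into
`𝟙_` by the zero morphism. Hence `U ≅ U ⊗ U'`, and the coevaluation of `U` gives a nonzero morphism
`𝟙_ ⟶ U`, whose composite with `i` is a nonzero scalar. -/
lemma isIso_of_mono_unit [IsRigidTensorCategory k C] {U : C} (i : U ⟶ 𝟙_ C) [Mono i]
    (hi : i ≠ 0) : IsIso i := by
  obtain ⟨U', ⟨p⟩⟩ := IsRigidTensorCategory.exists_dual (k := k) U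
  have p' := BraidedCategory.exactPairing_swap U U'
  let i' : 𝟙_ C ⟶ U' ⊗ 𝟙_ C := tensorLeftHomEquiv (𝟙_ C) U' U (𝟙_ C) ((ρ_ U).hom ≫ i)
  have hi' : i' = η_ U' U ≫ U' ◁ i := by
    have : (λ_ (𝟙_ C)).inv ≫ η_ U' U ▷ 𝟙_ C ≫ (α_ U' U (𝟙_ C)).hom ≫ U' ◁ (ρ_ U).hom =
      η_ U' U := by monoidal
    simp only [i', tensorLeftHomEquiv, Equiv.coe_fn_mk, MonoidalCategory.whiskerLeft_comp]
    rw [reassoc_of% this]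
  have hepi : Epi i' := by
    refine Preadditive.epi_of_cancel_zero _ fun {W} g hg => ?_
    have := mono_whiskerLeft k W i
    have h1 : η_ U' U ≫ ((ρ_ U').inv ≫ g) ▷ U ≫ W ◁ i = 0 := by
      have e : g = (ρ_ U').hom ≫ (ρ_ U').inv ≫ g := by simp
      rw [hi', e, Category.assoc] at hg
      rw [← whisker_exchange, ← cancel_mono (ρ_ W).hom]
      simpa using hg
    have h2 : η_ U' U ≫ ((ρ_ U').inv ≫ g) ▷ U = 0 := by
      rw [← cancel_mono (W ◁ i), zero_comp, Category.assoc, h1]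
    have h3 : tensorRightHomEquiv (𝟙_ C) U' U W ((λ_ U').hom ≫ (ρ_ U').inv ≫ g) =
        tensorRightHomEquiv (𝟙_ C) U' U W 0 := by
      have e : (ρ_ (𝟙_ C)).inv ≫ 𝟙_ C ◁ η_ U' U ≫ (α_ (𝟙_ C) U' U).inv ≫ (λ_ U').hom ▷ U =
        η_ U' U := by monoidal
      simp only [tensorRightHomEquiv, Equiv.coe_fn_mk]
      rw [comp_whiskerRight, reassoc_of% e, h2]
      simp
    simpa using (tensorRightHomEquiv _ _ _ _).injective h3
  have hK : IsZero (U ⊗ kernel i') := by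
    have := mono_whiskerLeft k U (kernel.ι i')
    have h : U ◁ kernel.ι i' ≫ (ρ_ U).hom ≫ i = 0 := by
      have h := tensorLeftHomEquiv_symm_naturality (Y' := U) (kernel.ι i') i'
      rw [kernel.condition] at h
      simp only [i', Equiv.symm_apply_apply] at h
      refine h.symm.trans ?_
      change U ◁ _ ≫ _ = _
      simp
    have hm := mono_comp (U ◁ kernel.ι i') ((ρ_ U).hom ≫ i)
    rw [h] at hm
    exact IsZero.of_mono_zero (U ⊗ kernel i') (𝟙_ C)
  have : Mono (U ◁ i') := by
    obtain ⟨_, _⟩ := tensorLeft_exact k U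
    let S := ShortComplex.mk _ _ (kernel.condition i')
    have hS : S.Exact := ShortComplex.exact_kernel i'
    exact (hS.map (tensorLeft U)).mono_g (hK.eq_of_src _ _)
  have : Epi (U ◁ i') := epi_whiskerLeft k U i'
  have : IsIso (U ◁ i') := isIso_of_mono_of_epi _
  let r : 𝟙_ C ⟶ U := η_ U U' ≫ U ◁ (ρ_ U').inv ≫ inv (U ◁ i') ≫ (ρ_ U).hom
  have hr : r ≠ 0 := by
    intro h
    have h' : η_ U U' = 0 := by
      rw [← cancel_mono (U ◁ (ρ_ U').inv ≫ inv (U ◁ i') ≫ (ρ_ U).hom), zero_comp]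
      exact h
    have h1 := ExactPairing.evaluation_coevaluation U U'
    rw [h'] at h1
    have h2 : 𝟙 U = 0 := by
      rw [← cancel_epi (λ_ U).hom, ← cancel_mono (ρ_ U).inv]
      simpa using h1.symm
    exact hi ((IsZero.iff_id_eq_zero U).2 h2 |>.eq_of_src _ _)
  -- `i` is split by a multiple of `r`.
  obtain ⟨c, hc⟩ := (IsRigidTensorCategory.end_unit (k := k) (C := C)).2 (r ≫ i)
  have hc0 : c ≠ 0 := by
    rintro rfl
    apply hr
    rw [← cancel_mono i, ← hc]
    simp
  have : Epi i := by
    refine Preadditive.epi_of_cancel_zero _ fun g hg => ?_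
    have : c • g = 0 := by
      have : (c • 𝟙 (𝟙_ C)) ≫ g = 0 := by
        change (fun a : k => a • 𝟙 (𝟙_ C)) c ≫ g = 0
        rw [hc, Category.assoc, hg, comp_zero]
      simpa using this
    exact (smul_eq_zero.1 this).resolve_left hc0
  exact isIso_of_mono_of_epi _

variable (k) in
/-- The kernel of `f` is a subobject of `𝟙_`, hence `0` or `𝟙_`. -/
lemma mono_of_unit_hom_ne_zero [IsRigidTensorCategory k C] {X : C} (f : 𝟙_ C ⟶ X) (hf : f ≠ 0) :
    Mono f := by
  by_cases h : kernel.ι f = 0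
  · exact Preadditive.mono_of_kernel_zero h
  · have := isIso_of_mono_unit k (kernel.ι f) h
    exact absurd (by rw [← cancel_epi (kernel.ι f), kernel.condition, comp_zero]) hf

end Unit

/-! ### Morphisms between objects coming from `T` -/

section Trivial

/-- A trivial object, as a direct sum of copies of the unit object. -/
lemma IsTrivialObj.exists_basis {C : Type*} [Category* C] [Abelian C] [MonoidalCategory C] {X : C}
    (h : IsTrivialObj X) : ∃ (n : ℕ) (i : Fin n → (𝟙_ C ⟶ X)) (p : Fin n → (X ⟶ 𝟙_ C)),
      (∀ a, i a ≫ p a = 𝟙 _) ∧ (∀ a b, a ≠ b → i a ≫ p b = 0) ∧ ∑ a, p a ≫ i a = 𝟙 X := by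
  obtain ⟨n, ⟨e⟩⟩ := h
  have := HasFiniteBiproducts.of_hasFiniteProducts (C := C)
  let e' : X ≅ ⨁ fun _ : Fin n => 𝟙_ C := e ≪≫ (biproduct.isoCoproduct _).symm
  refine ⟨n, fun a => biproduct.ι (fun _ : Fin n => 𝟙_ C) a ≫ e'.inv,
    fun a => e'.hom ≫ biproduct.π (fun _ : Fin n => 𝟙_ C) a, fun a => by simp,
    fun a b hab => by simp [biproduct.ι_π_ne _ hab], ?_⟩
  have : ∑ a, e'.hom ≫ (biproduct.π (fun _ : Fin n => 𝟙_ C) a ≫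
      biproduct.ι (fun _ : Fin n => 𝟙_ C) a) ≫ e'.inv =
      𝟙 X := by
    rw [← Preadditive.comp_sum, ← Preadditive.sum_comp, biproduct.total]
    simp
  simpa using this

lemma isTrivialObj_of_isZero {C : Type*} [Category* C] [Abelian C] [MonoidalCategory C] {X : C}
    (h : IsZero X) : IsTrivialObj X := by
  refine ⟨0, ⟨h.iso ?_⟩⟩
  rw [IsZero.iff_id_eq_zero]
  exact Sigma.hom_ext _ _ fun a => a.elim0

lemma isTrivialObj_unit {C : Type*} [Category* C] [Abelian C] [MonoidalCategory C] :
    IsTrivialObj (𝟙_ C) :=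
  ⟨1, ⟨(biproductUniqueIso fun _ : Fin 1 => 𝟙_ C).symm ≪≫ biproduct.isoCoproduct _⟩⟩

end Trivial

section Hom
variable (k K : Type v) [Field k] [Field K] [Algebra k K]
    {T : Type v} [SmallCategory T] [Abelian T] [Linear k T]
    {D : Type u} [Category.{v} D] [Abelian D] [Linear K D]
    (q : T ⥤ D) [q.Additive] [IsLinearOver k K q]

/-- The comparison map `K ⊗ Hom(X, Y) ⟶ Hom(q X, q Y)`. -/
def homComparison (X Y : T) : K ⊗[k] (X ⟶ Y) →ₗ[K] (q.obj X ⟶ q.obj Y) :=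
  letI : Module k (q.obj X ⟶ q.obj Y) := Module.compHom _ (algebraMap k K)
  haveI : IsScalarTower k K (q.obj X ⟶ q.obj Y) :=
    ⟨fun a b x => by rw [Algebra.smul_def, mul_smul]; rfl⟩
  LinearMap.liftBaseChange K
    { toFun := fun f => q.map f
      map_add' := fun f g => q.map_add
      map_smul' := fun a f => IsLinearOver.map_smul a f }

variable {k K}

@[simp]
lemma homComparison_tmul {X Y : T} (c : K) (f : X ⟶ Y) :
    homComparison k K q X Y (c ⊗ₜ f) = c • q.map f := by
  simp [homComparison]

end Hom

section Rigid
variable {k K : Type v} [Field k] [Field K] [Algebra k K]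
    {T : Type v} [SmallCategory T] [Abelian T] [Linear k T] [MonoidalCategory T]
    [SymmetricCategory T] [MonoidalPreadditive T] [MonoidalLinear k T]
    [IsRigidTensorCategory k T]
    {D : Type u} [Category.{v} D] [Abelian D] [Linear K D] [MonoidalCategory D]
    [SymmetricCategory D] [MonoidalPreadditive D] [MonoidalLinear K D]
    [IsRigidTensorCategory K D]
    (q : T ⥤ D) [q.Monoidal] [q.Additive] [IsLinearOver k K q]
    [PreservesFiniteLimits q] [PreservesFiniteColimits q]

lemma not_isZero_unit (K : Type v) [Field K] {D : Type u} [Category.{v} D] [Abelian D]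
    [Linear K D] [MonoidalCategory D] [SymmetricCategory D] [MonoidalPreadditive D]
    [MonoidalLinear K D] [IsRigidTensorCategory K D] : ¬ IsZero (𝟙_ D) := by
  intro h
  exact one_ne_zero ((IsRigidTensorCategory.end_unit (k := K) (C := D)).1 (h.eq_of_src _ _) :
    (1 : K) = 0)

variable (K) in
lemma exists_eq_smul_id_obj_unit (f : q.obj (𝟙_ T) ⟶ q.obj (𝟙_ T)) : ∃ c : K, f = c • 𝟙 _ := by
  obtain ⟨c, hc⟩ := (IsRigidTensorCategory.end_unit (k := K) (C := D)).2
    (Functor.LaxMonoidal.ε q ≫ f ≫ Functor.OplaxMonoidal.η q)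
  refine ⟨c, ?_⟩
  rw [← cancel_epi (Functor.LaxMonoidal.ε q), ← cancel_mono (Functor.OplaxMonoidal.η q)]
  simpa using hc.symm

variable (K) {q} in
include K in
/-- A zero object is trivial, so `X` is a direct sum of copies of `𝟙_`, and the number of copies
must be `0` because `q` does not kill `𝟙_`. -/
lemma IsBaseChange.isZero_of_isZero_obj (hq : IsBaseChange q) {X : T} (h : IsZero (q.obj X)) :
    IsZero X := by
  obtain ⟨n, i, p, h1, -, h3⟩ :=
    ((hq.trivial_iff X).1 (isTrivialObj_of_isZero h)).exists_basis
  have : IsEmpty (Fin n) := ⟨fun a => not_isZero_unit K (D := D) (by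
    have h0 : q.map (i a) ≫ q.map (p a) = 0 := by rw [h.eq_of_tgt (q.map (i a)) 0, zero_comp]
    rw [← q.map_comp, h1, q.map_id] at h0
    exact ((IsZero.iff_id_eq_zero _).2 h0).of_iso (Functor.Monoidal.εIso q))⟩
  rw [IsZero.iff_id_eq_zero, ← h3, Finset.univ_eq_empty, Finset.sum_empty]

variable (K) {q} in
include K in
/-- The functor `q` is faithful: it kills the image of `f`. -/
lemma IsBaseChange.eq_zero_of_map (hq : IsBaseChange q) {X Y : T} (f : X ⟶ Y)
    (h : q.map f = 0) : f = 0 := by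
  have h1 : q.map (image.ι f) = 0 := by
    rw [← cancel_epi (q.map (factorThruImage f)), ← q.map_comp, image.fac, h, comp_zero]
  have hm : Mono (q.map (image.ι f)) := inferInstance
  rw [h1] at hm
  have := hq.isZero_of_isZero_obj K (IsZero.of_mono_zero (q.obj (image f)) (q.obj Y))
  rw [← image.fac f, this.eq_of_src (image.ι f) 0, comp_zero]

variable (K) in
/-- There is a `k`-basis of `Hom(𝟙_, X)` whose image under `q` is a `K`-basis of `Hom(q 𝟙_, q X)`.
The morphisms from `q 𝟙_` to `q X` factor through the largest trivial subobject of `q X`, which is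
isomorphic to `q X'` for a subobject `X'` of `X`; this `X'` is trivial, and `Hom(𝟙_, X')` has an
obvious basis. -/
lemma IsBaseChange.exists_basis_hom_unit (hq : IsBaseChange q) (X : T) :
    ∃ (n : ℕ) (b : Fin n → (𝟙_ T ⟶ X)),
      (∀ c : Fin n → K, ∑ a, c a • q.map (b a) = 0 → c = 0) ∧
      (∀ f : q.obj (𝟙_ T) ⟶ q.obj X, ∃ c : Fin n → K, f = ∑ a, c a • q.map (b a)) ∧
      (∀ f : 𝟙_ T ⟶ X, ∃ c : Fin n → k, f = ∑ a, c a • b a) := by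
  obtain ⟨S, ⟨hS, hmax⟩, X', ⟨e⟩⟩ := hq.trivial_sub X
  have hX' : IsTrivialObj (X' : T) := by
    obtain ⟨n, ⟨e'⟩⟩ := hS
    exact (hq.trivial_iff _).1 ⟨n, ⟨e.symm ≪≫ e'⟩⟩
  obtain ⟨n, i, p, h1, h2, h3⟩ := hX'.exists_basis
  have hspan (g : q.obj (𝟙_ T) ⟶ q.obj (X' : T)) : ∃ c : Fin n → K, g = ∑ a, c a • q.map (i a) := by
    choose c hc using fun a => exists_eq_smul_id_obj_unit K q (g ≫ q.map (p a))
    refine ⟨c, ?_⟩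
    calc g = g ≫ q.map (∑ a, p a ≫ i a) := by rw [h3]; simp
      _ = ∑ a, (g ≫ q.map (p a)) ≫ q.map (i a) := by
        simp [Functor.map_sum, Preadditive.comp_sum]
      _ = _ := Finset.sum_congr rfl fun a _ => by rw [hc a]; simp
  have : Module.Finite K (q.obj (𝟙_ T) ⟶ q.obj (X' : T)) :=
    Module.Finite.of_surjective (Fintype.linearCombination K fun a => q.map (i a)) fun g => by
      obtain ⟨c, rfl⟩ := hspan g
      exact ⟨c, rfl⟩
  -- Two embeddings of `Hom(q 1, q X')` into `Hom(q 1, q X)`; the second one is onto, hence so is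
  -- the first one.
  let j := Linear.rightComp K (q.obj (𝟙_ T)) (q.map X'.arrow)
  let θ := Linear.rightComp K (q.obj (𝟙_ T)) (e.inv ≫ S.arrow)
  have hj : Function.Injective j := fun a b h => (cancel_mono (q.map X'.arrow)).1 h
  have hθ : Function.Bijective θ := by
    refine ⟨fun a b h => (cancel_mono (e.inv ≫ S.arrow)).1 h, fun f => ?_⟩
    by_cases hf : f = 0
    · exact ⟨0, by rw [map_zero, hf]⟩
    have hf' : Functor.LaxMonoidal.ε q ≫ f ≠ 0 := fun h => hf (by
      rw [← cancel_epi (Functor.LaxMonoidal.ε q), h, comp_zero])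
    have := mono_of_unit_hom_ne_zero K _ hf'
    have hle : Subobject.mk (Functor.LaxMonoidal.ε q ≫ f) ≤ S := hmax (by
      obtain ⟨m, ⟨e'⟩⟩ := isTrivialObj_unit (C := D)
      exact ⟨m, ⟨Subobject.underlyingIso _ ≪≫ e'⟩⟩)
    refine ⟨Functor.OplaxMonoidal.η q ≫ Subobject.ofMkLE _ _ hle ≫ e.hom, ?_⟩
    change (Functor.OplaxMonoidal.η q ≫ Subobject.ofMkLE _ _ hle ≫ e.hom) ≫ e.inv ≫ S.arrow = f
    simp
  let θ' := LinearEquiv.ofBijective θ hθ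
  have hsurj : Function.Surjective j := by
    have h := LinearMap.injective_iff_surjective.1
      (show Function.Injective (θ'.symm.toLinearMap ∘ₗ j) from θ'.symm.injective.comp hj)
    intro f
    obtain ⟨g, hg⟩ := h (θ'.symm f)
    exact ⟨g, θ'.symm.injective hg⟩
  refine ⟨n, fun a => i a ≫ X'.arrow, fun c hc => ?_, fun f => ?_, fun f => ?_⟩
  · have hc' : ∑ a, c a • q.map (i a) = 0 := hj (by
      rw [map_zero, map_sum, ← hc]
      simp [j])
    ext b
    have hb : (∑ a, c a • q.map (i a)) ≫ q.map (p b) = c b • 𝟙 _ := by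
      rw [Preadditive.sum_comp, Finset.sum_eq_single b]
      · rw [Linear.smul_comp, ← q.map_comp, h1, q.map_id]
      · intro a _ hab
        rw [Linear.smul_comp, ← q.map_comp, h2 a b hab, q.map_zero, smul_zero]
      · simp
    rw [hc', zero_comp] at hb
    refine (smul_eq_zero.1 hb.symm).resolve_right fun h => not_isZero_unit K (D := D) ?_
    exact ((IsZero.iff_id_eq_zero _).2 h).of_iso (Functor.Monoidal.εIso q)
  · obtain ⟨g, rfl⟩ := hsurj f
    obtain ⟨c, rfl⟩ := hspan g
    exact ⟨c, by simp [j]⟩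
  · -- `q f` factors through `q X'`, hence `f` through `X'`, since `q` is faithful.
    obtain ⟨g, hg⟩ := hsurj (q.map f)
    have h0 : f ≫ cokernel.π X'.arrow = 0 := hq.eq_zero_of_map K _ (by
      rw [q.map_comp, ← hg]
      change (g ≫ q.map X'.arrow) ≫ _ = 0
      rw [Category.assoc, ← q.map_comp, cokernel.condition, q.map_zero, comp_zero])
    choose c hc using fun a => (IsRigidTensorCategory.end_unit (k := k) (C := T)).2
      (Abelian.monoLift X'.arrow f h0 ≫ p a)
    refine ⟨c, ?_⟩
    calc f = (Abelian.monoLift X'.arrow f h0 ≫ ∑ a, p a ≫ i a) ≫ X'.arrow := by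
          rw [h3, Category.comp_id, Abelian.monoLift_comp]
      _ = ∑ a, ((Abelian.monoLift X'.arrow f h0 ≫ p a) ≫ i a) ≫ X'.arrow := by
        simp [Preadditive.comp_sum, Preadditive.sum_comp]
      _ = _ := Finset.sum_congr rfl fun a _ => by rw [← hc a]; simp

lemma IsBaseChange.homComparison_unit_bijective (hq : IsBaseChange q) (X : T) :
    Function.Bijective (homComparison k K q (𝟙_ T) X) := by
  obtain ⟨n, b, h1, h2, h3⟩ := hq.exists_basis_hom_unit K q X (k := k)
  refine ⟨?_, fun f => ?_⟩
  · rw [injective_iff_map_eq_zero]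
    intro s hs
    have hs' : ∃ c : Fin n → K, s = ∑ a, c a ⊗ₜ[k] b a := by
      clear hs
      induction s using TensorProduct.induction_on with
      | zero => exact ⟨0, by simp⟩
      | add s t hs ht =>
        obtain ⟨c, rfl⟩ := hs
        obtain ⟨d, rfl⟩ := ht
        exact ⟨c + d, by simp [TensorProduct.add_tmul, Finset.sum_add_distrib]⟩
      | tmul c f =>
        obtain ⟨d, rfl⟩ := h3 f
        exact ⟨fun a => d a • c, by simp [TensorProduct.tmul_sum, TensorProduct.smul_tmul]⟩
    obtain ⟨c, rfl⟩ := hs'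
    have := h1 c (by simpa using hs)
    simp [this]
  · obtain ⟨c, rfl⟩ := h2 f
    exact ⟨∑ a, c a ⊗ₜ[k] b a, by simp⟩

/-- The comparison map `K ⊗ Hom(X, Y) ⟶ Hom(q X, q Y)` is bijective. By duality this reduces to
the case `X = 𝟙_`. -/
lemma IsBaseChange.homComparison_bijective (hq : IsBaseChange q) (X Y : T) :
    Function.Bijective (homComparison k K q X Y) := by
  obtain ⟨X', ⟨p⟩⟩ := IsRigidTensorCategory.exists_dual (k := k) X
  let p' := exactPairingMap q X X'
  -- `A` is the duality isomorphism in `T`, and `B` its analogue in `D`.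
  let A : (X ⟶ Y) →ₗ[k] (𝟙_ T ⟶ Y ⊗ X') :=
    { toFun := fun f => η_ X X' ≫ f ▷ X'
      map_add' := fun f g => by simp
      map_smul' := fun a f => by simp }
  have hA : Function.Bijective A := by
    have h : ⇑A = tensorRightHomEquiv (𝟙_ T) X X' Y ∘ fun f => (λ_ X).hom ≫ f := by
      ext f
      have e : (ρ_ (𝟙_ T)).inv ≫ 𝟙_ T ◁ η_ X X' ≫ (α_ (𝟙_ T) X X').inv ≫ (λ_ X).hom ▷ X' =
        η_ X X' := by monoidal
      simp only [Function.comp_apply, tensorRightHomEquiv, Equiv.coe_fn_mk]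
      rw [comp_whiskerRight, reassoc_of% e]
      rfl
    rw [h]
    exact (tensorRightHomEquiv _ _ _ _).bijective.comp ⟨fun f g h => (cancel_epi _).1 h,
      fun f => ⟨(λ_ X).inv ≫ f, by simp⟩⟩
  let B : (q.obj X ⟶ q.obj Y) →ₗ[K] (q.obj (𝟙_ T) ⟶ q.obj (Y ⊗ X')) :=
    { toFun := fun f => q.map (η_ X X') ≫ Functor.OplaxMonoidal.δ q X X' ≫ f ▷ q.obj X' ≫
        Functor.LaxMonoidal.μ q Y X'
      map_add' := fun f g => by simp
      map_smul' := fun a f => by simp }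
  have hB : Function.Injective B := by
    intro f g h
    have h' : tensorRightHomEquiv (𝟙_ D) (q.obj X) (q.obj X') (q.obj Y) ((λ_ _).hom ≫ f) =
        tensorRightHomEquiv (𝟙_ D) (q.obj X) (q.obj X') (q.obj Y) ((λ_ _).hom ≫ g) := by
      have e : (ρ_ (𝟙_ D)).inv ≫ 𝟙_ D ◁ η_ (q.obj X) (q.obj X') ≫
        (α_ (𝟙_ D) (q.obj X) (q.obj X')).inv ≫ (λ_ (q.obj X)).hom ▷ q.obj X' =
          η_ (q.obj X) (q.obj X') := by monoidal
      have e' : η_ (q.obj X) (q.obj X') = Functor.LaxMonoidal.ε q ≫ q.map (η_ X X') ≫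
        Functor.OplaxMonoidal.δ q X X' := rfl
      simp only [tensorRightHomEquiv, Equiv.coe_fn_mk]
      rw [comp_whiskerRight, reassoc_of% e, comp_whiskerRight, reassoc_of% e, e',
        ← cancel_mono (Functor.LaxMonoidal.μ q Y X')]
      simpa [B] using congrArg (Functor.LaxMonoidal.ε q ≫ ·) h
    exact (cancel_epi _).1 ((tensorRightHomEquiv _ _ _ _).injective h')
  have hAB (s : K ⊗[k] (X ⟶ Y)) : B (homComparison k K q X Y s) =
      homComparison k K q (𝟙_ T) (Y ⊗ X') (A.baseChange K s) := by
    induction s using TensorProduct.induction_on with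
    | zero => simp only [map_zero]
    | add s t hs ht => simp only [map_add, hs, ht]
    | tmul c f =>
      rw [homComparison_tmul, map_smul, LinearMap.baseChange_tmul, homComparison_tmul]
      congr 1
      change q.map (η_ X X') ≫ _ ≫ q.map f ▷ _ ≫ _ = q.map (η_ X X' ≫ f ▷ X')
      rw [q.map_comp, Functor.Monoidal.map_whiskerRight]
  have hA' : Function.Bijective (A.baseChange K) :=
    ((LinearEquiv.ofBijective A hA).baseChange k K _ _).bijective
  have h1 := hq.homComparison_unit_bijective q (k := k) (K := K) (Y ⊗ X')
  refine ⟨fun s t h => hA'.1 (h1.1 ?_), fun f => ?_⟩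
  · rw [← hAB, ← hAB, h]
  · obtain ⟨s, hs⟩ := (h1.comp hA').2 (B f)
    exact ⟨s, hB ((hAB s).trans hs)⟩

end Rigid

/-! ### Ind-objects through their elements -/

section IndElements
variable {T : Type v} [SmallCategory T]

/-- A natural map on elements `X ⟶ M`, with `X` in `T`, comes from a morphism of ind-objects. -/
def indHomMk {M N : Ind T} (φ : ∀ Z : T, (Ind.yoneda.obj Z ⟶ M) → (Ind.yoneda.obj Z ⟶ N))
    (hφ : ∀ {Z Z' : T} (g : Z' ⟶ Z) (x : Ind.yoneda.obj Z ⟶ M),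
      φ Z' (Ind.yoneda.map g ≫ x) = Ind.yoneda.map g ≫ φ Z x) : M ⟶ N :=
  Ind.inclusion.fullyFaithful.preimage
    { app := fun Z => TypeCat.ofHom fun m =>
        elemEquiv Z.unop N (φ Z.unop ((elemEquiv Z.unop M).symm m))
      naturality := fun Z Z' g => by
        ext m
        obtain ⟨x, rfl⟩ := (elemEquiv Z.unop M).surjective m
        have h : elemEquiv Z'.unop M (Ind.yoneda.map g.unop ≫ x) =
          ((Ind.inclusion T).obj M).map g (elemEquiv Z.unop M x) :=
            elemEquiv_naturality_left g.unop x
        have h' : elemEquiv Z'.unop N (Ind.yoneda.map g.unop ≫ φ Z.unop x) =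
          ((Ind.inclusion T).obj N).map g (elemEquiv Z.unop N (φ Z.unop x)) :=
            elemEquiv_naturality_left g.unop (φ Z.unop x)
        simp [← h, ← h', hφ] }

@[simp]
lemma comp_indHomMk {M N : Ind T} (φ : ∀ Z : T, (Ind.yoneda.obj Z ⟶ M) → (Ind.yoneda.obj Z ⟶ N))
    (hφ : ∀ {Z Z' : T} (g : Z' ⟶ Z) (x : Ind.yoneda.obj Z ⟶ M),
      φ Z' (Ind.yoneda.map g ≫ x) = Ind.yoneda.map g ≫ φ Z x) {Z : T}
    (x : Ind.yoneda.obj Z ⟶ M) : x ≫ indHomMk φ hφ = φ Z x := by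
  apply (elemEquiv Z N).injective
  rw [elemEquiv_naturality_right]
  simp [indHomMk]

lemma ind_isIso_of_bijective {M N : Ind T} (f : M ⟶ N)
    (hf : ∀ Z : T, Function.Bijective fun x : Ind.yoneda.obj Z ⟶ M => x ≫ f) : IsIso f := by
  let g : N ⟶ M := indHomMk (fun Z => (Equiv.ofBijective _ (hf Z)).symm) fun {Z Z'} g x => by
    rw [Equiv.symm_apply_eq, Equiv.ofBijective_apply, Category.assoc]
    exact congrArg (Ind.yoneda.map g ≫ ·) ((Equiv.ofBijective _ (hf Z)).apply_symm_apply x).symm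
  refine ⟨g, ind_hom_ext fun Z x => ?_, ind_hom_ext fun Z x => ?_⟩
  · rw [← Category.assoc, comp_indHomMk, Category.comp_id]
    exact (Equiv.ofBijective _ (hf Z)).symm_apply_apply x
  · rw [← Category.assoc, comp_indHomMk, Category.comp_id]
    exact (Equiv.ofBijective _ (hf Z)).apply_symm_apply x

variable [Abelian T]

lemma ind_mono_of_injective {M N : Ind T} (f : M ⟶ N)
    (hf : ∀ (Z : T) (x : Ind.yoneda.obj Z ⟶ M), x ≫ f = 0 → x = 0) : Mono f :=
  Preadditive.mono_of_cancel_zero _ fun g hg => ind_hom_ext fun Z x => by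
    rw [comp_zero]
    exact hf Z _ (by rw [Category.assoc, hg, comp_zero])

lemma ind_epi_of_locally_surjective {M N : Ind T} (f : M ⟶ N)
    (hf : ∀ (X : T) (n : Ind.yoneda.obj X ⟶ N), ∃ (Y : T) (g : Y ⟶ X) (_ : Epi g)
      (m : Ind.yoneda.obj Y ⟶ M), m ≫ f = Ind.yoneda.map g ≫ n) : Epi f :=
  Preadditive.epi_of_cancel_zero _ fun h hh => ind_hom_ext fun X n => by
    obtain ⟨Y, g, _, m, hm⟩ := hf X n
    rw [← cancel_epi (Ind.yoneda.map g), ← Category.assoc, ← hm, Category.assoc, hh]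
    simp

/-- If `X` is noetherian, then an epimorphism onto `X` in `Ind T` restricts to an epimorphism from
an object of `T` onto `X`: among the images of the morphisms to `X` from objects of `T` which factor
through it, there is a largest one. -/
lemma exists_epi_of_epi_yoneda {P : Ind T} {X : T} [IsNoetherianObject X]
    (f : P ⟶ Ind.yoneda.obj X) [Epi f] :
    ∃ (Y : T) (g : Y ⟶ X) (_ : Epi g) (y : Ind.yoneda.obj Y ⟶ P), y ≫ f = Ind.yoneda.map g := by
  let s : Set (Subobject X) := {S | ∃ (Y : T) (g : Y ⟶ X) (y : Ind.yoneda.obj Y ⟶ P),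
    y ≫ f = Ind.yoneda.map g ∧ S = imageSubobject g}
  have hs : s.Nonempty := ⟨_, X, 0, 0, by simp, rfl⟩
  obtain ⟨S, ⟨Y, g, y, hy, rfl⟩, hmax⟩ := wellFounded_gt.has_min s hs
  refine ⟨Y, g, Preadditive.epi_of_cokernel_zero (Ind.yoneda.map_injective ?_), y, hy⟩
  rw [← cancel_epi f, Functor.map_zero, comp_zero]
  refine ind_hom_ext fun Z z => ?_
  obtain ⟨h, hh⟩ := Ind.yoneda.map_surjective (z ≫ f)
  have hle : imageSubobject (biprod.desc g h) ≤ imageSubobject g := by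
    by_contra hlt
    refine hmax (imageSubobject (biprod.desc g h)) ⟨Y ⊞ Z, _,
      Ind.yoneda.map biprod.fst ≫ y + Ind.yoneda.map biprod.snd ≫ z, ?_, rfl⟩
      (lt_of_le_not_ge ?_ hlt)
    · rw [Preadditive.add_comp, Category.assoc, Category.assoc, hy, ← hh, ← Functor.map_comp,
        ← Functor.map_comp, ← Functor.map_add]
      congr 1
      ext <;> simp
    · conv_lhs => rw [← biprod.inl_desc g h]
      exact imageSubobject_comp_le _ _
  have h0 : h ≫ cokernel.π g = 0 := by
    have e : h = (biprod.inr ≫ factorThruImageSubobject (biprod.desc g h) ≫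
        Subobject.ofLE _ _ hle) ≫ (imageSubobject g).arrow := by simp
    have e' : (imageSubobject g).arrow ≫ cokernel.π g = 0 := by
      rw [← cancel_epi (factorThruImageSubobject g)]
      simp
    rw [e, Category.assoc, e', comp_zero]
  rw [← Category.assoc, ← hh, ← Functor.map_comp, h0, Functor.map_zero, comp_zero]

/-- Elements lift along an epimorphism of ind-objects, up to an epimorphism of `T`. -/
lemma exists_lift_of_ind_epi {M N : Ind T} (f : M ⟶ N) [Epi f] {X : T} [IsNoetherianObject X]
    (n : Ind.yoneda.obj X ⟶ N) : ∃ (Y : T) (g : Y ⟶ X) (_ : Epi g) (m : Ind.yoneda.obj Y ⟶ M),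
      m ≫ f = Ind.yoneda.map g ≫ n := by
  obtain ⟨Y, g, hg, y, hy⟩ := exists_epi_of_epi_yoneda (pullback.snd f n)
  refine ⟨Y, g, hg, y ≫ pullback.fst f n, ?_⟩
  rw [Category.assoc, pullback.condition, ← Category.assoc, hy]

end IndElements

namespace IndMod
variable {k K : Type v} [Field k] [Field K] [Algebra k K]
variable {T : Type v} [SmallCategory T] [Abelian T] [Linear k T]

/-- The underlying ind-object. -/
@[simps]
def forgetInd : IndMod k K T ⥤ Ind T where
  obj M := M.obj
  map f := f.hom

instance : (forgetInd (k := k) (K := K) (T := T)).Faithful := ⟨fun h => hom_ext h⟩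

instance : (forgetInd (k := k) (K := K) (T := T)).Additive := ⟨rfl⟩

instance : (forgetInd (k := k) (K := K) (T := T)).ReflectsIsomorphisms where
  reflects {M N} f hf := by
    have : IsIso f.hom := hf
    refine ⟨⟨inv f.hom, fun a => ?_⟩, hom_ext ?_, hom_ext ?_⟩
    · rw [← cancel_epi f.hom, ← Category.assoc, ← f.comm, Category.assoc]
      simp
    · simp
    · simp

instance {J : Type*} [Category* J] :
    ReflectsColimitsOfShape J (forgetInd (k := k) (K := K) (T := T)) where
  reflectsColimit {F} := ⟨fun {c} hc => ⟨
    { desc := fun s => ⟨hc.desc (forgetInd.mapCocone s), fun a => hc.hom_ext fun j => by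
        let d : c.pt.obj ⟶ s.pt.obj := hc.desc (forgetInd.mapCocone s)
        have h3 : (c.ι.app j).hom ≫ d = (s.ι.app j).hom := hc.fac (forgetInd.mapCocone s) j
        change (c.ι.app j).hom ≫ c.pt.act a ≫ d = (c.ι.app j).hom ≫ d ≫ s.pt.act a
        have h1 : (F.obj j).act a ≫ (c.ι.app j).hom = (c.ι.app j).hom ≫ c.pt.act a :=
          (c.ι.app j).comm a
        have h2 : (F.obj j).act a ≫ (s.ι.app j).hom = (s.ι.app j).hom ≫ s.pt.act a :=
          (s.ι.app j).comm a
        rw [← Category.assoc, ← h1, Category.assoc, h3, h2, ← Category.assoc, h3]⟩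
      fac := fun s j => hom_ext (hc.fac (forgetInd.mapCocone s) j)
      uniq := fun s m hm => hom_ext (hc.uniq (forgetInd.mapCocone s) m.hom fun j =>
        congrArg Hom.hom (hm j)) }⟩⟩

instance {J : Type*} [Category* J] :
    ReflectsLimitsOfShape J (forgetInd (k := k) (K := K) (T := T)) where
  reflectsLimit {F} := ⟨fun {c} hc => ⟨
    { lift := fun s => ⟨hc.lift (forgetInd.mapCone s), fun a => hc.hom_ext fun j => by
        let d : s.pt.obj ⟶ c.pt.obj := hc.lift (forgetInd.mapCone s)
        have h3 : d ≫ (c.π.app j).hom = (s.π.app j).hom := hc.fac (forgetInd.mapCone s) j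
        change (s.pt.act a ≫ d) ≫ (c.π.app j).hom = (d ≫ c.pt.act a) ≫ (c.π.app j).hom
        have h1 : c.pt.act a ≫ (c.π.app j).hom = (c.π.app j).hom ≫ (F.obj j).act a :=
          (c.π.app j).comm a
        have h2 : s.pt.act a ≫ (s.π.app j).hom = (s.π.app j).hom ≫ (F.obj j).act a :=
          (s.π.app j).comm a
        rw [Category.assoc, h3, h2, Category.assoc, h1, ← Category.assoc, h3]⟩
      fac := fun s j => hom_ext (hc.fac (forgetInd.mapCone s) j)
      uniq := fun s m hm => hom_ext (hc.uniq (forgetInd.mapCone s) m.hom fun j =>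
        congrArg Hom.hom (hm j)) }⟩⟩

/-- The action of `K` on the cokernel of a morphism of `K`-modules. -/
def cokernelAct {M N : IndMod k K T} (f : M ⟶ N) (a : K) :
    cokernel f.hom ⟶ cokernel f.hom :=
  cokernel.desc _ (N.act a ≫ cokernel.π f.hom) (by
    rw [← Category.assoc, ← f.comm, Category.assoc, cokernel.condition, comp_zero])

lemma π_cokernelAct {M N : IndMod k K T} (f : M ⟶ N) (a : K) :
    cokernel.π f.hom ≫ cokernelAct f a = N.act a ≫ cokernel.π f.hom :=
  cokernel.π_desc _ _ _

/-- The cokernel of a morphism of `K`-modules in `Ind T`. -/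
def coker {M N : IndMod k K T} (f : M ⟶ N) : IndMod k K T where
  obj := cokernel f.hom
  act :=
    { toFun := cokernelAct f
      map_one' := by
        rw [← cancel_epi (cokernel.π f.hom), π_cokernelAct, act_one, Category.id_comp]
        exact (Category.comp_id _).symm
      map_mul' := fun a b => by
        rw [End.mul_def, ← cancel_epi (cokernel.π f.hom), π_cokernelAct, act_mul,
          ← Category.assoc, π_cokernelAct, Category.assoc, Category.assoc, π_cokernelAct]
      map_zero' := by
        rw [← cancel_epi (cokernel.π f.hom), π_cokernelAct, act_zero]
        exact zero_comp.trans comp_zero.symm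
      map_add' := fun a b => by
        rw [← cancel_epi (cokernel.π f.hom), π_cokernelAct, act_add]
        refine (Preadditive.add_comp _ _ _ _ _ _).trans
          (Eq.trans ?_ (Preadditive.comp_add _ _ _ _ _ _).symm)
        rw [π_cokernelAct, π_cokernelAct]
      commutes' := fun a => by
        rw [← cancel_epi (cokernel.π f.hom), π_cokernelAct, AlgHom.commutes,
          Algebra.algebraMap_eq_smul_one, Algebra.algebraMap_eq_smul_one]
        refine (Linear.smul_comp _ _ _ _ _ _).trans
          (Eq.trans ?_ (Linear.comp_smul _ _ _ _ _ _).symm)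
        exact congrArg (a • ·) ((Category.id_comp _).trans (Category.comp_id _).symm) }

/-- The projection to the cokernel. -/
def toCoker {M N : IndMod k K T} (f : M ⟶ N) : N ⟶ coker f :=
  ⟨cokernel.π f.hom, fun a => (π_cokernelAct f a).symm⟩

lemma comp_toCoker {M N : IndMod k K T} (f : M ⟶ N) : f ≫ toCoker f = 0 :=
  hom_ext (cokernel.condition f.hom)

lemma epi_hom_of_toCoker_eq_zero {M N : IndMod k K T} (f : M ⟶ N) (h : toCoker f = 0) :
    Epi f.hom :=
  Preadditive.epi_of_cokernel_zero (congrArg Hom.hom h)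

lemma yoneda_map_smul (a : k) {X Y : T} (f : X ⟶ Y) :
    Ind.yoneda.map (a • f) = a • Ind.yoneda.map f := by
  rw [yoneda_comp_smul, ← Functor.map_comp, Linear.smul_comp, Category.id_comp]

lemma act_smul (M : IndMod k K T) (a : k) (c : K) : M.act (a • c) = a • M.act c := map_smul _ _ _

/-- The map `K ⊗ Hom(Z, X) ⟶ Hom(Z, M)`, `c ⊗ h ↦ c • (x ∘ h)`. -/
def extendDescElem {X : T} {M : IndMod k K T} (x : Ind.yoneda.obj X ⟶ M.obj) (Z : T) :
    K ⊗[k] (Z ⟶ X) →ₗ[k] (Ind.yoneda.obj Z ⟶ M.obj) :=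
  TensorProduct.lift (LinearMap.mk₂ k (fun c h => Ind.yoneda.map h ≫ x ≫ M.act c)
    (fun c c' h => by
      rw [act_add]
      exact (congrArg (_ ≫ ·) (Preadditive.comp_add _ _ _ _ _ _)).trans
        (Preadditive.comp_add _ _ _ _ _ _))
    (fun a c h => by
      rw [act_smul]
      exact (congrArg (_ ≫ ·) (Linear.comp_smul _ _ _ _ _ _)).trans (Linear.comp_smul _ _ _ _ _ _))
    (fun c h h' => by rw [Functor.map_add, Preadditive.add_comp])
    (fun a c h => by rw [yoneda_map_smul, Linear.smul_comp]))

@[simp]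
lemma extendDescElem_tmul {X : T} {M : IndMod k K T} (x : Ind.yoneda.obj X ⟶ M.obj) {Z : T} (c : K)
    (h : Z ⟶ X) : extendDescElem x Z (c ⊗ₜ h) = Ind.yoneda.map h ≫ x ≫ M.act c := rfl

lemma extendEquiv_naturality {X Z Z' : T} (g : Z' ⟶ Z) (s : K ⊗[k] (Z ⟶ X)) :
    Ind.yoneda.map g ≫ extendEquiv k K Z X s =
      extendEquiv k K Z' X (LinearMap.baseChange K (Linear.leftComp k X g) s) :=
  (extLex k K X).elem_naturality g s

lemma extendDescElem_naturality {X : T} {M : IndMod k K T} (x : Ind.yoneda.obj X ⟶ M.obj) {Z Z' : T}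
    (g : Z' ⟶ Z) (s : K ⊗[k] (Z ⟶ X)) :
    extendDescElem x Z' (LinearMap.baseChange K (Linear.leftComp k X g) s) =
      Ind.yoneda.map g ≫ extendDescElem x Z s := by
  induction s using TensorProduct.induction_on with
  | zero => simp
  | add s t hs ht => simp only [map_add, hs, ht, Preadditive.comp_add]
  | tmul c f => simp

lemma extendDescElem_smul {X : T} {M : IndMod k K T} (x : Ind.yoneda.obj X ⟶ M.obj) {Z : T}
    (a : K) (s : K ⊗[k] (Z ⟶ X)) :
    extendDescElem x Z (a • s) = extendDescElem x Z s ≫ M.act a := by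
  induction s using TensorProduct.induction_on with
  | zero => simp
  | add s t hs ht => simp only [smul_add, map_add, hs, ht, Preadditive.add_comp]
  | tmul c f =>
    rw [TensorProduct.smul_tmul', extendDescElem_tmul, extendDescElem_tmul, smul_eq_mul, act_mul,
      Category.assoc, Category.assoc]

lemma extendDescElem_symm_naturality {X : T} {M : IndMod k K T} (x : Ind.yoneda.obj X ⟶ M.obj)
    {Z Z' : T} (g : Z' ⟶ Z) (y : Ind.yoneda.obj Z ⟶ (extend k K X).obj) :
    extendDescElem x Z' ((extendEquiv k K Z' X).symm (Ind.yoneda.map g ≫ y)) =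
      Ind.yoneda.map g ≫ extendDescElem x Z ((extendEquiv k K Z X).symm y) := by
  obtain ⟨s, rfl⟩ := (extendEquiv k K Z X).surjective y
  rw [extendEquiv_naturality, Equiv.symm_apply_apply, Equiv.symm_apply_apply,
    extendDescElem_naturality]

/-- The `K`-linear morphism `X ⊗ K ⟶ M` which extends `x : X ⟶ M`. -/
def extendDesc {X : T} {M : IndMod k K T} (x : Ind.yoneda.obj X ⟶ M.obj) : extend k K X ⟶ M where
  hom := indHomMk (fun Z y => extendDescElem x Z ((extendEquiv k K Z X).symm y))
    (extendDescElem_symm_naturality x)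
  comm a := ind_hom_ext fun Z y => by
    obtain ⟨s, rfl⟩ := (extendEquiv k K Z X).surjective y
    rw [← Category.assoc, ← extendEquiv_smul, comp_indHomMk, ← Category.assoc, comp_indHomMk,
      Equiv.symm_apply_apply, Equiv.symm_apply_apply, extendDescElem_smul]

lemma extendEquiv_extendDesc {X Z : T} {M : IndMod k K T} (x : Ind.yoneda.obj X ⟶ M.obj)
    (s : K ⊗[k] (Z ⟶ X)) :
    extendEquiv k K Z X s ≫ (extendDesc x).hom = extendDescElem x Z s := by
  have h := comp_indHomMk (fun Z y => extendDescElem x Z ((extendEquiv k K Z X).symm y))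
    (extendDescElem_symm_naturality x) (extendEquiv k K Z X s)
  rw [Equiv.symm_apply_apply] at h
  exact h

lemma extendUnit_extendDesc {X : T} {M : IndMod k K T} (x : Ind.yoneda.obj X ⟶ M.obj) :
    extendUnit k K X ≫ (extendDesc x).hom = x := by
  rw [extendUnit, extendEquiv_extendDesc, extendDescElem_tmul, act_one,
    CategoryTheory.Functor.map_id, Category.id_comp]
  exact Category.comp_id x

/-- The elements of the kernel of `f` give morphisms of `K`-modules from objects `Z ⊗ K`. -/
lemma mono_hom_of_mono {M N : IndMod k K T} (f : M ⟶ N) [Mono f] : Mono f.hom :=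
  ind_mono_of_injective _ fun Z x hx => by
    have h : extendDesc x ≫ f = 0 := extendLift_ext (by
      change extendUnit k K Z ≫ (extendDesc x).hom ≫ f.hom = extendUnit k K Z ≫ 0
      rw [← Category.assoc, extendUnit_extendDesc, hx, comp_zero])
    have h' : extendDesc x = 0 := by rw [← cancel_mono f, h, zero_comp]
    rw [← extendUnit_extendDesc x, h', zero_hom, comp_zero]

end IndMod

section TensorDesc
variable {T : Type v} [SmallCategory T] [MonoidalCategory T] [Abelian T]

/-- A morphism out of the tensor product of ind-objects, given on elements. -/
def indTensorDesc {M N P : Ind T} (β : ∀ (X Y : T), (Ind.yoneda.obj X ⟶ M) →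
    (Ind.yoneda.obj Y ⟶ N) → (Ind.yoneda.obj (X ⊗ Y) ⟶ P))
    (hβ : ∀ {X Y X' Y' : T} (f : X' ⟶ X) (g : Y' ⟶ Y) (x : Ind.yoneda.obj X ⟶ M)
      (y : Ind.yoneda.obj Y ⟶ N), β X' Y' (Ind.yoneda.map f ≫ x) (Ind.yoneda.map g ≫ y) =
        Ind.yoneda.map (f ⊗ₘ g) ≫ β X Y x y) : (indTensor T).obj (M, N) ⟶ P :=
  colimit.desc (CostructuredArrow.proj
    (Functor.prod (Ind.yoneda : T ⥤ Ind T) (Ind.yoneda : T ⥤ Ind T)) (M, N) ⋙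
      MonoidalCategory.tensor T ⋙ (Ind.yoneda : T ⥤ Ind T))
    { pt := P
      ι :=
        { app := fun j => β j.left.1 j.left.2 j.hom.1 j.hom.2
          naturality := fun i j φ => by
            have h := CostructuredArrow.w φ
            have h1 : Ind.yoneda.map φ.left.1 ≫ j.hom.1 = i.hom.1 := congrArg _root_.Prod.fst h
            have h2 : Ind.yoneda.map φ.left.2 ≫ j.hom.2 = i.hom.2 := congrArg _root_.Prod.snd h
            have h3 := hβ φ.left.1 φ.left.2 j.hom.1 j.hom.2
            rw [h1, h2] at h3
            refine Eq.trans ?_ (Category.comp_id _).symm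
            exact h3.symm } }

lemma indTensorElem_desc {M N P : Ind T} (β : ∀ (X Y : T), (Ind.yoneda.obj X ⟶ M) →
    (Ind.yoneda.obj Y ⟶ N) → (Ind.yoneda.obj (X ⊗ Y) ⟶ P))
    (hβ : ∀ {X Y X' Y' : T} (f : X' ⟶ X) (g : Y' ⟶ Y) (x : Ind.yoneda.obj X ⟶ M)
      (y : Ind.yoneda.obj Y ⟶ N), β X' Y' (Ind.yoneda.map f ≫ x) (Ind.yoneda.map g ≫ y) =
        Ind.yoneda.map (f ⊗ₘ g) ≫ β X Y x y) {X Y : T} (x : Ind.yoneda.obj X ⟶ M)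
    (y : Ind.yoneda.obj Y ⟶ N) : indTensorElem x y ≫ indTensorDesc β hβ = β X Y x y :=
  colimit.ι_desc _ _

variable {k K : Type v} [Field k] [Field K] [Algebra k K] [Linear k T]

namespace IndMod

lemma indTensorElem_actLeft (M N : IndMod k K T) (a : K) {X Y : T}
    (x : Ind.yoneda.obj X ⟶ M.obj) (y : Ind.yoneda.obj Y ⟶ N.obj) :
    indTensorElem x y ≫ actLeft M N a = indTensorElem (x ≫ M.act a) y := by
  refine (indTensorElem_map _ _ _ _).trans ?_
  rw [Category.comp_id]

lemma indTensorElem_actRight (M N : IndMod k K T) (a : K) {X Y : T}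
    (x : Ind.yoneda.obj X ⟶ M.obj) (y : Ind.yoneda.obj Y ⟶ N.obj) :
    indTensorElem x y ≫ actRight M N a = indTensorElem x (y ≫ N.act a) := by
  refine (indTensorElem_map _ _ _ _).trans ?_
  rw [Category.comp_id]

/-- The element `x ⊗ y` of the tensor product over `K`. -/
def tensorElem {M N : IndMod k K T} {X Y : T} (x : Ind.yoneda.obj X ⟶ M.obj)
    (y : Ind.yoneda.obj Y ⟶ N.obj) : Ind.yoneda.obj (X ⊗ Y) ⟶ tensorObj M N :=
  indTensorElem x y ≫ tensorπ M N

lemma tensorElem_balanced {M N : IndMod k K T} {X Y : T} (a : K) (x : Ind.yoneda.obj X ⟶ M.obj)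
    (y : Ind.yoneda.obj Y ⟶ N.obj) :
    tensorElem (x ≫ M.act a) y = tensorElem x (y ≫ N.act a) := by
  rw [tensorElem, tensorElem, ← indTensorElem_actLeft, ← indTensorElem_actRight, Category.assoc,
    Category.assoc, tensorπ_balanced]

lemma tensorElem_naturality {M N : IndMod k K T} {X Y X' Y' : T} (f : X' ⟶ X) (g : Y' ⟶ Y)
    (x : Ind.yoneda.obj X ⟶ M.obj) (y : Ind.yoneda.obj Y ⟶ N.obj) :
    tensorElem (Ind.yoneda.map f ≫ x) (Ind.yoneda.map g ≫ y) =
      Ind.yoneda.map (f ⊗ₘ g) ≫ tensorElem x y := by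
  rw [tensorElem, indTensorElem_naturality, Category.assoc, tensorElem]

lemma tensorObj_hom_ext {M N : IndMod k K T} {P : Ind T} {f g : tensorObj M N ⟶ P}
    (h : ∀ (X Y : T) (x : Ind.yoneda.obj X ⟶ M.obj) (y : Ind.yoneda.obj Y ⟶ N.obj),
      tensorElem x y ≫ f = tensorElem x y ≫ g) : f = g := by
  rw [← cancel_epi (tensorπ M N)]
  refine indTensor_hom_ext fun X Y x y => ?_
  rw [← Category.assoc, ← Category.assoc]
  exact h X Y x y

/-- A morphism out of the tensor product over `K`, given on elements by a balanced natural map. -/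
def tensorObjDesc {M N : IndMod k K T} {P : Ind T} (β : ∀ (X Y : T), (Ind.yoneda.obj X ⟶ M.obj) →
    (Ind.yoneda.obj Y ⟶ N.obj) → (Ind.yoneda.obj (X ⊗ Y) ⟶ P))
    (hβ : ∀ {X Y X' Y' : T} (f : X' ⟶ X) (g : Y' ⟶ Y) (x : Ind.yoneda.obj X ⟶ M.obj)
      (y : Ind.yoneda.obj Y ⟶ N.obj), β X' Y' (Ind.yoneda.map f ≫ x) (Ind.yoneda.map g ≫ y) =
        Ind.yoneda.map (f ⊗ₘ g) ≫ β X Y x y)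
    (hβ' : ∀ {X Y : T} (a : K) (x : Ind.yoneda.obj X ⟶ M.obj) (y : Ind.yoneda.obj Y ⟶ N.obj),
      β X Y (x ≫ M.act a) y = β X Y x (y ≫ N.act a)) : tensorObj M N ⟶ P :=
  tensorDesc (indTensorDesc β hβ) fun a => indTensor_hom_ext fun X Y x y => by
    rw [← Category.assoc, ← Category.assoc, indTensorElem_actLeft, indTensorElem_actRight,
      indTensorElem_desc, indTensorElem_desc, hβ']

lemma tensorElem_desc {M N : IndMod k K T} {P : Ind T}
    (β : ∀ (X Y : T), (Ind.yoneda.obj X ⟶ M.obj) →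
    (Ind.yoneda.obj Y ⟶ N.obj) → (Ind.yoneda.obj (X ⊗ Y) ⟶ P))
    (hβ : ∀ {X Y X' Y' : T} (f : X' ⟶ X) (g : Y' ⟶ Y) (x : Ind.yoneda.obj X ⟶ M.obj)
      (y : Ind.yoneda.obj Y ⟶ N.obj), β X' Y' (Ind.yoneda.map f ≫ x) (Ind.yoneda.map g ≫ y) =
        Ind.yoneda.map (f ⊗ₘ g) ≫ β X Y x y)
    (hβ' : ∀ {X Y : T} (a : K) (x : Ind.yoneda.obj X ⟶ M.obj) (y : Ind.yoneda.obj Y ⟶ N.obj),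
      β X Y (x ≫ M.act a) y = β X Y x (y ≫ N.act a)) {X Y : T} (x : Ind.yoneda.obj X ⟶ M.obj)
    (y : Ind.yoneda.obj Y ⟶ N.obj) :
    tensorElem x y ≫ tensorObjDesc β hβ hβ' = β X Y x y := by
  rw [tensorElem, Category.assoc]
  exact (congrArg (_ ≫ ·) (tensorπ_desc _ _)).trans (indTensorElem_desc β hβ x y)

end IndMod

end TensorDesc

/-! ### Elements of `U^K` -/

section Restrict
variable {k K : Type v} [Field k] [Field K] [Algebra k K]
variable {T : Type v} [SmallCategory T] [Abelian T] [Linear k T]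
variable {D : Type u} [Category.{v} D] [Abelian D] [Linear K D]
variable (q : T ⥤ D) [q.Additive] [PreservesFiniteColimits q] [IsLinearOver k K q]

lemma restrictElem_naturality {X Y : T} (g : Y ⟶ X) {U : D} (u : q.obj X ⟶ U) :
    Ind.yoneda.map g ≫ restrictElem k K q X U u = restrictElem k K q Y U (q.map g ≫ u) :=
  (restrictLex k K q U).elem_naturality g u

lemma restrictElem_map {X : T} {U V : D} (u : q.obj X ⟶ U) (f : U ⟶ V) :
    restrictElem k K q X U u ≫ ((restrict k K q).map f).hom = restrictElem k K q X V (u ≫ f) :=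
  Lex.elem_mapIndMod (A := restrictLex k K q U) (B := restrictLex k K q V) _ _

lemma restrictElem_act {X : T} {U : D} (u : q.obj X ⟶ U) (c : K) :
    restrictElem k K q X U u ≫ ((restrict k K q).obj U).act c =
      restrictElem k K q X U (c • u) :=
  (restrictLex k K q U).elem_smulNat c u

lemma restrictElem_add {X : T} {U : D} (u u' : q.obj X ⟶ U) :
    restrictElem k K q X U (u + u') = restrictElem k K q X U u + restrictElem k K q X U u' :=
  (restrictLex k K q U).elem_add u u'

lemma restrictElem_zero {X : T} {U : D} : restrictElem k K q X U 0 = 0 :=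
  (restrictLex k K q U).elem_zero

lemma restrict_hom_ext {U : D} {M : IndMod k K T} {f g : (restrict k K q).obj U ⟶ M}
    (h : ∀ (X : T) (u : q.obj X ⟶ U),
      restrictElem k K q X U u ≫ f.hom = restrictElem k K q X U u ≫ g.hom) : f = g :=
  Lex.mapIndMod_ext (A := restrictLex k K q U) h

instance : (restrict k K q).Additive where
  map_add {U V f g} := restrict_hom_ext q fun X u => by
    rw [IndMod.add_hom, Preadditive.comp_add, restrictElem_map, restrictElem_map, restrictElem_map,
      Preadditive.comp_add, restrictElem_add]

instance : (restrict k K q).Linear K where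
  map_smul f c := restrict_hom_ext q fun X u => by
    rw [IndMod.smul_hom, ← Category.assoc, restrictElem_map, restrictElem_map, restrictElem_act,
      Linear.comp_smul]

lemma extendDescElem_restrictElem {X Z : T} {U : D} (u : q.obj X ⟶ U) (s : K ⊗[k] (Z ⟶ X)) :
    IndMod.extendDescElem (M := (restrict k K q).obj U) (restrictElem k K q X U u) Z s =
      restrictElem k K q Z U (homComparison k K q Z X s ≫ u) := by
  induction s using TensorProduct.induction_on with
  | zero => rw [map_zero, map_zero, zero_comp, restrictElem_zero]
  | add s t hs ht => rw [map_add, map_add, hs, ht, Preadditive.add_comp, restrictElem_add]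
  | tmul c f =>
    rw [IndMod.extendDescElem_tmul, restrictElem_act, restrictElem_naturality, homComparison_tmul,
      Linear.comp_smul, Linear.smul_comp]

variable (k K) in
/-- The canonical morphism `X ⊗ K ⟶ (q X)^K`. -/
def extendToRestrict (X : T) : extend k K X ⟶ (restrict k K q).obj (q.obj X) :=
  IndMod.extendDesc (restrictElem k K q X (q.obj X) (𝟙 _))

lemma extendUnit_extendToRestrict (X : T) :
    extendUnit k K X ≫ (extendToRestrict k K q X).hom = restrictElem k K q X (q.obj X) (𝟙 _) :=
  IndMod.extendUnit_extendDesc _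

lemma extendEquiv_extendToRestrict {X Z : T} (s : K ⊗[k] (Z ⟶ X)) :
    extendEquiv k K Z X s ≫ (extendToRestrict k K q X).hom =
      restrictElem k K q Z (q.obj X) (homComparison k K q Z X s) := by
  rw [extendToRestrict, IndMod.extendEquiv_extendDesc, extendDescElem_restrictElem,
    Category.comp_id]

lemma isIso_extendToRestrict (h : ∀ X Y : T, Function.Bijective (homComparison k K q X Y)) (X : T) :
    IsIso (extendToRestrict k K q X) := by
  have : IsIso (IndMod.forgetInd.map (extendToRestrict k K q X)) :=
    ind_isIso_of_bijective _ fun Z => by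
      have e : (fun x : Ind.yoneda.obj Z ⟶ (extend k K X).obj =>
          x ≫ (extendToRestrict k K q X).hom) = restrictElem k K q Z (q.obj X) ∘
          homComparison k K q Z X ∘ (extendEquiv k K Z X).symm := by
        ext x
        obtain ⟨s, rfl⟩ := (extendEquiv k K Z X).surjective x
        simp [extendEquiv_extendToRestrict]
      exact e ▸ (restrictElem k K q Z (q.obj X)).bijective.comp
        ((h Z X).comp (extendEquiv k K Z X).symm.bijective)
  exact isIso_of_reflects_iso _ IndMod.forgetInd

/-- The morphism `Z ⊗ K ⟶ X ⊗ K` given by `s` corresponds to the morphism `q Z ⟶ q X` given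
by `s`. -/
lemma extendDesc_extendToRestrict {X Z : T} (s : K ⊗[k] (Z ⟶ X)) :
    IndMod.extendDesc (extendEquiv k K Z X s) ≫ extendToRestrict k K q X =
      extendToRestrict k K q Z ≫ (restrict k K q).map (homComparison k K q Z X s) :=
  extendLift_ext (by
    refine (Category.assoc _ _ _).symm.trans (Eq.trans ?_ (Category.assoc _ _ _))
    rw [IndMod.extendUnit_extendDesc, extendEquiv_extendToRestrict, extendUnit_extendToRestrict,
      restrictElem_map, Category.id_comp])

lemma extendLift_eq_extendDesc {X Y : T} (f : Ind.yoneda.obj X ⟶ (extend k K Y).obj) :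
    extendLift f = IndMod.extendDesc f :=
  extendLift_ext (by rw [extendUnit_extendLift, IndMod.extendUnit_extendDesc])

variable (k K) in
/-- The presheaf underlying `U^K` is `X ↦ Hom(q X, U)`. -/
def restrictInclusionIso : (restrict k K q ⋙ IndMod.forgetInd) ⋙ Ind.inclusion T ≅
    yoneda ⋙ (Functor.whiskeringLeft _ _ _).obj q.op :=
  NatIso.ofComponents (fun U => indOfIso _ (restrictLex k K q U).isIndObject ≪≫
      NatIso.ofComponents (fun X => Iso.refl _)) fun {U V} f => by
    have h : (Ind.inclusion T).map ((restrict k K q).map f).hom ≫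
        (indOfIso _ (restrictLex k K q V).isIndObject).hom =
        (indOfIso _ (restrictLex k K q U).isIndObject).hom ≫
          Functor.whiskerRight (Functor.whiskerLeft q.op ((linearYoneda K D).map f))
            (forget _) := by
      change (Ind.inclusion T).map (indOfMap _ _ _) ≫ _ = _
      simp only [indOfMap, Functor.FullyFaithful.map_preimage, Category.assoc, Iso.inv_hom_id,
        Category.comp_id]
      rfl
    ext X u
    exact congrArg (fun g => g.app X u) h

instance preservesFiniteLimits_restrict_forgetInd :
    PreservesFiniteLimits (restrict k K q ⋙ IndMod.forgetInd) :=
  have : PreservesFiniteLimits ((restrict k K q ⋙ IndMod.forgetInd) ⋙ Ind.inclusion T) :=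
    preservesFiniteLimits_of_natIso (restrictInclusionIso k K q).symm
  preservesFiniteLimits_of_reflects_of_preserves _ (Ind.inclusion T)

instance : PreservesFiniteLimits (restrict k K q) :=
  ⟨fun _ _ _ => preservesLimitsOfShape_of_reflects_of_preserves _ IndMod.forgetInd⟩

end Restrict

/-! ### Exactness of `U ↦ U^K` -/

section Flat
variable {k K : Type v} [Field k] [Field K] [Algebra k K]
    {T : Type v} [SmallCategory T] [Abelian T] [Linear k T] [MonoidalCategory T]
    [SymmetricCategory T] [MonoidalPreadditive T] [MonoidalLinear k T]

lemma indTensorElem_add_right {M N : Ind T} {X Y : T} (x : Ind.yoneda.obj X ⟶ M)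
    (y y' : Ind.yoneda.obj Y ⟶ N) :
    indTensorElem x (y + y') = indTensorElem x y + indTensorElem x y' := by
  let fst := Ind.yoneda.map (biprod.fst : Y ⊞ Y ⟶ Y)
  let snd := Ind.yoneda.map (biprod.snd : Y ⊞ Y ⟶ Y)
  let z : Ind.yoneda.obj (Y ⊞ Y) ⟶ N := fst ≫ y + snd ≫ y'
  have hz (f : Y ⟶ Y ⊞ Y) : Ind.yoneda.map f ≫ z =
      Ind.yoneda.map (f ≫ biprod.fst) ≫ y + Ind.yoneda.map (f ≫ biprod.snd) ≫ y' := by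
    simp [z, fst, snd]
  have h1 : Ind.yoneda.map (biprod.inl : Y ⟶ Y ⊞ Y) ≫ z = y := by rw [hz]; simp
  have h2 : Ind.yoneda.map (biprod.inr : Y ⟶ Y ⊞ Y) ≫ z = y' := by rw [hz]; simp
  have h3 : Ind.yoneda.map (biprod.inl + biprod.inr : Y ⟶ Y ⊞ Y) ≫ z = y + y' := by
    rw [Functor.map_add, Preadditive.add_comp, h1, h2]
  have hn (f : Y ⟶ Y ⊞ Y) : indTensorElem x (Ind.yoneda.map f ≫ z) =
      Ind.yoneda.map (𝟙 X ⊗ₘ f) ≫ indTensorElem x z := by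
    rw [← indTensorElem_naturality]; simp
  rw [← h3, hn, MonoidalPreadditive.tensor_add, Functor.map_add, Preadditive.add_comp, ← hn, ← hn,
    h1, h2]

namespace IndMod

lemma tensorElem_add_left {M N : IndMod k K T} {X Y : T} (x x' : Ind.yoneda.obj X ⟶ M.obj)
    (y : Ind.yoneda.obj Y ⟶ N.obj) :
    tensorElem (x + x') y = tensorElem x y + tensorElem x' y := by
  rw [tensorElem, indTensorElem_add, Preadditive.add_comp, tensorElem, tensorElem]

lemma tensorElem_add_right {M N : IndMod k K T} {X Y : T} (x : Ind.yoneda.obj X ⟶ M.obj)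
    (y y' : Ind.yoneda.obj Y ⟶ N.obj) :
    tensorElem x (y + y') = tensorElem x y + tensorElem x y' := by
  rw [tensorElem, indTensorElem_add_right, Preadditive.add_comp, tensorElem, tensorElem]

lemma tensorElem_zero_left {M N : IndMod k K T} {X Y : T} (y : Ind.yoneda.obj Y ⟶ N.obj) :
    tensorElem (0 : Ind.yoneda.obj X ⟶ M.obj) y = 0 := by
  simpa using tensorElem_add_left (0 : Ind.yoneda.obj X ⟶ M.obj) 0 y

lemma tensorElem_zero_right {M N : IndMod k K T} {X Y : T} (x : Ind.yoneda.obj X ⟶ M.obj) :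
    tensorElem x (0 : Ind.yoneda.obj Y ⟶ N.obj) = 0 := by
  simpa using tensorElem_add_right x (0 : Ind.yoneda.obj Y ⟶ N.obj) 0

lemma tensorElem_map {M M' N : IndMod k K T} (f : M ⟶ M') {X Y : T}
    (x : Ind.yoneda.obj X ⟶ M.obj) (y : Ind.yoneda.obj Y ⟶ N.obj) :
    tensorElem x y ≫ tensorMapHom f N = tensorElem (x ≫ f.hom) y := by
  rw [tensorElem, Category.assoc, tensorπ_mapHom, ← Category.assoc, tensorElem]
  congr 1
  refine (indTensorElem_map _ _ _ _).trans ?_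
  rw [Category.comp_id]

lemma extendDescElem_comp_act {X Z : T} {M : IndMod k K T} (x : Ind.yoneda.obj X ⟶ M.obj) (a : K)
    (s : K ⊗[k] (Z ⟶ X)) :
    extendDescElem (x ≫ M.act a) Z s = extendDescElem x Z s ≫ M.act a := by
  induction s using TensorProduct.induction_on with
  | zero => simp
  | add s t hs ht => simp only [map_add, hs, ht, Preadditive.add_comp]
  | tmul c f =>
    rw [extendDescElem_tmul, extendDescElem_tmul, Category.assoc, Category.assoc, Category.assoc,
      act_comm]

lemma extendDescElem_precomp {X Y Z : T} {M : IndMod k K T} (x : Ind.yoneda.obj X ⟶ M.obj)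
    (g : Y ⟶ X) (s : K ⊗[k] (Z ⟶ Y)) :
    extendDescElem (Ind.yoneda.map g ≫ x) Z s =
      extendDescElem x Z (LinearMap.baseChange K (Linear.rightComp k Z g) s) := by
  induction s using TensorProduct.induction_on with
  | zero => simp
  | add s t hs ht => simp only [map_add, hs, ht]
  | tmul c f => simp

end IndMod

section IndHom
open IndMod

/-- For `X` in `T` and an ind-object `N`, the ind-object `Z ↦ Hom(X ⊗ Z, N)`. -/
def indHomObj (X : T) [PreservesFiniteColimits (tensorLeft X)] (N : Ind T) : Ind T :=
  indOf ((tensorLeft X).op ⋙ (Ind.inclusion T).obj N) (by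
    have := (isIndObject_iff_preservesFiniteLimits _).1 (Ind.isIndObject_inclusion_obj N)
    have : PreservesFiniteLimits (tensorLeft X).op := preservesFiniteLimits_op _
    rw [isIndObject_iff_preservesFiniteLimits]
    infer_instance)

/-- Elements of `indHomObj X N`. -/
def indHomEquiv (X : T) [PreservesFiniteColimits (tensorLeft X)] (N : Ind T) (Z : T) :
    (Ind.yoneda.obj Z ⟶ indHomObj X N) ≃ (Ind.yoneda.obj (X ⊗ Z) ⟶ N) :=
  (indOfEquiv _ _ Z).trans (elemEquiv (X ⊗ Z) N).symm

lemma indHomEquiv_naturality (X : T) [PreservesFiniteColimits (tensorLeft X)] (N : Ind T) {Z Z' : T}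
    (g : Z' ⟶ Z) (x : Ind.yoneda.obj Z ⟶ indHomObj X N) :
    indHomEquiv X N Z' (Ind.yoneda.map g ≫ x) =
      Ind.yoneda.map (X ◁ g) ≫ indHomEquiv X N Z x := by
  apply (elemEquiv _ N).injective
  rw [elemEquiv_naturality_left]
  have h (Z : T) (x : Ind.yoneda.obj Z ⟶ indHomObj X N) :
      elemEquiv (X ⊗ Z) N (indHomEquiv X N Z x) = indOfEquiv _ _ Z x :=
    Equiv.apply_symm_apply _ _
  rw [h, h]
  exact indOfEquiv_naturality _ _ g x

lemma indHomEquiv_zero (X : T) [PreservesFiniteColimits (tensorLeft X)] (N : Ind T) (Z : T) :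
    indHomEquiv X N Z 0 = 0 := by
  have h := indHomEquiv_naturality X N (0 : Z ⟶ Z) 0
  simpa using h

/-- The map `Hom(A, Y) ⟶ Hom(X ⊗ (A ⊗ B), B)` given by a pairing `e : X ⊗ Y ⟶ 𝟙_`. -/
def contract {X Y : T} (e : X ⊗ Y ⟶ 𝟙_ T) (A B : T) : (A ⟶ Y) →ₗ[k] (X ⊗ (A ⊗ B) ⟶ B) where
  toFun h := (α_ X A B).inv ≫ (X ◁ h) ▷ B ≫ e ▷ B ≫ (λ_ B).hom
  map_add' h h' := by simp
  map_smul' a h := by simp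

/-- The element of `Hom(X ⊗ (A ⊗ B), N)` given by `a : A ⟶ Y ⊗ K` and `b : B ⟶ N`. -/
def contractElem {X Y : T} (e : X ⊗ Y ⟶ 𝟙_ T) [PreservesFiniteColimits (tensorLeft X)]
    (N : IndMod k K T) (A B : T) (a : Ind.yoneda.obj A ⟶ (extend k K Y).obj)
    (b : Ind.yoneda.obj B ⟶ N.obj) : Ind.yoneda.obj (A ⊗ B) ⟶ indHomObj X N.obj :=
  (indHomEquiv X N.obj (A ⊗ B)).symm (extendDescElem b (X ⊗ (A ⊗ B))
    (LinearMap.baseChange K (contract e A B) ((extendEquiv k K A Y).symm a)))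

lemma contractElem_naturality {X Y : T} (e : X ⊗ Y ⟶ 𝟙_ T) [PreservesFiniteColimits (tensorLeft X)]
    (N : IndMod k K T) {A B A' B' : T} (f : A' ⟶ A) (g : B' ⟶ B)
    (a : Ind.yoneda.obj A ⟶ (extend k K Y).obj) (b : Ind.yoneda.obj B ⟶ N.obj) :
    contractElem e N A' B' (Ind.yoneda.map f ≫ a) (Ind.yoneda.map g ≫ b) =
      Ind.yoneda.map (f ⊗ₘ g) ≫ contractElem e N A B a b := by
  obtain ⟨s, rfl⟩ := (extendEquiv k K A Y).surjective a
  rw [contractElem, Equiv.symm_apply_eq, indHomEquiv_naturality, contractElem,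
    Equiv.apply_symm_apply, extendEquiv_naturality, Equiv.symm_apply_apply, Equiv.symm_apply_apply,
    extendDescElem_precomp, ← extendDescElem_naturality]
  congr 1
  induction s using TensorProduct.induction_on with
  | zero => simp only [map_zero]
  | add s t hs ht => simp only [map_add, hs, ht]
  | tmul c h =>
    simp only [LinearMap.baseChange_tmul]
    congr 1
    change ((α_ X A' B').inv ≫ (X ◁ (f ≫ h)) ▷ B' ≫ e ▷ B' ≫ (λ_ B').hom) ≫ g =
      X ◁ (f ⊗ₘ g) ≫ (α_ X A B).inv ≫ (X ◁ h) ▷ B ≫ e ▷ B ≫ (λ_ B).hom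
    simp only [MonoidalCategory.tensorHom_def, MonoidalCategory.whiskerLeft_comp,
      whisker_assoc, Category.assoc, Iso.inv_hom_id_assoc]
    rw [← leftUnitor_naturality g, ← whisker_exchange_assoc,
      ← MonoidalCategory.whiskerLeft_comp_assoc X (A ◁ g), whisker_exchange]
    simp

lemma contractElem_balanced {X Y : T} (e : X ⊗ Y ⟶ 𝟙_ T) [PreservesFiniteColimits (tensorLeft X)]
    (N : IndMod k K T) {A B : T} (c : K)
    (a : Ind.yoneda.obj A ⟶ (extend k K Y).obj) (b : Ind.yoneda.obj B ⟶ N.obj) :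
    contractElem e N A B (a ≫ (extend k K Y).act c) b =
      contractElem e N A B a (b ≫ N.act c) := by
  obtain ⟨s, rfl⟩ := (extendEquiv k K A Y).surjective a
  rw [← extendEquiv_smul, contractElem, contractElem, Equiv.symm_apply_apply,
    Equiv.symm_apply_apply, map_smul, extendDescElem_smul, extendDescElem_comp_act]

/-- A pairing `e : X ⊗ Y ⟶ 𝟙_` gives a morphism from `(Y ⊗ K) ⊗_K N` to the internal Hom
of `X` and `N`. -/
def contractHom {X Y : T} (e : X ⊗ Y ⟶ 𝟙_ T) [PreservesFiniteColimits (tensorLeft X)]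
    (N : IndMod k K T) : tensorObj (extend k K Y) N ⟶ indHomObj X N.obj :=
  tensorObjDesc (contractElem e N) (contractElem_naturality e N) (contractElem_balanced e N)

lemma tensorElem_contractHom {X Y : T} (e : X ⊗ Y ⟶ 𝟙_ T) [PreservesFiniteColimits (tensorLeft X)]
    (N : IndMod k K T) {A B : T} (a : Ind.yoneda.obj A ⟶ (extend k K Y).obj)
    (b : Ind.yoneda.obj B ⟶ N.obj) :
    indHomEquiv X N.obj (A ⊗ B) (tensorElem a b ≫ contractHom e N) =
      extendDescElem b (X ⊗ (A ⊗ B)) (LinearMap.baseChange K (contract e A B)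
        ((extendEquiv k K A Y).symm a)) := by
  rw [contractHom, tensorElem_desc _ (contractElem_naturality e N) (contractElem_balanced e N),
    contractElem, Equiv.apply_symm_apply]

end IndHom

section Rigid
variable [IsRigidTensorCategory k T]
    {D : Type u} [Category.{v} D] [Abelian D] [Linear K D] [MonoidalCategory D]
    [SymmetricCategory D] [MonoidalPreadditive D] [MonoidalLinear K D]
    [IsRigidTensorCategory K D]
    (q : T ⥤ D) [q.Monoidal] [q.Additive] [IsLinearOver k K q]
    [PreservesFiniteLimits q] [PreservesFiniteColimits q]
open IndMod

/-- The dual of a morphism, as a linear map. -/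
def leftMate (k : Type v) [Field k] [Linear k T] [MonoidalLinear k T] (X Y : T)
    [HasLeftDual X] [HasLeftDual Y] : (X ⟶ Y) →ₗ[k] ((ᘁY : T) ⟶ (ᘁX : T)) where
  toFun f := ᘁf
  map_add' f g := by simp [leftAdjointMate]
  map_smul' a f := by simp [leftAdjointMate]

lemma whiskerLeft_comp_rightUnitor_inv_whiskerRight {C : Type*} [Category* C] [MonoidalCategory C]
    {W A B : C} (a : W ⟶ A) (φ : B ⊗ A ⟶ 𝟙_ C) :
    B ◁ (a ≫ (ρ_ A).inv) ≫ (α_ B A (𝟙_ C)).inv ≫ φ ▷ 𝟙_ C ≫ (λ_ (𝟙_ C)).hom = B ◁ a ≫ φ := by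
  simp [unitors_equal]

/-- If `q Z ⟶ q X` is an epimorphism, then its dual is a monomorphism. -/
lemma mono_homComparison_mate {X Z : T} [HasLeftDual X] [HasLeftDual Z] (s : K ⊗[k] (Z ⟶ X))
    [Epi (homComparison k K q Z X s)] :
    Mono (homComparison k K q _ _ (LinearMap.baseChange K (leftMate k Z X) s)) := by
  have hev : q.obj Z ◁ (homComparison k K q _ _ (LinearMap.baseChange K (leftMate k Z X) s)) ≫
      Functor.LaxMonoidal.μ q Z (ᘁZ) ≫ q.map (ε_ (ᘁZ) Z) =
        (homComparison k K q _ _ s) ▷ q.obj (ᘁX) ≫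
          Functor.LaxMonoidal.μ q X (ᘁX) ≫ q.map (ε_ (ᘁX) X) := by
    induction s using TensorProduct.induction_on with
    | zero => simp
    | add s t hs ht => simp only [map_add, MonoidalPreadditive.whiskerLeft_add,
        MonoidalPreadditive.add_whiskerRight, Preadditive.add_comp, hs, ht]
    | tmul c f =>
      have h := leftAdjointMate_comp_evaluation f
      simp only [LinearMap.baseChange_tmul, homComparison_tmul, MonoidalLinear.whiskerLeft_smul,
        MonoidalLinear.smul_whiskerRight, Linear.smul_comp]
      congr 1
      change q.obj Z ◁ q.map (ᘁf) ≫ _ = q.map f ▷ _ ≫ _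
      rw [Functor.LaxMonoidal.μ_natural_right_assoc, Functor.LaxMonoidal.μ_natural_left_assoc,
        ← q.map_comp, ← q.map_comp, h]
  refine Preadditive.mono_of_cancel_zero _ fun {W} a ha => ?_
  let _ := exactPairingMap q (ᘁX) X
  have := epi_whiskerRight K W (homComparison k K q Z X s)
  have h0 : q.obj X ◁ a ≫ Functor.LaxMonoidal.μ q X (ᘁX) ≫ q.map (ε_ (ᘁX) X) = 0 := by
    rw [← cancel_epi (homComparison k K q Z X s ▷ W), ← whisker_exchange_assoc, ← hev,
      ← MonoidalCategory.whiskerLeft_comp_assoc, ha]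
    simp
  have h1 : (tensorLeftHomEquiv W (q.obj (ᘁX)) (q.obj X) (𝟙_ D)).symm (a ≫ (ρ_ _).inv) =
      (tensorLeftHomEquiv W (q.obj (ᘁX)) (q.obj X) (𝟙_ D)).symm 0 := by
    change q.obj X ◁ _ ≫ _ ≫ (Functor.LaxMonoidal.μ q X (ᘁX) ≫ q.map (ε_ (ᘁX) X) ≫
      Functor.OplaxMonoidal.η q) ▷ _ ≫ _ = q.obj X ◁ 0 ≫ _ ≫ _ ≫ _
    have h0' : q.obj X ◁ a ≫ (Functor.LaxMonoidal.μ q X (ᘁX) ≫ q.map (ε_ (ᘁX) X) ≫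
        Functor.OplaxMonoidal.η q) = 0 := by
      rw [reassoc_of% h0, zero_comp]
    rw [whiskerLeft_comp_rightUnitor_inv_whiskerRight, h0']
    simp
  have h2 := (tensorLeftHomEquiv W (q.obj (ᘁX)) (q.obj X) (𝟙_ D)).symm.injective h1
  rw [← cancel_mono (ρ_ _).inv, h2, zero_comp]

/-- The main consequence of flatness. Let `s` give an epimorphism `q Z ⟶ q X`, and let `x : X ⟶ N`
be an element of a `K`-module which is killed by `s`. The dual of `s` gives a monomorphism
`X' ⊗ K ⟶ Z' ⊗ K`, which remains a monomorphism after tensoring with `N`. The element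
of `(X' ⊗ K) ⊗_K N` which corresponds to `x` under duality is sent to the one which corresponds
to `x` composed with `s`, which vanishes. -/
lemma eq_zero_of_extendDescElem_eq_zero
    (h : ∀ X Y : T, Function.Bijective (homComparison k K q X Y)) (hflat : IsFlatOver k K T)
    {X Z : T} (s : K ⊗[k] (Z ⟶ X)) [Epi (homComparison k K q Z X s)] {N : IndMod k K T}
    (x : Ind.yoneda.obj X ⟶ N.obj) (hx : extendDescElem x Z s = 0) : x = 0 := by
  obtain ⟨X', ⟨p⟩⟩ := IsRigidTensorCategory.exists_dual (k := k) X
  obtain ⟨Z', ⟨p'⟩⟩ := IsRigidTensorCategory.exists_dual (k := k) Z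
  let _ : HasLeftDual X := { leftDual := X', exact := BraidedCategory.exactPairing_swap X X' }
  let _ : HasLeftDual Z := { leftDual := Z', exact := BraidedCategory.exactPairing_swap Z Z' }
  have := (tensorLeft_exact k X).2
  let s' := LinearMap.baseChange K (leftMate k Z X) s
  let m := extendDesc (extendEquiv k K _ _ s')
  have hm : Mono m := by
    have := isIso_extendToRestrict q h (ᘁX : T)
    have := isIso_extendToRestrict q h (ᘁZ : T)
    have := mono_homComparison_mate q s
    have hs : Mono (m ≫ extendToRestrict k K q (ᘁZ : T)) := by
      rw [extendDesc_extendToRestrict]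
      infer_instance
    exact mono_of_mono _ (extendToRestrict k K q (ᘁZ : T))
  have hmN : Mono (tensorMapHom m N) := by
    have := (hflat N).1
    exact mono_hom_of_mono ((tensorRight N).map m)
  have key : Ind.yoneda.map (η_ (ᘁX : T) X) ≫ tensorElem (extendEquiv k K _ _ s') x =
      Ind.yoneda.map (η_ (ᘁZ : T) Z) ≫
        tensorElem (extendUnit k K (ᘁZ : T)) (extendDescElem x Z s) := by
    clear hx m hm hmN
    simp only [s']
    clear s'
    induction s using TensorProduct.induction_on with
    | zero => simp [extendEquiv_zero, tensorElem_zero_left, tensorElem_zero_right]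
    | add s t hs ht =>
      rw [map_add (LinearMap.baseChange K _), map_add (extendDescElem x Z), extendEquiv_add,
        tensorElem_add_left, tensorElem_add_right, Preadditive.comp_add,
        Preadditive.comp_add, hs, ht]
    | tmul c f =>
      have hf : η_ (ᘁX : T) X ≫ (ᘁf) ▷ X = η_ (ᘁZ : T) Z ≫ (ᘁZ : T) ◁ f :=
        coevaluation_comp_leftAdjointMate f
      have e1 := tensorElem_naturality (ᘁf) (𝟙 X) (extendUnit k K (ᘁZ : T)) (x ≫ N.act c)
      have e2 := tensorElem_naturality (𝟙 _) f (extendUnit k K (ᘁZ : T)) (x ≫ N.act c)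
      rw [CategoryTheory.Functor.map_id, Category.id_comp] at e1 e2
      rw [LinearMap.baseChange_tmul, extendEquiv_tmul, ← Category.assoc, tensorElem_balanced,
        extendDescElem_tmul]
      refine (congrArg (_ ≫ ·) e1).trans (Eq.trans ?_ (congrArg (_ ≫ ·) e2).symm)
      rw [← Category.assoc, ← Category.assoc, ← Functor.map_comp, ← Functor.map_comp, tensorHom_id,
        id_tensorHom, hf]
  have h0 : Ind.yoneda.map (η_ (ᘁX : T) X) ≫ tensorElem (extendUnit k K (ᘁX : T)) x = 0 := by
    rw [← cancel_mono (tensorMapHom m N), zero_comp, Category.assoc, tensorElem_map,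
      extendUnit_extendDesc, key, hx, tensorElem_zero_right, comp_zero]
  -- Evaluation at `X` recovers `x` from the element of `(X' ⊗ K) ⊗_K N`.
  have h1 := congrArg (fun z => indHomEquiv X N.obj _ (z ≫ contractHom (ε_ (ᘁX : T) X) N)) h0
  have h2 : X ◁ η_ (ᘁX : T) X ≫ (α_ X (ᘁX : T) X).inv ≫ (X ◁ 𝟙 (ᘁX : T)) ▷ X ≫
      ε_ (ᘁX : T) X ▷ X ≫ (λ_ X).hom = (ρ_ X).hom := by simp
  rw [zero_comp, indHomEquiv_zero, Category.assoc, indHomEquiv_naturality, tensorElem_contractHom,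
    extendUnit, Equiv.symm_apply_apply, LinearMap.baseChange_tmul, extendDescElem_tmul,
    act_one] at h1
  have h3 : Ind.yoneda.map (ρ_ X).hom ≫ x = 0 := by
    rw [← h2, Functor.map_comp, Category.assoc]
    refine Eq.trans ?_ h1
    congr 2
    exact (Category.comp_id x).symm
  rw [← cancel_epi (Ind.yoneda.map (ρ_ X).hom), h3, comp_zero]

/-- `U ↦ U^K` sends epimorphisms `q Z ⟶ q X` to epimorphisms of ind-objects: the element of the
cokernel defined by `X` is killed by `s`, hence vanishes. -/
lemma epi_extendDesc (h : ∀ X Y : T, Function.Bijective (homComparison k K q X Y))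
    (hflat : IsFlatOver k K T) {X Z : T} (s : K ⊗[k] (Z ⟶ X)) [Epi (homComparison k K q Z X s)] :
    Epi (extendDesc (extendEquiv k K Z X s)).hom := by
  let f := extendDesc (extendEquiv k K Z X s)
  refine epi_hom_of_toCoker_eq_zero f (extendLift_ext ?_)
  have hx : toCoker f = extendDesc (extendUnit k K X ≫ (toCoker f).hom) :=
    extendLift_ext (extendUnit_extendDesc _).symm
  refine (eq_zero_of_extendDescElem_eq_zero q h hflat s _ ?_).trans comp_zero.symm
  rw [← extendEquiv_extendDesc, ← hx, ← extendUnit_extendDesc (extendEquiv k K Z X s),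
    Category.assoc]
  exact (congrArg (_ ≫ ·) (congrArg Hom.hom (comp_toCoker f))).trans comp_zero

/-- Epimorphisms in `D` can be lifted locally: up to an epimorphism of `T`, a morphism `q X ⟶ V`
lifts along an epimorphism `U ⟶ V`. An object `q Z` which covers the pullback of `q X` and `U`
over `V` reduces this to the epimorphism `q Z ⟶ q X`, where `epi_extendDesc` applies. -/
lemma exists_lift (h : ∀ X Y : T, Function.Bijective (homComparison k K q X Y))
    (hflat : IsFlatOver k K T) (hq : ∀ U : D, ∃ (X : T) (p : q.obj X ⟶ U), Epi p) {U V : D}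
    (p : U ⟶ V) [Epi p] {X : T} (v : q.obj X ⟶ V) :
    ∃ (Y : T) (g : Y ⟶ X) (_ : Epi g) (u : q.obj Y ⟶ U), u ≫ p = q.map g ≫ v := by
  obtain ⟨Z, r, _⟩ := hq (pullback p v)
  obtain ⟨s, hs⟩ := (h Z X).2 (r ≫ pullback.snd p v)
  have : Epi (homComparison k K q Z X s) := by
    rw [hs]
    infer_instance
  have := epi_extendDesc q h hflat s
  have : IsNoetherianObject X := IsRigidTensorCategory.noetherian (k := k) X
  obtain ⟨Y, g, hg, m, hm⟩ := exists_lift_of_ind_epi (extendDesc (extendEquiv k K Z X s)).hom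
    (extendUnit k K X)
  obtain ⟨t, rfl⟩ := (extendEquiv k K Y Z).surjective m
  refine ⟨Y, g, hg, homComparison k K q Y Z t ≫ r ≫ pullback.fst p v, ?_⟩
  have h1 := congrArg (fun z => z ≫ (extendToRestrict k K q X).hom) hm
  have h2 := congrArg Hom.hom (extendDesc_extendToRestrict q s)
  change (extendDesc (extendEquiv k K Z X s)).hom ≫ (extendToRestrict k K q X).hom =
    (extendToRestrict k K q Z).hom ≫ ((restrict k K q).map _).hom at h2
  rw [Category.assoc, Category.assoc, h2, extendUnit_extendToRestrict, ← Category.assoc,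
    extendEquiv_extendToRestrict, restrictElem_map, restrictElem_naturality, Category.comp_id] at h1
  have h3 := (restrictElem k K q _ _).injective h1
  rw [Category.assoc, Category.assoc, pullback.condition, ← Category.assoc r, ← hs,
    ← Category.assoc, h3]

end Rigid

end Flat

/-! ### Presentations by objects coming from `T` -/

section Presentation
variable {T : Type*} [Category* T] {D : Type*} [Category* D] [Abelian D] {E : Type*} [Category* E]

/-- If every object of `D` is a quotient of some `q X`, then every object is the cokernel of a
morphism `q X' ⟶ q X`. -/
lemma exists_presentation (q : T ⥤ D) (hq : ∀ U : D, ∃ (X : T) (p : q.obj X ⟶ U), Epi p) (U : D) :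
    ∃ (X X' : T) (r : q.obj X' ⟶ q.obj X) (p : q.obj X ⟶ U) (w : r ≫ p = 0) (_ : Epi p),
      Nonempty (IsColimit (CokernelCofork.ofπ p w)) := by
  obtain ⟨X, p, hp⟩ := hq U
  obtain ⟨X', r, hr⟩ := hq (kernel p)
  refine ⟨X, X', r ≫ kernel.ι p, p, by simp, hp, ⟨?_⟩⟩
  let S := ShortComplex.mk (r ≫ kernel.ι p) p (by simp)
  have hS : S.Exact := by
    let φ : S ⟶ ShortComplex.mk (kernel.ι p) p (by simp) :=
      { τ₁ := r, τ₂ := 𝟙 _, τ₃ := 𝟙 _ }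
    have : Epi φ.τ₁ := hr
    have : IsIso φ.τ₂ := inferInstanceAs (IsIso (𝟙 _))
    have : Mono φ.τ₃ := inferInstanceAs (Mono (𝟙 _))
    exact (ShortComplex.exact_iff_of_epi_of_isIso_of_mono φ).2 (ShortComplex.exact_kernel p)
  have : Epi S.g := hp
  exact hS.gIsCokernel

/-- A morphism of right exact functors is an isomorphism if it is one on enough objects. -/
lemma isIso_of_isIso_obj (q : T ⥤ D) (hq : ∀ U : D, ∃ (X : T) (p : q.obj X ⟶ U), Epi p)
    {F G : D ⥤ E} [PreservesFiniteColimits F] [PreservesFiniteColimits G] (α : F ⟶ G)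
    (h : ∀ X : T, IsIso (α.app (q.obj X))) (U : D) : IsIso (α.app U) := by
  obtain ⟨X, X', r, p, w, -, ⟨hc⟩⟩ := exists_presentation q hq U
  let P := parallelPair r 0
  let hF := isColimitOfPreserves F hc
  let hG := isColimitOfPreserves G hc
  have hβ : ∀ j, IsIso ((P.whiskerLeft α).app j) := by
    rintro (_ | _)
    · exact h X'
    · exact h X
  have : IsIso (P.whiskerLeft α) := NatIso.isIso_of_isIso_app _
  let e := IsColimit.coconePointsIsoOfNatIso hF hG (asIso (P.whiskerLeft α))
  have he : e.hom = α.app U := hF.hom_ext fun j => by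
    refine (IsColimit.comp_coconePointsIsoOfNatIso_hom hF hG _ j).trans ?_
    exact (α.naturality _).symm
  rw [← he]
  infer_instance

end Presentation

/-! ### The tensor structure of `U ↦ U^K` -/

section Exact
variable {k K : Type v} [Field k] [Field K] [Algebra k K]
variable {T : Type v} [SmallCategory T] [Abelian T] [Linear k T]
variable {D : Type u} [Category.{v} D] [Abelian D] [Linear K D]
variable (q : T ⥤ D) [q.Additive] [PreservesFiniteColimits q] [IsLinearOver k K q]

/-- The local lifting property: every morphism `q X ⟶ V` lifts along a given epimorphism `U ⟶ V`
after composition with `q g`, for some epimorphism `g` onto `X` in `T`. By `exists_lift` it follows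
from flatness, and it is all that the later arguments use of flatness besides the right exactness
of the tensor product over `K`. -/
def HasLocalLifts {T : Type*} [Category* T] {D : Type*} [Category* D] (q : T ⥤ D) : Prop :=
  ∀ {U V : D} (p : U ⟶ V) [Epi p] {X : T} (v : q.obj X ⟶ V),
    ∃ (Y : T) (g : Y ⟶ X) (_ : Epi g) (u : q.obj Y ⟶ U), u ≫ p = q.map g ≫ v

lemma HasLocalLifts.epi_restrict_map {q : T ⥤ D} [q.Additive] [PreservesFiniteColimits q]
    [IsLinearOver k K q] (hl : HasLocalLifts q) {U V : D} (p : U ⟶ V) [Epi p] :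
    Epi ((restrict k K q).map p).hom :=
  ind_epi_of_locally_surjective _ fun X n => by
    obtain ⟨v, rfl⟩ := (restrictElem k K q X V).surjective n
    obtain ⟨Y, g, hg, u, hu⟩ := hl p v
    exact ⟨Y, g, hg, restrictElem k K q Y U u, by
      rw [restrictElem_map, hu, restrictElem_naturality]⟩

/-- As a right adjoint, `U ↦ U^K` is left exact, so it is exact if it preserves epimorphisms. -/
lemma HasLocalLifts.preservesFiniteColimits_restrict {q : T ⥤ D} [q.Additive]
    [PreservesFiniteColimits q] [IsLinearOver k K q] (hl : HasLocalLifts q) :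
    PreservesFiniteColimits (restrict k K q) := by
  let F := restrict k K q ⋙ IndMod.forgetInd
  have : F.Additive := inferInstanceAs (restrict k K q ⋙ IndMod.forgetInd).Additive
  have hF : PreservesFiniteLimits F := preservesFiniteLimits_restrict_forgetInd q
  have h1 : ∀ S : ShortComplex D, S.ShortExact → (S.map F).Exact ∧ Mono (F.map S.f) :=
    (F.preservesFiniteLimits_tfae.out 3 0).1 hF
  have h2 : ∀ S : ShortComplex D, S.ShortExact → (S.map F).Exact ∧ Epi (F.map S.g) :=
    fun S hS => ⟨(h1 S hS).1, have := hS.epi_g; hl.epi_restrict_map S.g⟩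
  have : PreservesFiniteColimits F := (F.preservesFiniteColimits_tfae.out 0 3).1 h2
  exact ⟨fun J _ _ =>
    have : PreservesColimitsOfShape J (restrict k K q ⋙ IndMod.forgetInd) :=
      PreservesFiniteColimits.preservesFiniteColimits (F := F) J
    preservesColimitsOfShape_of_reflects_of_preserves _ IndMod.forgetInd⟩

end Exact

section Tensor
variable {k K : Type v} [Field k] [Field K] [Algebra k K]
    {T : Type v} [SmallCategory T] [Abelian T] [Linear k T] [MonoidalCategory T]
    [SymmetricCategory T] [MonoidalPreadditive T] [MonoidalLinear k T]
    {D : Type u} [Category.{v} D] [Abelian D] [Linear K D] [MonoidalCategory D]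
    [MonoidalPreadditive D] [MonoidalLinear K D]
    (q : T ⥤ D) [q.Monoidal] [q.Additive] [IsLinearOver k K q] [PreservesFiniteColimits q]
open IndMod

lemma IndMod.tensorElem_act {M N : IndMod k K T} {X Y : T}
    (x : Ind.yoneda.obj X ⟶ M.obj) (y : Ind.yoneda.obj Y ⟶ N.obj) (a : K) :
    tensorElem x y ≫ tensorAct M N a = tensorElem (x ≫ M.act a) y := by
  rw [tensorElem, Category.assoc, tensorπ_act, ← Category.assoc, indTensorElem_actLeft, tensorElem]

/-- The element `u ⊗ v` of `(U ⊗ V)^K`. -/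
def restrictTensorElem (U V : D) (X Y : T)
    (x : Ind.yoneda.obj X ⟶ ((restrict k K q).obj U).obj)
    (y : Ind.yoneda.obj Y ⟶ ((restrict k K q).obj V).obj) :
    Ind.yoneda.obj (X ⊗ Y) ⟶ ((restrict k K q).obj (U ⊗ V)).obj :=
  restrictElem k K q (X ⊗ Y) (U ⊗ V) (Functor.OplaxMonoidal.δ q X Y ≫
    ((restrictElem k K q X U).symm x ⊗ₘ (restrictElem k K q Y V).symm y))

lemma restrictTensorElem_naturality (U V : D) {X Y X' Y' : T} (f : X' ⟶ X) (g : Y' ⟶ Y)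
    (x : Ind.yoneda.obj X ⟶ ((restrict k K q).obj U).obj)
    (y : Ind.yoneda.obj Y ⟶ ((restrict k K q).obj V).obj) :
    restrictTensorElem q U V X' Y' (Ind.yoneda.map f ≫ x) (Ind.yoneda.map g ≫ y) =
      Ind.yoneda.map (f ⊗ₘ g) ≫ restrictTensorElem q U V X Y x y := by
  obtain ⟨u, rfl⟩ := (restrictElem k K q X U).surjective x
  obtain ⟨v, rfl⟩ := (restrictElem k K q Y V).surjective y
  simp only [restrictTensorElem, restrictElem_naturality, Equiv.symm_apply_apply]
  rw [← tensorHom_comp_tensorHom, Functor.OplaxMonoidal.δ_natural_assoc]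

lemma restrictTensorElem_balanced (U V : D) {X Y : T} (a : K)
    (x : Ind.yoneda.obj X ⟶ ((restrict k K q).obj U).obj)
    (y : Ind.yoneda.obj Y ⟶ ((restrict k K q).obj V).obj) :
    restrictTensorElem q U V X Y (x ≫ ((restrict k K q).obj U).act a) y =
      restrictTensorElem q U V X Y x (y ≫ ((restrict k K q).obj V).act a) := by
  obtain ⟨u, rfl⟩ := (restrictElem k K q X U).surjective x
  obtain ⟨v, rfl⟩ := (restrictElem k K q Y V).surjective y
  simp only [restrictTensorElem, restrictElem_act, Equiv.symm_apply_apply]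
  simp [MonoidalCategory.tensorHom_def]

variable (k K) in
/-- The morphism of ind-objects underlying `U^K ⊗_K V^K ⟶ (U ⊗ V)^K`. -/
def restrictTensorObjHom (U V : D) :
    tensorObj ((restrict k K q).obj U) ((restrict k K q).obj V) ⟶
      ((restrict k K q).obj (U ⊗ V)).obj :=
  tensorObjDesc (restrictTensorElem q U V) (restrictTensorElem_naturality q U V)
    (restrictTensorElem_balanced q U V)

lemma tensorElem_restrictTensorObjHom {U V : D} {X Y : T} (u : q.obj X ⟶ U) (v : q.obj Y ⟶ V) :
    tensorElem (restrictElem k K q X U u) (restrictElem k K q Y V v) ≫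
      restrictTensorObjHom k K q U V =
        restrictElem k K q (X ⊗ Y) (U ⊗ V) (Functor.OplaxMonoidal.δ q X Y ≫ (u ⊗ₘ v)) := by
  refine (tensorElem_desc _ (restrictTensorElem_naturality q U V)
    (restrictTensorElem_balanced q U V) _ _).trans ?_
  rw [restrictTensorElem, Equiv.symm_apply_apply, Equiv.symm_apply_apply]

lemma tensorAct_restrictTensorObjHom (U V : D) (a : K) :
    tensorAct ((restrict k K q).obj U) ((restrict k K q).obj V) a ≫ restrictTensorObjHom k K q U V =
      restrictTensorObjHom k K q U V ≫ ((restrict k K q).obj (U ⊗ V)).act a :=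
  tensorObj_hom_ext fun X Y x y => by
    obtain ⟨u, rfl⟩ := (restrictElem k K q X U).surjective x
    obtain ⟨v, rfl⟩ := (restrictElem k K q Y V).surjective y
    rw [← Category.assoc, tensorElem_act, restrictElem_act, tensorElem_restrictTensorObjHom]
    refine Eq.trans ?_ (Category.assoc _ _ _)
    rw [tensorElem_restrictTensorObjHom, restrictElem_act]
    simp [MonoidalCategory.tensorHom_def]

lemma tensorMapHom_restrictTensorObjHom {U U' : D} (f : U ⟶ U') (V : D) :
    tensorMapHom ((restrict k K q).map f) ((restrict k K q).obj V) ≫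
      restrictTensorObjHom k K q U' V =
    restrictTensorObjHom k K q U V ≫ ((restrict k K q).map (f ▷ V)).hom :=
  tensorObj_hom_ext fun X Y x y => by
    obtain ⟨u, rfl⟩ := (restrictElem k K q X U).surjective x
    obtain ⟨v, rfl⟩ := (restrictElem k K q Y V).surjective y
    rw [← Category.assoc, ← Category.assoc, tensorElem_map, tensorElem_restrictTensorObjHom,
      restrictElem_map, restrictElem_map, tensorElem_restrictTensorObjHom]
    simp [MonoidalCategory.tensorHom_def, whisker_exchange]

variable (k K) in
/-- The canonical morphism `U^K ⊗_K V^K ⟶ (U ⊗ V)^K`. -/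
def restrictTensorHom (U V : D) :
    IndMod.tensor ((restrict k K q).obj U) ((restrict k K q).obj V) ⟶
      (restrict k K q).obj (U ⊗ V) where
  hom := restrictTensorObjHom k K q U V
  comm a := tensorAct_restrictTensorObjHom q U V a

variable (k K) in
/-- The canonical morphism `U^K ⊗_K V^K ⟶ (U ⊗ V)^K` is natural in `U`. -/
def restrictTensorNat (V : D) :
    restrict k K q ⋙ IndMod.tensorRight ((restrict k K q).obj V) ⟶
      MonoidalCategory.tensorRight V ⋙ restrict k K q where
  app U := restrictTensorHom k K q U V
  naturality _ _ f := IndMod.hom_ext (tensorMapHom_restrictTensorObjHom q f V)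

/-- The functor `q` sends the morphism `Z ⟶ X ⊗ X' ⊗ Z` given by `e : 𝟙_ ⟶ X ⊗ X'` to its analogue
in `D`. -/
lemma map_coev_comp_δ {X X' : T} (e : 𝟙_ T ⟶ X ⊗ X') (Z : T) :
    q.map ((λ_ Z).inv ≫ e ▷ Z ≫ (α_ X X' Z).hom) ≫ Functor.OplaxMonoidal.δ q X (X' ⊗ Z) ≫
      q.obj X ◁ Functor.OplaxMonoidal.δ q X' Z =
    (λ_ (q.obj Z)).inv ≫ (Functor.LaxMonoidal.ε q ≫ q.map e ≫ Functor.OplaxMonoidal.δ q X X') ▷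
      q.obj Z ≫ (α_ _ _ _).hom := by
  have h : (λ_ (q.obj Z)).inv ≫ Functor.LaxMonoidal.ε q ▷ q.obj Z =
      q.map (λ_ Z).inv ≫ Functor.OplaxMonoidal.δ q (𝟙_ T) Z := by
    rw [Functor.OplaxMonoidal.left_unitality]
    simp [← comp_whiskerRight]
  rw [comp_whiskerRight, comp_whiskerRight, Category.assoc, Category.assoc, reassoc_of% h,
    Functor.OplaxMonoidal.δ_natural_left_assoc, Functor.OplaxMonoidal.associativity,
    Functor.map_comp, Functor.map_comp, Category.assoc, Category.assoc]

/-- For `f : A ⟶ X` and `v : q B ⟶ V`, the morphism `q (X' ⊗ (A ⊗ B)) ⟶ V` which corresponds to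
`q f ⊗ v` under duality is the composite of `v` with the image under `q` of the morphism
`X' ⊗ (A ⊗ B) ⟶ B` which corresponds to `f ⊗ B`. -/
lemma δ_comp_tensorLeftHomEquiv_symm {X X' : T} [ExactPairing X X'] {V : D} {A B : T} (f : A ⟶ X)
    (v : q.obj B ⟶ V) :
    let _ := exactPairingMap q X X'
    Functor.OplaxMonoidal.δ q X' (A ⊗ B) ≫
      (tensorLeftHomEquiv (q.obj (A ⊗ B)) (q.obj X) (q.obj X') V).symm
        (Functor.OplaxMonoidal.δ q A B ≫ (q.map f ⊗ₘ v)) =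
    q.map ((tensorLeftHomEquiv (A ⊗ B) X X' B).symm (f ▷ B)) ≫ v := by
  intro _
  change Functor.OplaxMonoidal.δ q X' (A ⊗ B) ≫ q.obj X' ◁ (Functor.OplaxMonoidal.δ q A B ≫
      (q.map f ⊗ₘ v)) ≫ (α_ _ _ _).inv ≫ (Functor.LaxMonoidal.μ q X' X ≫ q.map (ε_ X X') ≫
        Functor.OplaxMonoidal.η q) ▷ V ≫ (λ_ V).hom =
    q.map (X' ◁ (f ▷ B) ≫ (α_ _ _ _).inv ≫ ε_ X X' ▷ B ≫ (λ_ B).hom) ≫ v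
  rw [MonoidalCategory.tensorHom_def]
  have hv : q.obj X' ◁ (q.obj X ◁ v) ≫ (α_ _ _ _).inv ≫ (Functor.LaxMonoidal.μ q X' X ≫
      q.map (ε_ X X') ≫ Functor.OplaxMonoidal.η q) ▷ V ≫ (λ_ V).hom =
      (α_ _ _ _).inv ≫ (Functor.LaxMonoidal.μ q X' X ≫
      q.map (ε_ X X') ≫ Functor.OplaxMonoidal.η q) ▷ q.obj B ≫ (λ_ _).hom ≫ v := by
    rw [← leftUnitor_naturality, ← whisker_exchange_assoc]
    simp
  simp only [MonoidalCategory.whiskerLeft_comp, Category.assoc]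
  have h1 : q.obj X' ◁ Functor.OplaxMonoidal.δ q A B ≫ q.obj X' ◁ q.map f ▷ q.obj B =
      q.obj X' ◁ q.map (f ▷ B) ≫ q.obj X' ◁ Functor.OplaxMonoidal.δ q X B := by
    rw [← MonoidalCategory.whiskerLeft_comp, Functor.OplaxMonoidal.δ_natural_left,
      MonoidalCategory.whiskerLeft_comp]
  have h2 : (Functor.LaxMonoidal.μ q X' X ≫ q.map (ε_ X X') ≫ Functor.OplaxMonoidal.η q) ▷
      q.obj B = Functor.LaxMonoidal.μ q X' X ▷ q.obj B ≫ q.map (ε_ X X') ▷ q.obj B ≫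
        Functor.OplaxMonoidal.η q ▷ q.obj B := by simp only [comp_whiskerRight]
  rw [hv, reassoc_of% h1, Functor.OplaxMonoidal.δ_natural_right_assoc,
    Functor.OplaxMonoidal.associativity_inv_assoc, h2]
  simp only [Category.assoc]
  rw [Functor.Monoidal.whiskerRight_δ_μ_assoc, Functor.OplaxMonoidal.δ_natural_left_assoc,
    Functor.OplaxMonoidal.left_unitality_hom_assoc]
  simp only [Functor.map_comp, Category.assoc]

/-- The canonical morphism `U^K ⊗_K V^K ⟶ (U ⊗ V)^K` is invertible if `U = q X`. The inverse comes
from duality: a morphism `q Z ⟶ q X ⊗ V` amounts to a morphism `q (X' ⊗ Z) ⟶ V`. -/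
lemma isIso_restrictTensorHom_obj (h : ∀ X Y : T, Function.Bijective (homComparison k K q X Y))
    (X X' : T) [ExactPairing X X'] (V : D) :
    IsIso (restrictTensorHom k K q (q.obj X) V) := by
  let _ := exactPairingMap q X X'
  let φ (Z : T) (w : q.obj Z ⟶ q.obj X ⊗ V) :
      Ind.yoneda.obj Z ⟶ tensorObj ((restrict k K q).obj (q.obj X)) ((restrict k K q).obj V) :=
    Ind.yoneda.map ((λ_ Z).inv ≫ η_ X X' ▷ Z ≫ (α_ X X' Z).hom) ≫
      tensorElem (restrictElem k K q X (q.obj X) (𝟙 _))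
        (restrictElem k K q (X' ⊗ Z) V (Functor.OplaxMonoidal.δ q X' Z ≫
          (tensorLeftHomEquiv (q.obj Z) (q.obj X) (q.obj X') V).symm w))
  have hφ {Z Z' : T} (g : Z' ⟶ Z) (w : q.obj Z ⟶ q.obj X ⊗ V) :
      φ Z' (q.map g ≫ w) = Ind.yoneda.map g ≫ φ Z w := by
    have h1 : Functor.OplaxMonoidal.δ q X' Z' ≫
        (tensorLeftHomEquiv (q.obj Z') (q.obj X) (q.obj X') V).symm (q.map g ≫ w) =
        q.map (X' ◁ g) ≫ Functor.OplaxMonoidal.δ q X' Z ≫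
          (tensorLeftHomEquiv (q.obj Z) (q.obj X) (q.obj X') V).symm w := by
      rw [tensorLeftHomEquiv_symm_naturality, Functor.OplaxMonoidal.δ_natural_right_assoc]
    dsimp only [φ]
    rw [h1, ← restrictElem_naturality]
    have h2 := tensorElem_naturality (𝟙 X) (X' ◁ g) (restrictElem k K q X (q.obj X) (𝟙 _))
      (restrictElem k K q (X' ⊗ Z) V (Functor.OplaxMonoidal.δ q X' Z ≫
          (tensorLeftHomEquiv (q.obj Z) (q.obj X) (q.obj X') V).symm w))
    rw [CategoryTheory.Functor.map_id, Category.id_comp] at h2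
    rw [h2, ← Category.assoc (Ind.yoneda.map _), ← Category.assoc (Ind.yoneda.map _),
      ← Functor.map_comp, ← Functor.map_comp]
    congr 2
    rw [id_tensorHom, leftUnitor_inv_naturality_assoc, whisker_exchange_assoc]
    simp
  let ψ : ((restrict k K q).obj (q.obj X ⊗ V)).obj ⟶
      tensorObj ((restrict k K q).obj (q.obj X)) ((restrict k K q).obj V) :=
    indHomMk (fun Z w => φ Z ((restrictElem k K q Z _).symm w)) fun {Z Z'} g w => by
      obtain ⟨w, rfl⟩ := (restrictElem k K q Z _).surjective w
      rw [restrictElem_naturality, Equiv.symm_apply_apply, Equiv.symm_apply_apply, hφ]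
  have hψ {Z : T} (w : q.obj Z ⟶ q.obj X ⊗ V) : restrictElem k K q Z _ w ≫ ψ = φ Z w :=
    (comp_indHomMk _ _ _).trans (by rw [Equiv.symm_apply_apply])
  have h1 : ψ ≫ restrictTensorObjHom k K q (q.obj X) V = 𝟙 _ := ind_hom_ext fun Z w => by
    obtain ⟨w, rfl⟩ := (restrictElem k K q Z _).surjective w
    rw [← Category.assoc, hψ, Category.assoc, tensorElem_restrictTensorObjHom,
      restrictElem_naturality, Category.comp_id]
    congr 1
    refine Eq.trans ?_ ((tensorLeftHomEquiv (q.obj Z) (q.obj X) (q.obj X') V).apply_symm_apply w)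
    rw [id_tensorHom, MonoidalCategory.whiskerLeft_comp, ← Category.assoc, ← Category.assoc,
      Category.assoc (q.map _), map_coev_comp_δ]
    simp only [Category.assoc]
    rfl
  have h2 : restrictTensorObjHom k K q (q.obj X) V ≫ ψ = 𝟙 _ :=
    tensorObj_hom_ext fun A B x y => by
      obtain ⟨u, rfl⟩ := (restrictElem k K q A _).surjective x
      obtain ⟨v, rfl⟩ := (restrictElem k K q B _).surjective y
      obtain ⟨s, rfl⟩ := (h A X).2 u
      rw [Category.comp_id]
      induction s using TensorProduct.induction_on generalizing v with
      | zero => rw [map_zero, restrictElem_zero, tensorElem_zero_left, zero_comp]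
      | add s t hs ht =>
        rw [map_add, restrictElem_add, tensorElem_add_left, Preadditive.add_comp, hs, ht]
      | tmul c f =>
        rw [homComparison_tmul, ← restrictElem_act, tensorElem_balanced, restrictElem_act]
        -- By the balancing relation only `u = q f`, with `f : A ⟶ X`, has to be considered.
        generalize c • v = v
        rw [← Category.assoc, tensorElem_restrictTensorObjHom, hψ]
        dsimp only [φ]
        rw [δ_comp_tensorLeftHomEquiv_symm, ← restrictElem_naturality]
        have h3 := tensorElem_naturality (𝟙 X) ((tensorLeftHomEquiv (A ⊗ B) X X' B).symm (f ▷ B))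
          (restrictElem k K q X (q.obj X) (𝟙 _)) (restrictElem k K q B V v)
        rw [CategoryTheory.Functor.map_id, Category.id_comp] at h3
        have h4 := tensorElem_naturality f (𝟙 B)
          (restrictElem k K q X (q.obj X) (𝟙 _)) (restrictElem k K q B V v)
        rw [CategoryTheory.Functor.map_id, Category.id_comp, restrictElem_naturality,
          Category.comp_id] at h4
        rw [h3, h4, ← Category.assoc, ← Functor.map_comp, tensorHom_id, id_tensorHom]
        congr 2
        refine Eq.trans ?_ ((tensorLeftHomEquiv (A ⊗ B) X X' B).apply_symm_apply (f ▷ B))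
        simp only [Category.assoc]
        rfl
  have : IsIso (forgetInd.map (restrictTensorHom k K q (q.obj X) V)) := ⟨ψ, h2, h1⟩
  exact isIso_of_reflects_iso _ forgetInd

end Tensor

section RestrictIsTensor
variable {k K : Type v} [Field k] [Field K] [Algebra k K]
    {T : Type v} [SmallCategory T] [Abelian T] [Linear k T] [MonoidalCategory T]
    [SymmetricCategory T] [MonoidalPreadditive T] [MonoidalLinear k T]
    [IsRigidTensorCategory k T]
    {D : Type u} [Category.{v} D] [Abelian D] [Linear K D] [MonoidalCategory D]
    [SymmetricCategory D] [MonoidalPreadditive D] [MonoidalLinear K D]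
    [IsRigidTensorCategory K D]
    (q : T ⥤ D) [q.Monoidal] [q.Additive] [IsLinearOver k K q]
    [PreservesFiniteLimits q] [PreservesFiniteColimits q]

/-- Both sides of `U^K ⊗_K V^K ⟶ (U ⊗ V)^K` are right exact in `U`, which reduces the claim to the
case `U = q X`. -/
lemma restrictIsTensor (h : ∀ X Y : T, Function.Bijective (homComparison k K q X Y))
    (hflat : IsFlatOver k K T) (hl : HasLocalLifts q)
    (hq : ∀ U : D, ∃ (X : T) (p : q.obj X ⟶ U), Epi p) : RestrictIsTensor k K q where
  tensor U V := by
    have hiso : IsIso (restrictTensorHom k K q U V) := by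
      have := hl.preservesFiniteColimits_restrict (k := k) (K := K)
      have := (hflat ((restrict k K q).obj V)).2
      have := (tensorRight_exact K V).2
      have : PreservesFiniteColimits
          (restrict k K q ⋙ IndMod.tensorRight ((restrict k K q).obj V)) :=
        comp_preservesFiniteColimits _ _
      have : PreservesFiniteColimits (MonoidalCategory.tensorRight V ⋙ restrict k K q) :=
        comp_preservesFiniteColimits _ _
      refine isIso_of_isIso_obj q hq (restrictTensorNat k K q V) (fun X => ?_) U
      obtain ⟨X', ⟨p⟩⟩ := IsRigidTensorCategory.exists_dual (k := k) X
      exact isIso_restrictTensorHom_obj q h X X' V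
    refine ⟨asIso (restrictTensorHom k K q U V), fun X Y u v => ?_⟩
    exact (Category.assoc _ _ _).symm.trans (tensorElem_restrictTensorObjHom q u v)
  unit := by
    have := isIso_extendToRestrict q h (𝟙_ T)
    refine ⟨asIso (extendToRestrict k K q (𝟙_ T)) ≪≫
      (restrict k K q).mapIso (Functor.Monoidal.εIso q).symm, ?_⟩
    change extendUnit k K _ ≫ (extendToRestrict k K q (𝟙_ T)).hom ≫
      ((restrict k K q).map (Functor.OplaxMonoidal.η q)).hom = _
    refine (Category.assoc _ _ _).symm.trans ?_
    rw [extendUnit_extendToRestrict, restrictElem_map, Category.id_comp]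

end RestrictIsTensor

/-! ### Images -/

section Image

/-- The image of a morphism, read off from any factorization as an epimorphism followed by a
monomorphism. -/
lemma exists_image_iso {D : Type*} [Category* D] [Abelian D] {X Y P : D} (f : X ⟶ Y) (a : X ⟶ P)
    (b : P ⟶ Y) [Epi a] [Mono b] (h : a ≫ b = f) :
    ∃ θ : Abelian.image f ≅ P, θ.hom ≫ b = Abelian.image.ι f := by
  have hb : Abelian.image.ι f ≫ cokernel.π b = 0 := by
    rw [← cancel_epi (Abelian.factorThruImage f), ← Category.assoc, Abelian.image.fac, ← h,
      Category.assoc, cokernel.condition, comp_zero, comp_zero]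
  let θ := Abelian.monoLift b (Abelian.image.ι f) hb
  have hθ : θ ≫ b = Abelian.image.ι f := Abelian.monoLift_comp b _ hb
  have : Mono θ := by
    have : Mono (θ ≫ b) := by rw [hθ]; infer_instance
    exact mono_of_mono θ b
  have hθ' : Abelian.factorThruImage f ≫ θ = a := by
    rw [← cancel_mono b, Category.assoc, hθ, Abelian.image.fac, h]
  have : Epi θ := by
    have : Epi (Abelian.factorThruImage f ≫ θ) := by rw [hθ']; infer_instance
    exact epi_of_epi (Abelian.factorThruImage f) θ
  have := isIso_of_mono_of_epi θ
  exact ⟨asIso θ, hθ⟩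

variable {k K : Type v} [Field k] [Field K] [Algebra k K]
variable {T : Type v} [SmallCategory T] [Abelian T] [Linear k T]

lemma IndMod.nonempty_image_iso {M N P : IndMod k K T} (f : M ⟶ N) (a : M ⟶ P) (b : P ⟶ N)
    [Epi a.hom] [Mono b.hom] (h : a ≫ b = f) : Nonempty (IndMod.image f ≅ P) := by
  obtain ⟨θ, hθ⟩ := exists_image_iso f.hom a.hom b.hom (congrArg IndMod.Hom.hom h)
  let φ : IndMod.image f ⟶ P := ⟨θ.hom, fun c => by
    change IndMod.imageAct f c ≫ θ.hom = θ.hom ≫ P.act c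
    rw [← cancel_mono b.hom, Category.assoc, Category.assoc, hθ, IndMod.imageAct_ι, b.comm,
      ← Category.assoc, hθ]⟩
  have : IsIso (IndMod.forgetInd.map φ) := inferInstanceAs (IsIso θ.hom)
  have := isIso_of_reflects_iso φ IndMod.forgetInd
  exact ⟨asIso φ⟩

end Image

/-! ### The functor `U ↦ U^K` is fully faithful -/

section FullyFaithful
variable {k K : Type v} [Field k] [Field K] [Algebra k K]
variable {T : Type v} [SmallCategory T] [Abelian T] [Linear k T]
variable {D : Type u} [Category.{v} D] [Abelian D] [Linear K D]
variable {q : T ⥤ D} [q.Additive] [PreservesFiniteColimits q] [IsLinearOver k K q]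

lemma IndMod.extendDescElem_comp {X Z : T} {M N : IndMod k K T} (x : Ind.yoneda.obj X ⟶ M.obj)
    (f : M ⟶ N) (s : K ⊗[k] (Z ⟶ X)) :
    extendDescElem x Z s ≫ f.hom = extendDescElem (x ≫ f.hom) Z s := by
  induction s using TensorProduct.induction_on with
  | zero => simp
  | add s t hs ht => simp only [map_add, Preadditive.add_comp, hs, ht]
  | tmul c g => rw [extendDescElem_tmul, extendDescElem_tmul, Category.assoc, Category.assoc,
      Category.assoc, f.comm]

lemma faithful_restrict (hq : ∀ U : D, ∃ (X : T) (p : q.obj X ⟶ U), Epi p) :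
    (restrict k K q).Faithful where
  map_injective {U V f g} h := by
    obtain ⟨X, p, _⟩ := hq U
    rw [← cancel_epi p]
    apply (restrictElem k K q X V).injective
    rw [← restrictElem_map, ← restrictElem_map, h]

/-- A morphism `φ : U^K ⟶ V^K` is determined by its value `g : q X ⟶ V` on the element `p : q X ⟶
U`, where `p` is an epimorphism. The morphism `g` factors through `U`, and the two morphisms `U^K ⟶
V^K` agree on all elements since these lift locally to `q X`. -/
lemma full_restrict (h : ∀ X Y : T, Function.Bijective (homComparison k K q X Y))
    (hl : HasLocalLifts q) (hq : ∀ U : D, ∃ (X : T) (p : q.obj X ⟶ U), Epi p) :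
    (restrict k K q).Full where
  map_surjective {U V} φ := by
    obtain ⟨X, p, _⟩ := hq U
    obtain ⟨g, hg⟩ := (restrictElem k K q X V).surjective (restrictElem k K q X U p ≫ φ.hom)
    have key {Y : T} (r : q.obj Y ⟶ q.obj X) :
        restrictElem k K q Y U (r ≫ p) ≫ φ.hom = restrictElem k K q Y V (r ≫ g) := by
      obtain ⟨s, rfl⟩ := (h Y X).2 r
      rw [← extendDescElem_restrictElem, ← extendDescElem_restrictElem,
        IndMod.extendDescElem_comp, hg]
    have hker : kernel.ι p ≫ g = 0 := by
      obtain ⟨X', r, _⟩ := hq (kernel p)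
      rw [← cancel_epi r, comp_zero, ← Category.assoc]
      apply (restrictElem k K q X' V).injective
      rw [← key, Category.assoc, kernel.condition, comp_zero, restrictElem_zero, zero_comp,
        restrictElem_zero]
    let g' := Abelian.epiDesc p g hker
    have hg' : p ≫ g' = g := Abelian.comp_epiDesc p g hker
    refine ⟨g', restrict_hom_ext q fun Y u => ?_⟩
    obtain ⟨Z, t, _, w, hw⟩ := hl p u
    rw [← cancel_epi (Ind.yoneda.map t), ← Category.assoc, ← Category.assoc,
      restrictElem_naturality, restrictElem_map, ← hw, key, Category.assoc, hg']

end FullyFaithful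

/-! ### The category of triples -/

section Triple
variable {k K : Type v} [Field k] [Field K] [Algebra k K]
variable {T : Type v} [SmallCategory T] [Abelian T] [Linear k T]
variable {D : Type u} [Category.{v} D] [Abelian D] [Linear K D]
variable (q : T ⥤ D) [q.Additive] [PreservesFiniteColimits q] [IsLinearOver k K q]

namespace Triple

/-- The morphism `q X ⟶ q Y` defined by a triple `(X, Y, f)`. -/
def realize (A : Triple k K T) : q.obj A.X ⟶ q.obj A.Y :=
  homComparison k K q A.X A.Y ((extendEquiv k K A.X A.Y).symm A.f)

/-- The image of a triple is `U^K`, with `U` the image of the morphism `q X ⟶ q Y` it defines. This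
uses that `U ↦ U^K` is exact. -/
lemma nonempty_im_iso (h : ∀ X Y : T, Function.Bijective (homComparison k K q X Y))
    (hl : HasLocalLifts q) (A : Triple k K T) :
    Nonempty (A.im ≅ (restrict k K q).obj (Abelian.image (A.realize q))) := by
  have hX := isIso_extendToRestrict q h A.X
  have hY := isIso_extendToRestrict q h A.Y
  let a : extend k K A.X ⟶ (restrict k K q).obj (Abelian.image (A.realize q)) :=
    extendToRestrict k K q A.X ≫ (restrict k K q).map (Abelian.factorThruImage _)
  let b : (restrict k K q).obj (Abelian.image (A.realize q)) ⟶ extend k K A.Y :=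
    (restrict k K q).map (Abelian.image.ι _) ≫ inv (extendToRestrict k K q A.Y)
  have hX' : IsIso (extendToRestrict k K q A.X).hom :=
    inferInstanceAs (IsIso (IndMod.forgetInd.map (extendToRestrict k K q A.X)))
  have : Epi a.hom := by
    have := hl.epi_restrict_map (k := k) (K := K) (Abelian.factorThruImage (A.realize q))
    exact epi_comp (extendToRestrict k K q A.X).hom _
  have : Mono b := inferInstance
  have : Mono b.hom := IndMod.mono_hom_of_mono b
  refine IndMod.nonempty_image_iso _ a b ?_
  rw [← cancel_mono (extendToRestrict k K q A.Y)]
  simp only [a, b, Category.assoc, IsIso.inv_hom_id, Category.comp_id]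
  rw [← Functor.map_comp, Abelian.image.fac, extendLift_eq_extendDesc]
  have := extendDesc_extendToRestrict q ((extendEquiv k K A.X A.Y).symm A.f)
  rw [Equiv.apply_symm_apply] at this
  exact this.symm

instance : (imFunctor (k := k) (K := K) (T := T)).Faithful := ⟨fun h => h⟩
instance : (imFunctor (k := k) (K := K) (T := T)).Full := ⟨fun f => ⟨f, rfl⟩⟩
instance : (imFunctor (k := k) (K := K) (T := T)).Additive := ⟨rfl⟩
instance : (imFunctor (k := k) (K := K) (T := T)).Linear K := ⟨fun _ _ => rfl⟩

instance (X : T) : IsIso (IndMod.imageι (extendLift (extendUnit k K X))) := by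
  have : IsIso (extendLift (extendUnit k K X)).hom := by
    rw [extendLift_unit]; exact inferInstanceAs (IsIso (𝟙 _))
  have : IsIso (IndMod.forgetInd.map (IndMod.imageι (extendLift (extendUnit k K X)))) := by
    change IsIso (Abelian.image.ι (extendLift (extendUnit k K X)).hom)
    have : Epi (Abelian.image.ι (extendLift (extendUnit k K X)).hom) := by
      have : Epi (Abelian.factorThruImage (extendLift (extendUnit k K X)).hom ≫
          Abelian.image.ι (extendLift (extendUnit k K X)).hom) := by
        rw [Abelian.image.fac]; infer_instance
      exact epi_of_epi (Abelian.factorThruImage (extendLift (extendUnit k K X)).hom) _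
    exact isIso_of_mono_of_epi _
  exact isIso_of_reflects_iso _ IndMod.forgetInd

lemma extendMap_extendToRestrict {X Y : T} (g : X ⟶ Y) :
    extendMap g ≫ extendToRestrict k K q Y =
      extendToRestrict k K q X ≫ (restrict k K q).map (q.map g) :=
  extendLift_ext (by
    refine (Category.assoc _ _ _).symm.trans (Eq.trans ?_ (Category.assoc _ _ _))
    rw [extendMap, extendUnit_extendLift, Category.assoc, extendUnit_extendToRestrict,
      extendUnit_extendToRestrict, restrictElem_map, restrictElem_naturality, Category.comp_id,
      Category.id_comp])

/-- The image of the triple `(X, X, id ⊗ u)` is `(q X)^K`. -/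
def ofObjImIso (h : ∀ X Y : T, Function.Bijective (homComparison k K q X Y)) :
    ofObj ⋙ imFunctor ≅ q ⋙ restrict k K q :=
  have := isIso_extendToRestrict q h
  NatIso.ofComponents (fun X =>
      (asIso (IndMod.imageι (extendLift (extendUnit k K X))) :
        IndMod.image (extendLift (extendUnit k K X)) ≅ extend k K X) ≪≫
      asIso (extendToRestrict k K q X)) fun {X Y} g => by
    change ofObjMap g ≫ IndMod.imageι _ ≫ extendToRestrict k K q Y =
      (IndMod.imageι _ ≫ extendToRestrict k K q X) ≫ (restrict k K q).map (q.map g)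
    rw [← Category.assoc, ofObjMap_ι, Category.assoc, Category.assoc, extendMap_extendToRestrict]

end Triple

end Triple

section TripleTensor
variable {k K : Type v} [Field k] [Field K] [Algebra k K]
    {T : Type v} [SmallCategory T] [Abelian T] [Linear k T] [MonoidalCategory T]
    [MonoidalPreadditive T] [MonoidalLinear k T]
    {D : Type u} [Category.{v} D] [Abelian D] [Linear K D] [MonoidalCategory D]
    [MonoidalPreadditive D] [MonoidalLinear K D]
    (q : T ⥤ D) [q.Monoidal] [q.Additive] [IsLinearOver k K q]
open Functor.LaxMonoidal Functor.OplaxMonoidal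

lemma Triple.homComparison_tensorElem {X Y X' Y' : T} (s : K ⊗[k] (X ⟶ Y)) (t : K ⊗[k] (X' ⟶ Y')) :
    homComparison k K q _ _ (tensorElem X Y X' Y' (s ⊗ₜ t)) =
      δ q X X' ≫ (homComparison k K q _ _ s ⊗ₘ homComparison k K q _ _ t) ≫ μ q Y Y' := by
  induction s using TensorProduct.induction_on with
  | zero => simp
  | add s s' hs hs' =>
    simp only [TensorProduct.add_tmul, map_add, hs, hs', MonoidalPreadditive.add_tensor,
      Preadditive.add_comp, Preadditive.comp_add]
  | tmul c f =>
    induction t using TensorProduct.induction_on with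
    | zero => simp
    | add t t' ht ht' =>
      simp only [TensorProduct.tmul_add, map_add, ht, ht', MonoidalPreadditive.tensor_add,
        Preadditive.add_comp, Preadditive.comp_add]
    | tmul c' f' =>
      have : tensorElem X Y X' Y' ((c ⊗ₜ[k] f) ⊗ₜ[k] (c' ⊗ₜ[k] f')) = (c * c') ⊗ₜ[k] (f ⊗ₘ f') := by
        simp [tensorElem]
      rw [this, homComparison_tmul, homComparison_tmul, homComparison_tmul,
        Functor.Monoidal.map_tensor]
      simp [MonoidalCategory.tensorHom_def, smul_smul, mul_comm]

section
variable [SymmetricCategory D] [IsRigidTensorCategory K D] [PreservesFiniteColimits q]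

namespace Triple

lemma realize_tensor (A B : Triple k K T) :
    (A.tensor B).realize q = δ q A.X B.X ≫ (A.realize q ⊗ₘ B.realize q) ≫ μ q A.Y B.Y := by
  change homComparison k K q _ _ ((extendEquiv k K (A.X ⊗ B.X) (A.Y ⊗ B.Y)).symm
    (extendEquiv k K _ _ _)) = _
  rw [Equiv.symm_apply_apply, homComparison_tensorElem]
  rfl

lemma nonempty_image_realize_tensor_iso (A B : Triple k K T) :
    Nonempty (Abelian.image ((A.tensor B).realize q) ≅
      Abelian.image (A.realize q) ⊗ Abelian.image (B.realize q)) := by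
  let a := Abelian.factorThruImage (A.realize q)
  let a' := Abelian.factorThruImage (B.realize q)
  let b := Abelian.image.ι (A.realize q)
  let b' := Abelian.image.ι (B.realize q)
  have : Epi (a ⊗ₘ a') := by
    rw [MonoidalCategory.tensorHom_def]
    have := epi_whiskerRight K (q.obj B.X) a
    have := epi_whiskerLeft K (Abelian.image (A.realize q)) a'
    infer_instance
  have : Mono (b ⊗ₘ b') := by
    rw [MonoidalCategory.tensorHom_def]
    have := mono_whiskerRight K (Abelian.image (B.realize q)) b
    have := mono_whiskerLeft K (q.obj A.Y) b'
    infer_instance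
  let f : q.obj (A.X ⊗ B.X) ⟶ q.obj (A.Y ⊗ B.Y) :=
    δ q A.X B.X ≫ (A.realize q ⊗ₘ B.realize q) ≫ μ q A.Y B.Y
  have hf : (A.tensor B).realize q = f := realize_tensor q A B
  obtain ⟨θ, -⟩ := exists_image_iso f (δ q A.X B.X ≫ (a ⊗ₘ a')) ((b ⊗ₘ b') ≫ μ q A.Y B.Y) (by
    rw [Category.assoc, tensorHom_comp_tensorHom_assoc]
    simp only [a, a', b, b', f, Abelian.image.fac])
  rw [hf]
  exact ⟨θ⟩

/-- The functor `U ↦ U^K` is fully faithful, and its essential image contains the images of triples,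
so sending a triple to its image gives a fully faithful functor to `D`. It is essentially surjective
since every object of `D` is the image of a morphism `q X ⟶ q Y`. -/
lemma exists_equivalence (h : ∀ X Y : T, Function.Bijective (homComparison k K q X Y))
    (hl : HasLocalLifts q) (hq : ∀ U : D, ∃ (X : T) (p : q.obj X ⟶ U), Epi p)
    (hq' : ∀ U : D, ∃ (X : T) (i : U ⟶ q.obj X), Mono i) :
    ∃ e : Triple k K T ≌ D,
      e.functor.Additive ∧ e.functor.Linear K ∧
      Nonempty (ofObj ⋙ e.functor ≅ q) ∧
      Nonempty (e.functor ⋙ restrict k K q ≅ imFunctor) ∧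
      (∀ A B : Triple k K T,
        Nonempty (e.functor.obj (A.tensor B) ≅ e.functor.obj A ⊗ e.functor.obj B)) ∧
      Nonempty (e.functor.obj unit ≅ 𝟙_ D) := by
  let R := restrict k K q
  have : R.Faithful := faithful_restrict hq
  have : R.Full := full_restrict h hl hq
  have hG (A : Triple k K T) : R.essImage (imFunctor.obj A) :=
    ⟨_, ⟨(nonempty_im_iso q h hl A).some.symm⟩⟩
  let L : Triple k K T ⥤ D := Functor.essImage.liftFunctor imFunctor R hG
  let i : L ⋙ R ≅ imFunctor := Functor.essImage.liftFunctorCompIso imFunctor R hG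
  have hi {A B : Triple k K T} (f : A ⟶ B) :
      R.map (L.map f) = i.hom.app A ≫ imFunctor.map f ≫ i.inv.app B :=
    (NatIso.naturality_2 i f).symm
  have : L.Faithful := Functor.Faithful.of_comp_iso i
  have : L.Full := Functor.Full.of_comp_faithful_iso i
  have hL (A : Triple k K T) : Nonempty (L.obj A ≅ Abelian.image (A.realize q)) :=
    ⟨R.preimageIso (i.app A ≪≫ (nonempty_im_iso q h hl A).some)⟩
  have : L.EssSurj := ⟨fun U => by
    obtain ⟨X, p, _⟩ := hq U
    obtain ⟨Y, m, _⟩ := hq' U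
    obtain ⟨s, hs⟩ := (h X Y).2 (p ≫ m)
    let A : Triple k K T := ⟨X, Y, extendEquiv k K X Y s⟩
    have hA : A.realize q = p ≫ m := by rw [realize, Equiv.symm_apply_apply, hs]
    obtain ⟨θ, -⟩ := exists_image_iso (A.realize q) p m hA.symm
    exact ⟨A, ⟨(hL A).some ≪≫ θ⟩⟩⟩
  have hadd : L.Additive := ⟨fun {A B f g} => R.map_injective (by
    rw [R.map_add, hi, hi, hi, imFunctor.map_add, Preadditive.add_comp, Preadditive.comp_add])⟩
  have hlin : L.Linear K := ⟨fun {A B} f c => R.map_injective (by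
    rw [R.map_smul, hi, hi, imFunctor.map_smul, Linear.smul_comp, Linear.comp_smul])⟩
  have hobj : ofObj ⋙ L ≅ q :=
    Functor.fullyFaithfulCancelRight R (Functor.isoWhiskerLeft ofObj i ≪≫ ofObjImIso q h)
  have : L.IsEquivalence := {}
  refine ⟨L.asEquivalence, hadd, hlin, ⟨hobj⟩, ⟨i⟩, fun A B => ?_,
    ⟨hobj.app (𝟙_ T) ≪≫ (Functor.Monoidal.εIso q).symm⟩⟩
  exact ⟨(hL _).some ≪≫ (nonempty_image_realize_tensor_iso q A B).some ≪≫
    ((hL A).some.symm ⊗ᵢ (hL B).some.symm)⟩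

end Triple

end

end TripleTensor

/-! ### Extending a functor along `q` -/

section RelativeAdjoint
variable {A M C : Type*} [Category* A] [Category* M] [Category* C]

/-- A functor `L` which is left adjoint to `S` relative to `R` preserves the colimits which `R`
preserves. -/
lemma preservesColimitsOfShape_of_homEquiv {L : A ⥤ C} {R : A ⥤ M} {S : C ⥤ M}
    (e : ∀ U Z, (L.obj U ⟶ Z) ≃ (R.obj U ⟶ S.obj Z))
    (he' : ∀ {U U' Z} (a : U ⟶ U') (f : L.obj U' ⟶ Z), e U Z (L.map a ≫ f) = R.map a ≫ e U' Z f)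
    (J : Type*) [Category* J] [PreservesColimitsOfShape J R] : PreservesColimitsOfShape J L where
  preservesColimit {F} := ⟨fun {c} hc => ⟨by
    let hR := isColimitOfPreserves R hc
    let t (s : Cocone (F ⋙ L)) : Cocone (F ⋙ R) :=
      { pt := S.obj s.pt
        ι :=
          { app := fun j => e _ _ (s.ι.app j)
            naturality := fun i j a => by
              have := s.w a
              dsimp at this ⊢
              rw [← he', this, Category.comp_id] } }
    exact
      { desc := fun s => (e _ _).symm (hR.desc (t s))
        fac := fun s j => (e _ _).injective ((he' _ _).trans (by
          rw [Equiv.apply_symm_apply]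
          exact hR.fac (t s) j))
        uniq := fun s m hm => (e _ _).injective (by
          rw [Equiv.apply_symm_apply]
          refine hR.hom_ext fun j => ?_
          rw [hR.fac]
          exact (he' _ _).symm.trans (congrArg _ (hm j))) }⟩⟩

end RelativeAdjoint

section Extension
variable {k K : Type v} [Field k] [Field K] [Algebra k K]
variable {T : Type v} [SmallCategory T] [Abelian T] [Linear k T]
variable {D : Type u} [Category.{v} D] [Abelian D] [Linear K D]
variable {C : Type w} [Category.{v} C] [Abelian C] [Linear K C]
variable (q : T ⥤ D) [q.Additive] [PreservesFiniteColimits q] [IsLinearOver k K q]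
variable (ω : T ⥤ C) [ω.Additive] [PreservesFiniteColimits ω] [IsLinearOver k K ω]

variable (k K) in
/-- The canonical morphism `(q X)^K ≅ X ⊗ K ⟶ (ω X)^K`. -/
def restrictToRestrict [∀ X, IsIso (extendToRestrict k K q X)] (X : T) :
    (restrict k K q).obj (q.obj X) ⟶ (restrict k K ω).obj (ω.obj X) :=
  inv (extendToRestrict k K q X) ≫ extendToRestrict k K ω X

section
variable [∀ X, IsIso (extendToRestrict k K q X)]

lemma restrictToRestrict_naturality {X Y : T} (g : X ⟶ Y) :
    (restrict k K q).map (q.map g) ≫ restrictToRestrict k K q ω Y =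
      restrictToRestrict k K q ω X ≫ (restrict k K ω).map (ω.map g) := by
  rw [restrictToRestrict, restrictToRestrict, ← cancel_epi (extendToRestrict k K q X),
    Category.assoc, IsIso.hom_inv_id_assoc, ← Triple.extendMap_extendToRestrict,
    ← Category.assoc, ← Triple.extendMap_extendToRestrict, Category.assoc, IsIso.hom_inv_id_assoc]

lemma extendToRestrict_restrictToRestrict {X : T} {Z : C} (f : ω.obj X ⟶ Z) :
    extendUnit k K X ≫ (extendToRestrict k K q X ≫ restrictToRestrict k K q ω X ≫
      (restrict k K ω).map f).hom = restrictElem k K ω X Z f := by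
  rw [restrictToRestrict, Category.assoc, IsIso.hom_inv_id_assoc]
  refine (Category.assoc _ _ _).symm.trans ?_
  rw [extendUnit_extendToRestrict, restrictElem_map, Category.id_comp]

/-- `(q X)^K` is corepresented by `ω X` with respect to `Z ↦ Z^K`. -/
lemma restrictToRestrict_bijective (X : T) (Z : C) :
    Function.Bijective fun f : ω.obj X ⟶ Z =>
      restrictToRestrict k K q ω X ≫ (restrict k K ω).map f := by
  refine ⟨fun f g h => ?_, fun φ => ?_⟩
  · apply (restrictElem k K ω X Z).injective
    rw [← extendToRestrict_restrictToRestrict q, ← extendToRestrict_restrictToRestrict q]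
    exact congrArg (fun φ => extendUnit k K X ≫ (extendToRestrict k K q X ≫ φ).hom) h
  · obtain ⟨f, hf⟩ := (restrictElem k K ω X Z).surjective
      (extendUnit k K X ≫ (extendToRestrict k K q X ≫ φ).hom)
    refine ⟨f, ?_⟩
    rw [← cancel_epi (extendToRestrict k K q X)]
    exact extendLift_ext ((extendToRestrict_restrictToRestrict q ω f).trans hf)

/-- The functor `Z ↦ Hom_K(U^K, Z^K)` is corepresentable: the objects `U` for which it is so are
stable under cokernels, because `U ↦ U^K` is right exact. -/
lemma leftAdjointObjIsDefined_restrict (hl : HasLocalLifts q)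
    (hq : ∀ U : D, ∃ (X : T) (p : q.obj X ⟶ U), Epi p) (U : D) :
    (restrict k K ω).leftAdjointObjIsDefined ((restrict k K q).obj U) := by
  have hobj (X : T) :
      (restrict k K ω).leftAdjointObjIsDefined ((restrict k K q).obj (q.obj X)) :=
    Functor.CorepresentableBy.isCorepresentable (X := ω.obj X)
      { homEquiv := fun {Z} => Equiv.ofBijective _ (restrictToRestrict_bijective q ω X Z)
        homEquiv_comp := fun g f => by
          change _ ≫ (restrict k K ω).map (f ≫ g) = (_ ≫ (restrict k K ω).map f) ≫ _
          rw [Functor.map_comp, Category.assoc] }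
  have := hl.preservesFiniteColimits_restrict (k := k) (K := K)
  obtain ⟨X, X', r, p, w, -, ⟨hc⟩⟩ := exists_presentation q hq U
  refine Functor.leftAdjointObjIsDefined_of_isColimit (isColimitOfPreserves (restrict k K q) hc) ?_
  rintro (_ | _)
  · exact hobj X'
  · exact hobj X

end

/-- The right exact extension of `ω` along `q`, as a partial left adjoint: `ω_K U` is determined
by `Hom(ω_K U, Z) = Hom_K(U^K, Z^K)`. -/
lemma exists_extension (h : ∀ X Y : T, Function.Bijective (homComparison k K q X Y))
    (hl : HasLocalLifts q) (hq : ∀ U : D, ∃ (X : T) (p : q.obj X ⟶ U), Epi p) :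
    ∃ (L : D ⥤ C) (_ : ω ≅ q ⋙ L), L.Additive ∧ L.Linear K ∧ PreservesFiniteColimits L := by
  have := isIso_extendToRestrict q h
  let R := restrict k K q
  let S := restrict k K ω
  have hdef (U : D) : S.leftAdjointObjIsDefined (R.obj U) :=
    leftAdjointObjIsDefined_restrict q ω hl hq U
  let L : D ⥤ C := ObjectProperty.lift _ R hdef ⋙ S.partialLeftAdjoint
  let e (U : D) (Z : C) : (L.obj U ⟶ Z) ≃ (R.obj U ⟶ S.obj Z) :=
    S.partialLeftAdjointHomEquiv (X := ⟨R.obj U, hdef U⟩)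
  have he {U : D} {Z Z' : C} (f : L.obj U ⟶ Z) (g : Z ⟶ Z') : e U Z' (f ≫ g) = e U Z f ≫ S.map g :=
    S.partialLeftAdjointHomEquiv_comp f g
  have he' {U U' : D} {Z : C} (a : U ⟶ U') (f : L.obj U' ⟶ Z) :
      e U Z (L.map a ≫ f) = R.map a ≫ e U' Z f :=
    S.partialLeftAdjointHomEquiv_map_comp ((ObjectProperty.lift _ R hdef).map a) f
  let η (U : D) : R.obj U ⟶ S.obj (L.obj U) := e U _ (𝟙 _)
  have hη {U : D} {Z : C} (f : L.obj U ⟶ Z) : e U Z f = η U ≫ S.map f := by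
    rw [← he, Category.id_comp]
  have hηL {U U' : D} (a : U ⟶ U') : η U ≫ S.map (L.map a) = R.map a ≫ η U' := by
    rw [← he', ← hη, Category.comp_id]
  let κ := restrictToRestrict k K q ω
  have hκ (X : T) (Z : C) : Function.Bijective fun f : ω.obj X ⟶ Z => κ X ≫ S.map f :=
    restrictToRestrict_bijective q ω X Z
  -- `ω X` and `L (q X)` corepresent the same functor.
  choose θ hθ using fun X => (hκ X (L.obj (q.obj X))).2 (η (q.obj X))
  have hθ' (X : T) : IsIso (θ X) := by
    refine ⟨(e _ _).symm (κ X), (hκ X _).1 ?_, (e _ _).injective ?_⟩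
    · change κ X ≫ S.map _ = κ X ≫ S.map _
      rw [S.map_comp, ← Category.assoc]
      refine (congrArg (· ≫ S.map _) (hθ X)).trans ?_
      rw [← hη, Equiv.apply_symm_apply, S.map_id, Category.comp_id]
    · rw [he, Equiv.apply_symm_apply]
      exact hθ X
  have hnat {X Y : T} (g : X ⟶ Y) : ω.map g ≫ θ Y = θ X ≫ L.map (q.map g) := by
    apply (hκ X _).1
    change κ X ≫ S.map _ = κ X ≫ S.map _
    have h1 : R.map (q.map g) ≫ κ Y = κ X ≫ S.map (ω.map g) := restrictToRestrict_naturality q ω g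
    have hY : κ Y ≫ S.map (θ Y) = η (q.obj Y) := hθ Y
    have hX : κ X ≫ S.map (θ X) = η (q.obj X) := hθ X
    rw [S.map_comp, S.map_comp, ← Category.assoc, ← h1, Category.assoc, hY, ← Category.assoc, hX,
      hηL]
  refine ⟨L, NatIso.ofComponents (fun X => @asIso _ _ _ _ (θ X) (hθ' X)) hnat,
    ⟨fun {U V f g} => ?_⟩, ⟨fun {U V} f c => ?_⟩, ⟨fun J _ _ => ?_⟩⟩
  · apply (e _ _).injective
    rw [hη, hη, hηL, R.map_add, S.map_add, Preadditive.add_comp, Preadditive.comp_add, hηL, hηL]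
  · apply (e _ _).injective
    rw [hη, hη, hηL, R.map_smul, S.map_smul, Linear.smul_comp, Linear.comp_smul, hηL]
  · have := hl.preservesFiniteColimits_restrict (k := k) (K := K)
    exact preservesColimitsOfShape_of_homEquiv e he' J

end Extension

/-! ### Tensor structure of the extension -/

section RightExact
variable {C : Type*} [Category* C] [MonoidalCategory C]

lemma preservesFiniteColimits_tensorRight [BraidedCategory C]
    [∀ Z : C, PreservesFiniteColimits (tensorLeft Z)] (Z : C) :
    PreservesFiniteColimits (tensorRight Z) :=
  preservesFiniteColimits_of_natIso (BraidedCategory.tensorLeftIsoTensorRight Z)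

lemma epi_tensorHom [BraidedCategory C] [∀ Z : C, PreservesFiniteColimits (tensorLeft Z)]
    {X Y X' Y' : C} (f : X ⟶ Y) (g : X' ⟶ Y') [Epi f] [Epi g] : Epi (f ⊗ₘ g) := by
  have := preservesFiniteColimits_tensorRight X'
  have h1 : Epi (f ▷ X') := inferInstanceAs (Epi ((tensorRight X').map f))
  have h2 : Epi (Y ◁ g) := inferInstanceAs (Epi ((tensorLeft Y).map g))
  rw [MonoidalCategory.tensorHom_def]
  infer_instance

/-- A right exact functor `F` preserves cokernels, so a morphism from `F Y` factors through the
image under `F` of a cokernel `p : Y ⟶ U` of `r` as soon as `F r` kills it. -/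
lemma exists_desc_of_isColimit {D E : Type*} [Category* D] [Abelian D] [Category* E] [Abelian E]
    (F : D ⥤ E) [F.Additive] [PreservesFiniteColimits F] {X Y U : D} {r : X ⟶ Y} {p : Y ⟶ U}
    {w : r ≫ p = 0} (hc : IsColimit (CokernelCofork.ofπ p w)) {Z : E} (f : F.obj Y ⟶ Z)
    (hf : F.map r ≫ f = 0) : ∃ g : F.obj U ⟶ Z, F.map p ≫ g = f := by
  have h := CokernelCofork.mapIsColimit _ hc F
  exact ⟨h.desc (CokernelCofork.ofπ f hf), h.fac (CokernelCofork.ofπ f hf) WalkingParallelPair.one⟩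

end RightExact

section ExtensionElem
variable {k K : Type v} [Field k] [Field K] [Algebra k K]
variable {T : Type v} [SmallCategory T] [Abelian T] [Linear k T]
variable {D : Type u} [Category.{v} D] [Abelian D] [Linear K D]
variable {C : Type w} [Category.{v} C] [Abelian C] [Linear K C]
variable {q : T ⥤ D} [q.Additive] [IsLinearOver k K q]
variable {ω : T ⥤ C} [ω.Additive] [IsLinearOver k K ω]
variable {L : D ⥤ C} (θ : ω ≅ q ⋙ L)

/-- For an extension `L` of `ω` along `q`, the morphism `ω X ⟶ L U` defined by a morphism
`u : q X ⟶ U`. -/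
def extensionElem {X : T} {U : D} (u : q.obj X ⟶ U) : ω.obj X ⟶ L.obj U :=
  θ.hom.app X ≫ L.map u

lemma extensionElem_comp {X : T} {U V : D} (u : q.obj X ⟶ U) (f : U ⟶ V) :
    extensionElem θ u ≫ L.map f = extensionElem θ (u ≫ f) := by
  rw [extensionElem, extensionElem, L.map_comp, Category.assoc]

lemma map_extensionElem {X Y : T} (g : Y ⟶ X) {U : D} (u : q.obj X ⟶ U) :
    ω.map g ≫ extensionElem θ u = extensionElem θ (q.map g ≫ u) := by
  rw [extensionElem, extensionElem, L.map_comp, ← Category.assoc, θ.hom.naturality,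
    Category.assoc]
  rfl

lemma epi_extensionElem [PreservesFiniteColimits L] {X : T} {U : D} (u : q.obj X ⟶ U) [Epi u] :
    Epi (extensionElem θ u) :=
  epi_comp (θ.hom.app X) (L.map u)

lemma homComparison_extensionElem [L.Additive] [L.Linear K] {X Y : T} (s : K ⊗[k] (Y ⟶ X)) {U : D}
    (u : q.obj X ⟶ U) :
    homComparison k K ω Y X s ≫ extensionElem θ u =
      extensionElem θ (homComparison k K q Y X s ≫ u) := by
  induction s using TensorProduct.induction_on with
  | zero => simp [extensionElem]
  | add s t hs ht =>
    rw [map_add, map_add, Preadditive.add_comp, Preadditive.add_comp, hs, ht, extensionElem,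
      extensionElem, extensionElem, L.map_add, Preadditive.comp_add]
  | tmul c g =>
    rw [homComparison_tmul, homComparison_tmul, Linear.smul_comp, Linear.smul_comp,
      map_extensionElem, extensionElem, extensionElem, L.map_smul, Linear.comp_smul]

lemma homComparison_one_tmul_id (X : T) : homComparison k K q X X (1 ⊗ₜ 𝟙 X) = 𝟙 (q.obj X) := by
  rw [homComparison_tmul, one_smul, CategoryTheory.Functor.map_id]

/-- A presentation of `U` by objects coming from `T` gives a presentation of `L U`, which is
preserved by right exact functors. -/
lemma exists_desc_extensionElem [L.Additive] [L.Linear K] [PreservesFiniteColimits L]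
    {E : Type*} [Category* E] [Abelian E] (F : C ⥤ E) [F.Additive] [PreservesFiniteColimits F]
    {X X' : T} {s : K ⊗[k] (X' ⟶ X)} {U : D} {p : q.obj X ⟶ U}
    {w : homComparison k K q X' X s ≫ p = 0} (hc : IsColimit (CokernelCofork.ofπ p w)) {Z : E}
    (f : F.obj (ω.obj X) ⟶ Z) (hf : F.map (homComparison k K ω X' X s) ≫ f = 0) :
    ∃ g : F.obj (L.obj U) ⟶ Z, F.map (extensionElem θ p) ≫ g = f := by
  have := comp_preservesFiniteColimits L F
  have h : L.map (homComparison k K q X' X s) ≫ θ.inv.app X =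
      θ.inv.app X' ≫ homComparison k K ω X' X s := by
    have := homComparison_extensionElem θ s (𝟙 (q.obj X))
    rw [Category.comp_id, extensionElem, extensionElem, L.map_id] at this
    rw [← cancel_mono (θ.hom.app X), ← cancel_epi (θ.hom.app X')]
    simp only [Category.assoc, Iso.inv_hom_id_app, Iso.hom_inv_id_app_assoc]
    exact (Eq.trans (congrArg (_ ≫ ·) (Category.comp_id _).symm) (this.trans
      (congrArg (_ ≫ ·) (Category.comp_id _).symm))).symm
  obtain ⟨g, hg⟩ := exists_desc_of_isColimit (L ⋙ F) hc (F.map (θ.inv.app X) ≫ f) (by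
    rw [Functor.comp_map, ← Category.assoc, ← F.map_comp, h, F.map_comp, Category.assoc, hf,
      comp_zero])
  refine ⟨g, ?_⟩
  rw [extensionElem, F.map_comp, Category.assoc]
  refine (congrArg (_ ≫ ·) hg).trans ?_
  rw [← Category.assoc, ← F.map_comp, Iso.hom_inv_id_app, F.map_id, Category.id_comp]

end ExtensionElem

section ExtensionTensor
variable {k K : Type v} [Field k] [Field K] [Algebra k K]
    {T : Type v} [SmallCategory T] [Abelian T] [Linear k T] [MonoidalCategory T]
    [SymmetricCategory T] [MonoidalPreadditive T] [MonoidalLinear k T]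
    {D : Type u} [Category.{v} D] [Abelian D] [Linear K D] [MonoidalCategory D]
    [SymmetricCategory D] [MonoidalPreadditive D] [MonoidalLinear K D]
    [∀ Z : D, PreservesFiniteColimits (tensorLeft Z)]
    {C : Type w} [Category.{v} C] [Abelian C] [Linear K C] [MonoidalCategory C]
    [SymmetricCategory C] [MonoidalPreadditive C] [MonoidalLinear K C]
    [∀ Z : C, PreservesFiniteColimits (tensorLeft Z)]
    {q : T ⥤ D} [q.Braided] [q.Additive] [IsLinearOver k K q]
    {ω : T ⥤ C} [ω.Braided] [ω.Additive] [IsLinearOver k K ω] [PreservesFiniteColimits ω]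
    {L : D ⥤ C} [L.Additive] [L.Linear K] [PreservesFiniteColimits L] (θ : ω ≅ q ⋙ L)
open Functor.LaxMonoidal Functor.OplaxMonoidal

/-- The morphism `ω X ⊗ ω Y ⟶ L (U ⊗ V)` defined by `u : q X ⟶ U` and `v : q Y ⟶ V`. -/
def extensionTensorElem {X Y : T} {U V : D} (u : q.obj X ⟶ U) (v : q.obj Y ⟶ V) :
    ω.obj X ⊗ ω.obj Y ⟶ L.obj (U ⊗ V) :=
  μ ω X Y ≫ extensionElem θ (δ q X Y ≫ (u ⊗ₘ v))

lemma homComparison_extensionTensorElem {X Y X' Y' : T} {U V : D} (s : K ⊗[k] (X' ⟶ X))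
    (t : K ⊗[k] (Y' ⟶ Y)) (u : q.obj X ⟶ U) (v : q.obj Y ⟶ V) :
    (homComparison k K ω X' X s ⊗ₘ homComparison k K ω Y' Y t) ≫ extensionTensorElem θ u v =
      extensionTensorElem θ (homComparison k K q X' X s ≫ u) (homComparison k K q Y' Y t ≫ v) := by
  have h1 : μ ω X' Y' ≫ homComparison k K ω _ _ (Triple.tensorElem X' X Y' Y (s ⊗ₜ t)) =
      (homComparison k K ω X' X s ⊗ₘ homComparison k K ω Y' Y t) ≫ μ ω X Y := by
    rw [Triple.homComparison_tensorElem, Functor.Monoidal.μ_δ_assoc]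
  have h2 : homComparison k K q _ _ (Triple.tensorElem X' X Y' Y (s ⊗ₜ t)) ≫ δ q X Y =
      δ q X' Y' ≫ (homComparison k K q X' X s ⊗ₘ homComparison k K q Y' Y t) := by
    rw [Triple.homComparison_tensorElem, Category.assoc, Category.assoc, Functor.Monoidal.μ_δ,
      Category.comp_id]
  rw [extensionTensorElem, extensionTensorElem, ← Category.assoc, ← h1, Category.assoc,
    homComparison_extensionElem, reassoc_of% h2, tensorHom_comp_tensorHom]

lemma map_extensionTensorElem {X Y X' Y' : T} {U V : D} (f : X' ⟶ X) (g : Y' ⟶ Y)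
    (u : q.obj X ⟶ U) (v : q.obj Y ⟶ V) :
    (ω.map f ⊗ₘ ω.map g) ≫ extensionTensorElem θ u v =
      extensionTensorElem θ (q.map f ≫ u) (q.map g ≫ v) := by
  rw [extensionTensorElem, extensionTensorElem, μ_natural_assoc, map_extensionElem,
    ← δ_natural_assoc, tensorHom_comp_tensorHom]

lemma extensionTensorElem_zero_left {X Y : T} {U V : D} (v : q.obj Y ⟶ V) :
    extensionTensorElem θ (0 : q.obj X ⟶ U) v = 0 := by
  simp [extensionTensorElem, extensionElem]

lemma extensionTensorElem_zero_right {X Y : T} {U V : D} (u : q.obj X ⟶ U) :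
    extensionTensorElem θ u (0 : q.obj Y ⟶ V) = 0 := by
  simp [extensionTensorElem, extensionElem]

include θ in
/-- Morphisms out of `L U ⊗ L V` are determined by their values on the elements `u ⊗ v`. -/
lemma extension_tensor_hom_ext (hq : ∀ U : D, ∃ (X : T) (p : q.obj X ⟶ U), Epi p) {U V : D} {Z : C}
    {f g : L.obj U ⊗ L.obj V ⟶ Z}
    (h : ∀ {X Y : T} (u : q.obj X ⟶ U) (v : q.obj Y ⟶ V),
      (extensionElem θ u ⊗ₘ extensionElem θ v) ≫ f =
        (extensionElem θ u ⊗ₘ extensionElem θ v) ≫ g) : f = g := by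
  obtain ⟨X, p, _⟩ := hq U
  obtain ⟨Y, p', _⟩ := hq V
  have := epi_extensionElem θ p
  have := epi_extensionElem θ p'
  have := epi_tensorHom (extensionElem θ p) (extensionElem θ p')
  exact (cancel_epi _).1 (h p p')

/-- The tensor structure `L U ⊗ L V ⟶ L (U ⊗ V)` is determined by its values on elements. It is
constructed from presentations of `U` and `V`; that its values are right on all elements follows
from the local lifting property. -/
lemma exists_extensionμ (h : ∀ X Y : T, Function.Bijective (homComparison k K q X Y))
    (hl : HasLocalLifts q) (hq : ∀ U : D, ∃ (X : T) (p : q.obj X ⟶ U), Epi p) (U V : D) :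
    ∃ m : L.obj U ⊗ L.obj V ⟶ L.obj (U ⊗ V), ∀ {X Y : T} (u : q.obj X ⟶ U) (v : q.obj Y ⟶ V),
      (extensionElem θ u ⊗ₘ extensionElem θ v) ≫ m = extensionTensorElem θ u v := by
  obtain ⟨X, X', r, p, w, _, ⟨hc⟩⟩ := exists_presentation q hq U
  obtain ⟨Y, Y', r', p', w', _, ⟨hc'⟩⟩ := exists_presentation q hq V
  obtain ⟨s, rfl⟩ := (h X' X).2 r
  obtain ⟨t, rfl⟩ := (h Y' Y).2 r'
  have hR := preservesFiniteColimits_tensorRight (C := C)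
  have hpY := epi_extensionElem θ p
  -- The map factors through `L U ⊗ ω Y`, and then through `L U ⊗ L V`.
  obtain ⟨m₁, hm₁⟩ : ∃ m₁ : L.obj U ⊗ ω.obj Y ⟶ L.obj (U ⊗ V),
      extensionElem θ p ▷ ω.obj Y ≫ m₁ = extensionTensorElem θ p p' := by
    refine exists_desc_extensionElem θ (tensorRight (ω.obj Y)) hc (extensionTensorElem θ p p') ?_
    have := homComparison_extensionTensorElem θ s (1 ⊗ₜ 𝟙 Y) p p'
    rw [w, extensionTensorElem_zero_left, homComparison_one_tmul_id, tensorHom_id] at this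
    exact this
  obtain ⟨m, hm⟩ : ∃ m : L.obj U ⊗ L.obj V ⟶ L.obj (U ⊗ V),
      L.obj U ◁ extensionElem θ p' ≫ m = m₁ := by
    have := preservesFiniteColimits_tensorRight (C := C) (ω.obj Y')
    have : Epi (extensionElem θ p ▷ ω.obj Y') :=
      inferInstanceAs (Epi ((tensorRight (ω.obj Y')).map (extensionElem θ p)))
    refine exists_desc_extensionElem θ (tensorLeft (L.obj U)) hc' m₁ ?_
    rw [← cancel_epi (extensionElem θ p ▷ ω.obj Y'), comp_zero]
    have := homComparison_extensionTensorElem θ (1 ⊗ₜ 𝟙 X) t p p'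
    rw [w', extensionTensorElem_zero_right, homComparison_one_tmul_id, id_tensorHom, ← hm₁] at this
    rw [← this]
    exact (whisker_exchange_assoc _ _ _).symm
  have hpp : (extensionElem θ p ⊗ₘ extensionElem θ p') ≫ m = extensionTensorElem θ p p' := by
    rw [MonoidalCategory.tensorHom_def, Category.assoc, hm, hm₁]
  refine ⟨m, fun {A B} u v => ?_⟩
  obtain ⟨A', a, _, x, hx⟩ := hl p u
  obtain ⟨B', b, _, y, hy⟩ := hl p' v
  obtain ⟨x, rfl⟩ := (h A' X).2 x
  obtain ⟨y, rfl⟩ := (h B' Y).2 y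
  have := epi_tensorHom (ω.map a) (ω.map b)
  rw [← cancel_epi (ω.map a ⊗ₘ ω.map b), map_extensionTensorElem, ← hx, ← hy,
    ← homComparison_extensionTensorElem, ← hpp, tensorHom_comp_tensorHom_assoc,
    tensorHom_comp_tensorHom_assoc, map_extensionElem, map_extensionElem, ← hx, ← hy,
    homComparison_extensionElem, homComparison_extensionElem]

variable (h : ∀ X Y : T, Function.Bijective (homComparison k K q X Y))
    (hl : HasLocalLifts q) (hq : ∀ U : D, ∃ (X : T) (p : q.obj X ⟶ U), Epi p)

/-- The tensor structure `L U ⊗ L V ⟶ L (U ⊗ V)` on an extension `L` of `ω`. -/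
def extensionμ (U V : D) : L.obj U ⊗ L.obj V ⟶ L.obj (U ⊗ V) :=
  (exists_extensionμ θ h hl hq U V).choose

lemma extensionElem_μ {X Y : T} {U V : D} (u : q.obj X ⟶ U) (v : q.obj Y ⟶ V) :
    (extensionElem θ u ⊗ₘ extensionElem θ v) ≫ extensionμ θ h hl hq U V =
      μ ω X Y ≫ extensionElem θ (δ q X Y ≫ (u ⊗ₘ v)) :=
  (exists_extensionμ θ h hl hq U V).choose_spec u v

lemma extensionElem_μ_assoc {X Y : T} {U V : D} (u : q.obj X ⟶ U) (v : q.obj Y ⟶ V) {Z : C}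
    (f : L.obj (U ⊗ V) ⟶ Z) :
    (extensionElem θ u ⊗ₘ extensionElem θ v) ≫ extensionμ θ h hl hq U V ≫ f =
      μ ω X Y ≫ extensionElem θ (δ q X Y ≫ (u ⊗ₘ v)) ≫ f := by
  rw [← Category.assoc, extensionElem_μ, Category.assoc]

lemma extensionμ_naturality {U U' V V' : D} (f : U ⟶ U') (g : V ⟶ V') :
    (L.map f ⊗ₘ L.map g) ≫ extensionμ θ h hl hq U' V' =
      extensionμ θ h hl hq U V ≫ L.map (f ⊗ₘ g) :=
  extension_tensor_hom_ext θ hq fun u v => by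
    rw [tensorHom_comp_tensorHom_assoc, extensionElem_comp, extensionElem_comp, extensionElem_μ,
      extensionElem_μ_assoc, extensionElem_comp, Category.assoc, tensorHom_comp_tensorHom]

/-- Both sides of `L U ⊗ L V ⟶ L (U ⊗ V)` are right exact in `U` and in `V`, which reduces the claim
to the case `U = q X`, `V = q Y`, where the morphism is the tensor structure of `ω`. -/
lemma isIso_extensionμ (U V : D) : IsIso (extensionμ θ h hl hq U V) := by
  have hRC := preservesFiniteColimits_tensorRight (C := C)
  have hRD := preservesFiniteColimits_tensorRight (C := D)
  have hX (X : T) (V : D) : IsIso (extensionμ θ h hl hq (q.obj X) V) := by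
    let α : L ⋙ tensorLeft (L.obj (q.obj X)) ⟶ tensorLeft (q.obj X) ⋙ L :=
      { app := fun V => extensionμ θ h hl hq (q.obj X) V
        naturality := fun V V' g => by
          have := extensionμ_naturality θ h hl hq (𝟙 (q.obj X)) g
          rwa [L.map_id, id_tensorHom, id_tensorHom] at this }
    have := comp_preservesFiniteColimits L (tensorLeft (L.obj (q.obj X)))
    have := comp_preservesFiniteColimits (tensorLeft (q.obj X)) L
    refine isIso_of_isIso_obj q hq α (fun Y => ?_) V
    have h1 := extensionElem_μ θ h hl hq (𝟙 (q.obj X)) (𝟙 (q.obj Y))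
    have hid (X : T) : IsIso (extensionElem θ (𝟙 (q.obj X))) := by
      have : IsIso (L.map (𝟙 (q.obj X))) := inferInstance
      exact IsIso.comp_isIso (f := θ.hom.app X)
    have h2 : IsIso (extensionElem θ (δ q X Y ≫ (𝟙 (q.obj X) ⊗ₘ 𝟙 (q.obj Y)))) := by
      rw [id_tensorHom_id, Category.comp_id]
      exact IsIso.comp_isIso (f := θ.hom.app (X ⊗ Y))
    have h3 : IsIso ((extensionElem θ (𝟙 (q.obj X)) ⊗ₘ extensionElem θ (𝟙 (q.obj Y))) ≫
        extensionμ θ h hl hq (q.obj X) (q.obj Y)) := by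
      rw [h1]; infer_instance
    exact IsIso.of_isIso_comp_left
      (extensionElem θ (𝟙 (q.obj X)) ⊗ₘ extensionElem θ (𝟙 (q.obj Y))) _
  let α : L ⋙ tensorRight (L.obj V) ⟶ tensorRight V ⋙ L :=
    { app := fun U => extensionμ θ h hl hq U V
      naturality := fun U U' f => by
        have := extensionμ_naturality θ h hl hq f (𝟙 V)
        rwa [L.map_id, tensorHom_id, tensorHom_id] at this }
  have := comp_preservesFiniteColimits L (tensorRight (L.obj V))
  have := comp_preservesFiniteColimits (tensorRight V) L
  exact isIso_of_isIso_obj q hq α (fun X => hX X V) U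

/-- The unit `𝟙_ ≅ ω 𝟙_ ≅ L (q 𝟙_) ≅ L 𝟙_`. -/
def extensionεIso : 𝟙_ C ≅ L.obj (𝟙_ D) :=
  Functor.Monoidal.εIso ω ≪≫ θ.app (𝟙_ T) ≪≫ L.mapIso (Functor.Monoidal.εIso q).symm

lemma extensionεIso_hom : (extensionεIso θ).hom = ε ω ≫ extensionElem θ (η q) := rfl

lemma extension_associativity (U V W : D) :
    extensionμ θ h hl hq U V ▷ L.obj W ≫ extensionμ θ h hl hq (U ⊗ V) W ≫ L.map (α_ U V W).hom =
      (α_ (L.obj U) (L.obj V) (L.obj W)).hom ≫ L.obj U ◁ extensionμ θ h hl hq V W ≫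
        extensionμ θ h hl hq U (V ⊗ W) := by
  obtain ⟨X, u, _⟩ := hq U
  obtain ⟨Y, v, _⟩ := hq V
  obtain ⟨Z, w, _⟩ := hq W
  have := epi_extensionElem θ u
  have := epi_extensionElem θ v
  have := epi_extensionElem θ w
  have := epi_tensorHom (extensionElem θ u) (extensionElem θ v)
  have := epi_tensorHom (extensionElem θ u ⊗ₘ extensionElem θ v) (extensionElem θ w)
  rw [← cancel_epi ((extensionElem θ u ⊗ₘ extensionElem θ v) ⊗ₘ extensionElem θ w)]
  have h1 : ((extensionElem θ u ⊗ₘ extensionElem θ v) ⊗ₘ extensionElem θ w) ≫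
      extensionμ θ h hl hq U V ▷ L.obj W =
      μ ω X Y ▷ ω.obj Z ≫ (extensionElem θ (δ q X Y ≫ (u ⊗ₘ v)) ⊗ₘ extensionElem θ w) := by
    rw [← tensorHom_id, tensorHom_comp_tensorHom, extensionElem_μ, Category.comp_id,
      ← tensorHom_id, tensorHom_comp_tensorHom, Category.id_comp]
  have h2 : (extensionElem θ u ⊗ₘ (extensionElem θ v ⊗ₘ extensionElem θ w)) ≫
      L.obj U ◁ extensionμ θ h hl hq V W =
      ω.obj X ◁ μ ω Y Z ≫ (extensionElem θ u ⊗ₘ extensionElem θ (δ q Y Z ≫ (v ⊗ₘ w))) := by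
    rw [← id_tensorHom, tensorHom_comp_tensorHom, extensionElem_μ, Category.comp_id,
      ← id_tensorHom, tensorHom_comp_tensorHom, Category.id_comp]
  have h3 : δ q (X ⊗ Y) Z ≫ ((δ q X Y ≫ (u ⊗ₘ v)) ⊗ₘ w) ≫ (α_ U V W).hom =
      q.map (α_ X Y Z).hom ≫ δ q X (Y ⊗ Z) ≫ (u ⊗ₘ (δ q Y Z ≫ (v ⊗ₘ w))) := by
    have e1 : ((δ q X Y ≫ (u ⊗ₘ v)) ⊗ₘ w) = δ q X Y ▷ q.obj Z ≫ ((u ⊗ₘ v) ⊗ₘ w) := by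
      rw [← tensorHom_id, tensorHom_comp_tensorHom, Category.id_comp]
    have e2 : (u ⊗ₘ (δ q Y Z ≫ (v ⊗ₘ w))) = q.obj X ◁ δ q Y Z ≫ (u ⊗ₘ (v ⊗ₘ w)) := by
      rw [← id_tensorHom, tensorHom_comp_tensorHom, Category.id_comp]
    rw [e1, e2, Category.assoc, associator_naturality, Functor.OplaxMonoidal.associativity_assoc]
  rw [reassoc_of% h1, extensionElem_μ_assoc, extensionElem_comp, Category.assoc, h3,
    associator_naturality_assoc, reassoc_of% h2, extensionElem_μ, ← map_extensionElem]
  exact Functor.LaxMonoidal.associativity_assoc ω X Y Z _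

lemma extension_left_unitality (U : D) : (λ_ (L.obj U)).hom = (extensionεIso θ).hom ▷ L.obj U ≫
    extensionμ θ h hl hq (𝟙_ D) U ≫ L.map (λ_ U).hom := by
  obtain ⟨X, u, _⟩ := hq U
  have := epi_extensionElem θ u
  have : Epi (𝟙_ C ◁ extensionElem θ u) :=
    inferInstanceAs (Epi ((tensorLeft (𝟙_ C)).map (extensionElem θ u)))
  rw [← cancel_epi (𝟙_ C ◁ extensionElem θ u), extensionεIso_hom]
  have h1 : 𝟙_ C ◁ extensionElem θ u ≫ (ε ω ≫ extensionElem θ (η q)) ▷ L.obj U =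
      ε ω ▷ ω.obj X ≫ (extensionElem θ (η q) ⊗ₘ extensionElem θ u) := by
    rw [whisker_exchange, comp_whiskerRight, Category.assoc, MonoidalCategory.tensorHom_def]
  have h2 : δ q (𝟙_ T) X ≫ (η q ⊗ₘ u) ≫ (λ_ U).hom = q.map (λ_ X).hom ≫ u := by
    rw [MonoidalCategory.tensorHom_def, Category.assoc, leftUnitor_naturality,
      left_unitality_hom_assoc]
  rw [reassoc_of% h1, extensionElem_μ_assoc, extensionElem_comp, Category.assoc, h2,
    ← map_extensionElem, leftUnitor_naturality, Functor.LaxMonoidal.left_unitality ω X]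
  simp only [Category.assoc]

lemma extension_right_unitality (U : D) : (ρ_ (L.obj U)).hom = L.obj U ◁ (extensionεIso θ).hom ≫
    extensionμ θ h hl hq U (𝟙_ D) ≫ L.map (ρ_ U).hom := by
  obtain ⟨X, u, _⟩ := hq U
  have := epi_extensionElem θ u
  have := preservesFiniteColimits_tensorRight (𝟙_ C)
  have : Epi (extensionElem θ u ▷ 𝟙_ C) :=
    inferInstanceAs (Epi ((tensorRight (𝟙_ C)).map (extensionElem θ u)))
  rw [← cancel_epi (extensionElem θ u ▷ 𝟙_ C), extensionεIso_hom]
  have h1 : extensionElem θ u ▷ 𝟙_ C ≫ L.obj U ◁ (ε ω ≫ extensionElem θ (η q)) =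
      ω.obj X ◁ ε ω ≫ (extensionElem θ u ⊗ₘ extensionElem θ (η q)) := by
    rw [← whisker_exchange, MonoidalCategory.whiskerLeft_comp, Category.assoc,
      MonoidalCategory.tensorHom_def']
  have h2 : δ q X (𝟙_ T) ≫ (u ⊗ₘ η q) ≫ (ρ_ U).hom = q.map (ρ_ X).hom ≫ u := by
    rw [MonoidalCategory.tensorHom_def', Category.assoc, rightUnitor_naturality,
      right_unitality_hom_assoc]
  rw [reassoc_of% h1, extensionElem_μ_assoc, extensionElem_comp, Category.assoc, h2,
    ← map_extensionElem, rightUnitor_naturality, Functor.LaxMonoidal.right_unitality ω X]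
  simp only [Category.assoc]

lemma extension_braided (U V : D) :
    extensionμ θ h hl hq U V ≫ L.map (β_ U V).hom =
      (β_ (L.obj U) (L.obj V)).hom ≫ extensionμ θ h hl hq V U :=
  extension_tensor_hom_ext θ hq fun {X Y} u v => by
    have h2 : δ q X Y ≫ (u ⊗ₘ v) ≫ (β_ U V).hom = q.map (β_ X Y).hom ≫ δ q Y X ≫ (v ⊗ₘ u) := by
      rw [BraidedCategory.braiding_naturality, Functor.map_braiding, Category.assoc, Category.assoc,
        Functor.Monoidal.μ_δ_assoc]
    rw [extensionElem_μ_assoc, extensionElem_comp, Category.assoc, h2, ← map_extensionElem,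
      BraidedCategory.braiding_naturality_assoc, extensionElem_μ, ← Category.assoc,
      Functor.LaxBraided.braided, Category.assoc]

/-- An extension of `ω` along `q` is a tensor functor. -/
def extensionCoreMonoidal : L.CoreMonoidal where
  εIso := extensionεIso θ
  μIso U V := @asIso _ _ _ _ (extensionμ θ h hl hq U V) (isIso_extensionμ θ h hl hq U V)
  μIso_hom_natural_left f V := by
    have := extensionμ_naturality θ h hl hq f (𝟙 V)
    rwa [L.map_id, tensorHom_id, tensorHom_id] at this
  μIso_hom_natural_right V f := by
    have := extensionμ_naturality θ h hl hq (𝟙 V) f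
    rwa [L.map_id, id_tensorHom, id_tensorHom] at this
  associativity := extension_associativity θ h hl hq
  left_unitality := extension_left_unitality θ h hl hq
  right_unitality := extension_right_unitality θ h hl hq

/-- An extension of `ω` along `q` is a symmetric tensor functor. -/
@[reducible]
def extensionBraided : L.Braided :=
  { (extensionCoreMonoidal θ h hl hq).toMonoidal with
    braided := extension_braided θ h hl hq }

lemma isMonoidal_extension :
    let _ := extensionBraided θ h hl hq
    NatTrans.IsMonoidal θ.hom := by
  intro _
  refine ⟨?_, fun X Y => ?_⟩
  · change ε ω ≫ θ.hom.app (𝟙_ T) = (extensionεIso θ).hom ≫ L.map (ε q)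
    rw [extensionεIso_hom, Category.assoc, extensionElem_comp, Functor.Monoidal.η_ε, extensionElem,
      L.map_id]
    exact congrArg (_ ≫ ·) (Category.comp_id _).symm
  · change μ ω X Y ≫ θ.hom.app (X ⊗ Y) =
      (θ.hom.app X ⊗ₘ θ.hom.app Y) ≫ extensionμ θ h hl hq (q.obj X) (q.obj Y) ≫ L.map (μ q X Y)
    have hid (X : T) : θ.hom.app X = extensionElem θ (𝟙 (q.obj X)) := by
      rw [extensionElem, L.map_id]
      exact (Category.comp_id _).symm
    rw [hid X, hid Y, extensionElem_μ_assoc, extensionElem_comp, id_tensorHom_id, Category.comp_id,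
      Functor.Monoidal.δ_μ, hid]

end ExtensionTensor

end TensorBC

end

theorem corollary5p5 {k K : Type v} [Field k] [Field K] [Algebra k K]
    {T : Type v} [SmallCategory T] [Abelian T] [Linear k T] [MonoidalCategory T]
    [SymmetricCategory T] [MonoidalPreadditive T] [MonoidalLinear k T]
    [TensorBC.IsRigidTensorCategory k T]
    {TK : Type u} [Category.{v} TK] [Abelian TK] [Linear K TK] [MonoidalCategory TK]
    [SymmetricCategory TK] [MonoidalPreadditive TK] [MonoidalLinear K TK]
    [TensorBC.IsRigidTensorCategory K TK]
    (q : T ⥤ TK) [q.Braided] [q.Additive] [TensorBC.IsLinearOver k K q]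
    [PreservesFiniteLimits q] [PreservesFiniteColimits q]
    (hq : TensorBC.IsBaseChange q)
    (hflat : TensorBC.IsFlatOver k K T) :
    ((TensorBC.restrict k K q).Additive ∧ (TensorBC.restrict k K q).Linear K ∧
      PreservesFiniteLimits (TensorBC.restrict k K q) ∧
      PreservesFiniteColimits (TensorBC.restrict k K q) ∧
      TensorBC.RestrictIsTensor k K q) ∧
    (∃ e : TensorBC.Triple k K T ≌ TK,
      e.functor.Additive ∧ e.functor.Linear K ∧
      Nonempty (TensorBC.Triple.ofObj ⋙ e.functor ≅ q) ∧
      Nonempty (e.functor ⋙ TensorBC.restrict k K q ≅ TensorBC.Triple.imFunctor) ∧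
      (∀ A B : TensorBC.Triple k K T,
        Nonempty (e.functor.obj (A.tensor B) ≅ e.functor.obj A ⊗ e.functor.obj B)) ∧
      Nonempty (e.functor.obj TensorBC.Triple.unit ≅ 𝟙_ TK)) ∧
    (∀ {C : Type w} [Category.{v} C] [Abelian C] [Linear K C] [MonoidalCategory C]
      [SymmetricCategory C] [MonoidalPreadditive C] [MonoidalLinear K C]
      [∀ Z : C, PreservesFiniteColimits (tensorLeft Z)]
      (ω : T ⥤ C) [ω.Braided] [ω.Additive] [TensorBC.IsLinearOver k K ω]
      [PreservesFiniteLimits ω] [PreservesFiniteColimits ω],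
      ∃ (ωK : TK ⥤ C) (_ : ωK.Braided), ωK.Additive ∧ ωK.Linear K ∧
        ∃ α : q ⋙ ωK ≅ ω, NatTrans.IsMonoidal α.hom) := by
  have h (X Y : T) : Function.Bijective (TensorBC.homComparison k K q X Y) :=
    hq.homComparison_bijective q X Y
  have hl : TensorBC.HasLocalLifts q := fun {U V} p _ X v =>
    TensorBC.exists_lift q h hflat hq.exists_epi p v
  refine ⟨⟨inferInstance, inferInstance, inferInstance, hl.preservesFiniteColimits_restrict,
    TensorBC.restrictIsTensor q h hflat hl hq.exists_epi⟩,
    TensorBC.Triple.exists_equivalence q h hl hq.exists_epi hq.exists_mono, ?_⟩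
  intro C _ _ _ _ _ _ _ _ ω _ _ _ _ _
  have hTK (Z : TK) : PreservesFiniteColimits (tensorLeft Z) := (TensorBC.tensorLeft_exact K Z).2
  obtain ⟨L, θ, hadd, hlin, hcolim⟩ := TensorBC.exists_extension q ω h hl hq.exists_epi
  let B : L.Braided := TensorBC.extensionBraided θ h hl hq.exists_epi
  have hθ : NatTrans.IsMonoidal θ.hom := TensorBC.isMonoidal_extension θ h hl hq.exists_epi
  exact ⟨L, B, hadd, hlin, θ.symm, inferInstanceAs (NatTrans.IsMonoidal θ.inv)⟩
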